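/- Let $G_1,\dots,G_r$ be groups, where $G_j=\pi_1X_j$ for a based connected nonpositively curved cube complex $X_j$ (i.e. a cube complex whose universal cover $\widetilde X_j$ is a CAT(0) cube complex), and let $\langle G_1,\dots,G_r\mid R_1,\dots,R_s\rangle$ be a presentation over the free product $G_1*\cdots*G_r$, where each $R_i$ is a cyclically reduced word (its first and last syllables exist and lie in different factors). Let $|\cdot|_*$ denote the syllable length of normal forms. A normal form $W$ is weakly cyclically reduced if $|W|_*\le 1$ or its last syllable is not the inverse of its first. A normal form $P$ is a piece of $(i,W)$ and $(j,W')$ if $W$, $W'$ are weakly cyclically reduced conjugates of $R_i^{\pm1}$, $R_j^{\pm1}$ with $(i,W)\ne(j,W')$, and $W=P\cdot U$, $W'=P\cdot U'$ for normal forms $U,U'$ such that the last syllable of $P$ is not the inverse of the first syllable of $U$ or of $U'$. The presentation is $C'_*(\alpha)$ if $|P|_*<\alpha|W|_*$ for each such piece. For $q\ge1$ let $X$ be the long wedge: the union of $X_1,\dots,X_r$ and of edges $e_1,\dots,e_r$ with a common initial vertex, where $e_j$ ends at the base vertex of $X_j$ and each $e_j$ is subdivided into $q$ edges. For $R_i=h_1\cdots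 h_t$ with $h_k\in G_{m(k)}$ let $V_k$ be the combinatorial convex hull in $\widetilde X_{m(k)}$ of the base vertex $p$ and $h_kp$, let $\sigma_k$ be a copy of the subdivided path $e_{m(k)}^{-1}e_{m(k+1)}$ (indices mod $t$), and let $Y_i\to X$ be the necklace obtained by gluing the terminal vertex $h_kp$ of $V_k$ to the initial vertex of $\sigma_k$ and the terminal vertex of $\sigma_k$ to the initial vertex $p$ of $V_{k+1}$. Let $X^*=\langle X\mid Y_1,\dots,Y_s\rangle$, i.e. $X$ with a cone on each $Y_i$ attached. For $\alpha>0$, $X^*$ is $C'(\alpha)$ if every cone-piece and every wall-piece $P$ in $Y_i$ satisfies $\operatorname{diam}(P)<\alpha\,\operatorname{sys}(Y_i)$, where $\operatorname{sys}$ is the infimal length of an essential combinatorial closed path and $\operatorname{diam}$ refers to the combinatorial path metric of $P$. A cone-piece is a component of the intersection (fibre product, if the lifts are not embeddings) of a lift of $Y_i$ and a lift of some $Y_j$ to the universal cover $\widetilde{X^*}$, excluding the components along which $i=j$ and the two lifts coincide up to an automorphism of $Y_i$ over $X$; a wall-piece is a component of the part of a lift of $Y_i$ that lies in the carrier of a hyperplane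 of $\widetilde{X^*}$ disjoint from this lift. **Lemma.** Let $n\ge1$ be an integer. If $\langle G_1,\dots,G_r\mid R_1,\dots,R_s\rangle$ is $C'_*(\frac1n)$, then there is $q_0$ such that for all $q\ge q_0$ the cubical presentation $X^*$ built with $q$-fold subdivided edges $e_1,\dots,e_r$ is $C'(\frac1n)$. -/

import Mathlib

open scoped ENNReal

universe u v

noncomputable section

namespace CubicalSC

/-! ### Cube complexes

A cube complex is recorded through its vertices, its oriented edges and its squares.  In a
nonpositively curved cube complex the cubes of higher dimension are determined by the squares, and
combinatorial paths, their homotopy, the combinatorial metric, hyperplanes, and the vertices and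
edges of carriers only depend on the vertices, edges and squares. -/

/-- Vertices, oriented edges (`inv` reverses an edge) and squares. `sq a b a' b'` says that
there is a square with a corner at which the edges `a`, `b` start, where `a'` is the side opposite
to `a` and `b'` is the side opposite to `b`, so that the two paths `a b'` and `b a'` together
bound the square. -/
structure CubeCx where
  V : Type v
  E : Type v
  src : E → V
  inv : E → E
  inv_inv : ∀ e, inv (inv e) = e
  inv_ne : ∀ e, inv e ≠ e
  sq : E → E → E → E → Prop
  sq_corner : ∀ {a b a' b'}, sq a b a' b' →
    src a = src b ∧ src b' = src (inv a) ∧ src a' = src (inv b) ∧ src (inv a') = src (inv b')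
  sq_swap : ∀ {a b a' b'}, sq a b a' b' → sq b a b' a'
  sq_flip : ∀ {a b a' b'}, sq a b a' b' → sq (inv a) b' (inv a') b

namespace CubeCx

/-- The terminal vertex of an oriented edge. -/
def tgt (C : CubeCx.{v}) (e : C.E) : C.V := C.src (C.inv e)

/-- Combinatorial maps. -/
structure Hom (C D : CubeCx.{v}) where
  onV : C.V → D.V
  onE : C.E → D.E
  src_comp : ∀ e, D.src (onE e) = onV (C.src e)
  inv_comp : ∀ e, D.inv (onE e) = onE (C.inv e)
  sq_comp : ∀ {a b a' b'}, C.sq a b a' b' → D.sq (onE a) (onE b) (onE a') (onE b')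

/-- `C.IsPath x l y`: the list of edges `l` is a combinatorial path from `x` to `y`. -/
def IsPath (C : CubeCx.{v}) : C.V → List C.E → C.V → Prop
  | x, [], y => x = y
  | x, e :: l, y => C.src e = x ∧ IsPath C (C.tgt e) l y

theorem IsPath.append {C : CubeCx.{v}} {x y z : C.V} {l m : List C.E}
    (h : C.IsPath x l y) (k : C.IsPath y m z) : C.IsPath x (l ++ m) z := by
  induction l generalizing x with
  | nil => cases h; exact k
  | cons e l ih => exact ⟨h.1, ih h.2⟩

theorem IsPath.snoc {C : CubeCx.{v}} {x y : C.V} {l : List C.E} {e : C.E}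
    (h : C.IsPath x l y) (k : C.src e = y) : C.IsPath x (l ++ [e]) (C.tgt e) :=
  h.append ⟨k, rfl⟩

/-- The elementary moves between paths: remove a backtrack, push the path across a square, remove
a subpath that belongs to the set `K` of closed paths. -/
inductive Step (C : CubeCx.{v}) (K : List C.E → Prop) : List C.E → List C.E → Prop
  | backtrack (l m : List C.E) (e : C.E) : Step C K (l ++ e :: C.inv e :: m) (l ++ m)
  | square (l m : List C.E) {a b a' b' : C.E} (h : C.sq a b a' b') :
      Step C K (l ++ a :: b' :: m) (l ++ b :: a' :: m)
  | kill (l m : List C.E) {c : List C.E} (h : K c) : Step C K (l ++ c ++ m) (l ++ m)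

theorem Step.append {C : CubeCx.{v}} {K : List C.E → Prop} {l m : List C.E}
    (h : Step C K l m) (t : List C.E) : Step C K (l ++ t) (m ++ t) := by
  cases h with
  | backtrack l m e => simpa using Step.backtrack l (m ++ t) e
  | square l m h => simpa using Step.square l (m ++ t) h
  | kill l m h => simpa using Step.kill l (m ++ t) h

/-- The paths that start at `x₀`. -/
structure PathFrom (C : CubeCx.{v}) (x₀ : C.V) where
  last : C.V
  edges : List C.E
  isPath : C.IsPath x₀ edges last

namespace PathFrom

variable {C : CubeCx.{v}} {x₀ : C.V}

/-- The constant path. -/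
def const (C : CubeCx.{v}) (x₀ : C.V) : C.PathFrom x₀ := ⟨x₀, [], rfl⟩

/-- Prolong a path by an edge. -/
def snoc (p : C.PathFrom x₀) (e : C.E) (h : C.src e = p.last) : C.PathFrom x₀ :=
  ⟨C.tgt e, p.edges ++ [e], p.isPath.snoc h⟩

/-- Two paths with the same endpoints that differ by an elementary move. -/
def Rel (K : List C.E → Prop) (p p' : C.PathFrom x₀) : Prop :=
  p.last = p'.last ∧ C.Step K p.edges p'.edges

end PathFrom

/-- A closed path at `x` is null-homotopic if it is related to the constant path by elementary
moves (through paths from `x` to `x`) in which nothing but backtracks and squares is used. -/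
def NullHomotopic (C : CubeCx.{v}) {x : C.V} {l : List C.E} (h : C.IsPath x l x) : Prop :=
  Quot.mk (PathFrom.Rel fun _ => False) (⟨x, l, h⟩ : C.PathFrom x) =
    Quot.mk (PathFrom.Rel fun _ => False) (PathFrom.const C x)

/-- The systole: the infimal length of an essential combinatorial closed path
(`⊤` if there is none). -/
def systole (C : CubeCx.{v}) : ℝ≥0∞ :=
  ⨅ (x : C.V) (l : List C.E) (h : C.IsPath x l x) (_ : ¬ C.NullHomotopic h), (l.length : ℝ≥0∞)

/-! ### The cover of paths modulo elementary moves

For a set `K` of closed paths, the covering space of `C` whose fundamental group is normally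
generated by the loops that are conjugate to elements of `K`: a vertex is a class of paths
starting at `x₀`, modulo the elementary moves. -/

section Cover

variable (C : CubeCx.{v}) (K : List C.E → Prop) (x₀ : C.V)

/-- The vertices of the cover. -/
abbrev CoverV : Type v := Quot (PathFrom.Rel (x₀ := x₀) K)

/-- A path from `x₀` followed by a marked edge. -/
structure PathEdge where
  path : C.PathFrom x₀
  edge : C.E
  src_edge : C.src edge = path.last

variable {C x₀}

/-- The path of a marked edge, prolonged by that edge. -/
def PathEdge.prolong (p : C.PathEdge x₀) : C.PathFrom x₀ := p.path.snoc p.edge p.src_edge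

/-- The same edge, reversed. -/
def PathEdge.rev (p : C.PathEdge x₀) : C.PathEdge x₀ := ⟨p.prolong, C.inv p.edge, rfl⟩

/-- Same edge, and paths that differ by an elementary move. -/
def PathEdge.Rel (p p' : C.PathEdge x₀) : Prop :=
  PathFrom.Rel K p.path p'.path ∧ p.edge = p'.edge

theorem PathEdge.Rel.prolong {K : List C.E → Prop} {p p' : C.PathEdge x₀}
    (h : PathEdge.Rel K p p') : PathFrom.Rel K p.prolong p'.prolong := by
  obtain ⟨⟨h1, h2⟩, h3⟩ := h
  refine ⟨congrArg C.tgt h3, ?_⟩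
  have := h2.append [p.edge]
  simpa [PathEdge.prolong, PathFrom.snoc, h3] using this

theorem PathEdge.Rel.rev {K : List C.E → Prop} {p p' : C.PathEdge x₀}
    (h : PathEdge.Rel K p p') : PathEdge.Rel K p.rev p'.rev :=
  ⟨h.prolong, congrArg C.inv h.2⟩

variable (C x₀)

/-- The oriented edges of the cover. -/
abbrev CoverE : Type v := Quot (PathEdge.Rel (C := C) (x₀ := x₀) K)

variable {C x₀}

theorem PathEdge.mk_eq {p p' : C.PathFrom x₀} {e : C.E} (h : C.src e = p.last)
    (h' : C.src e = p'.last) (hp : PathFrom.Rel K p p') :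
    (Quot.mk _ ⟨p, e, h⟩ : C.CoverE K x₀) = Quot.mk _ ⟨p', e, h'⟩ :=
  Quot.sound ⟨hp, rfl⟩

theorem PathFrom.backtrack_rel (p : C.PathFrom x₀) (e f : C.E) (h : C.src e = p.last)
    (hf : f = C.inv e) (h' : C.src f = (p.snoc e h).last) :
    PathFrom.Rel K ((p.snoc e h).snoc f h') p := by
  subst hf
  refine ⟨?_, ?_⟩
  · simp [PathFrom.snoc, CubeCx.tgt, C.inv_inv, h]
  · simpa [PathFrom.snoc] using Step.backtrack (K := K) p.edges [] e

theorem PathFrom.square_rel (p : C.PathFrom x₀) {a b a' b' : C.E} (h : C.sq a b a' b')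
    (ha : C.src a = p.last) (hb : C.src b = p.last)
    (ha' : C.src a' = (p.snoc b hb).last) (hb' : C.src b' = (p.snoc a ha).last) :
    PathFrom.Rel K ((p.snoc a ha).snoc b' hb') ((p.snoc b hb).snoc a' ha') := by
  refine ⟨(C.sq_corner h).2.2.2.symm, ?_⟩
  simpa [PathFrom.snoc] using Step.square (K := K) p.edges [] h

theorem PathEdge.square_mk_eq (p : C.PathFrom x₀) {a b a' b' : C.E} (h : C.sq a b a' b')
    (ha : C.src a = p.last) (hb : C.src b = p.last)
    (ha' : C.src a' = (p.snoc b hb).last) (hb' : C.src b' = (p.snoc a ha).last) :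
    (Quot.mk _ ((p.snoc a ha).snoc b' hb') : C.CoverV K x₀) =
      Quot.mk _ ((p.snoc b hb).snoc a' ha') :=
  Quot.sound (PathFrom.square_rel K p h ha hb ha' hb')

/-- Squares of the cover: the lifts of the squares of `C`. -/
inductive CoverSq : C.CoverE K x₀ → C.CoverE K x₀ → C.CoverE K x₀ → C.CoverE K x₀ → Prop
  | mk (p : C.PathFrom x₀) {a b a' b' : C.E} (h : C.sq a b a' b')
      (ha : C.src a = p.last) (hb : C.src b = p.last)
      (ha' : C.src a' = (p.snoc b hb).last) (hb' : C.src b' = (p.snoc a ha).last) :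
      CoverSq (Quot.mk _ ⟨p, a, ha⟩) (Quot.mk _ ⟨p, b, hb⟩)
        (Quot.mk _ ⟨p.snoc b hb, a', ha'⟩) (Quot.mk _ ⟨p.snoc a ha, b', hb'⟩)

variable (C x₀)

/-- The covering space of `C` in which exactly the closed paths of `K`, their conjugates, and
what these generate become null-homotopic. -/
def cover : CubeCx.{v} where
  V := C.CoverV K x₀
  E := C.CoverE K x₀
  src := Quot.lift (fun p => Quot.mk _ p.path) fun _ _ h => Quot.sound h.1
  inv := Quot.map PathEdge.rev fun _ _ h => h.rev
  inv_inv := by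
    rintro ⟨p, e, h⟩
    change Quot.mk _ _ = Quot.mk _ _
    refine Quot.sound ⟨PathFrom.backtrack_rel K p e _ h rfl rfl, C.inv_inv e⟩
  inv_ne := by
    rintro ⟨p, e, h⟩ hh
    have : C.inv e = e := congrArg (Quot.lift (fun p : C.PathEdge x₀ => p.edge)
      fun _ _ h => h.2) hh
    exact C.inv_ne e this
  sq := CoverSq K
  sq_corner := by
    rintro _ _ _ _ ⟨p, h, ha, hb, ha', hb'⟩
    refine ⟨rfl, rfl, rfl, ?_⟩
    exact (PathEdge.square_mk_eq K p h ha hb ha' hb').symm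
  sq_swap := by
    rintro _ _ _ _ ⟨p, h, ha, hb, ha', hb'⟩
    exact CoverSq.mk p (C.sq_swap h) hb ha hb' ha'
  sq_flip := by
    rintro _ _ _ _ ⟨p, h, ha, hb, ha', hb'⟩
    rename_i a b a' b'
    have hc := C.sq_corner h
    have e1 : C.src (C.inv a') = ((p.snoc a ha).snoc b' hb').last := hc.2.2.2
    have e2 : C.src b = ((p.snoc a ha).snoc (C.inv a) rfl).last := by
      change _ = C.src (C.inv (C.inv a))
      rw [C.inv_inv, hb, ha]
    have key := CoverSq.mk (K := K) (p.snoc a ha) (C.sq_flip h) rfl hb' e1 e2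
    have f1 : (Quot.mk _ ⟨(p.snoc a ha).snoc b' hb', C.inv a', e1⟩ : C.CoverE K x₀) =
        Quot.mk _ ⟨(p.snoc b hb).snoc a' ha', C.inv a', rfl⟩ :=
      Quot.sound ⟨PathFrom.square_rel K p h ha hb ha' hb', rfl⟩
    have f2 : (Quot.mk _ ⟨(p.snoc a ha).snoc (C.inv a) rfl, b, e2⟩ : C.CoverE K x₀) =
        Quot.mk _ ⟨p, b, hb⟩ :=
      PathEdge.mk_eq K e2 hb (PathFrom.backtrack_rel K p a _ ha rfl rfl)
    rw [f1, f2] at key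
    exact key

/-- The covering map. -/
def coverProj : Hom (C.cover K x₀) C where
  onV := Quot.lift (fun p => p.last) fun _ _ h => h.1
  onE := Quot.lift (fun p => p.edge) fun _ _ h => h.2
  src_comp := by
    rintro ⟨p, e, h⟩
    exact h
  inv_comp := by
    rintro ⟨p, e, h⟩
    rfl
  sq_comp := by
    rintro _ _ _ _ ⟨p, h, ha, hb, ha', hb'⟩
    exact h

end Cover

/-! ### Hyperplanes and carriers -/

/-- Two oriented edges are parallel if they are dual to the same hyperplane: the equivalence
relation generated by reversing an edge and by passing to the opposite side of a square. The
hyperplanes are the classes. -/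
def Parallel (C : CubeCx.{v}) : C.E → C.E → Prop :=
  Relation.EqvGen fun e e' => e' = C.inv e ∨ ∃ b b', C.sq e b e' b'

/-- The vertices of the carrier of the hyperplane dual to `e` (the union of the closed cubes that
meet the hyperplane): the endpoints of the dual edges. -/
def CarrierV (C : CubeCx.{v}) (e : C.E) (x : C.V) : Prop := ∃ e', C.Parallel e e' ∧ C.src e' = x

/-- The edges of the carrier of the hyperplane dual to `e`: the dual edges, and the sides of the
squares that have a dual edge as a side. -/
def CarrierE (C : CubeCx.{v}) (e : C.E) (d : C.E) : Prop :=
  C.Parallel e d ∨ ∃ b d' b', C.sq d b d' b' ∧ C.Parallel e b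

end CubeCx

open CubeCx

/-! ### Cubical presentations and pieces -/

/-- The data of a cubical presentation `⟨X | Y i, i : I⟩`: maps `Y i → X`. The vertex `base` of
the (connected) complex `X` is only used to construct the universal cover. -/
structure CubicalPresentation where
  X : CubeCx.{v}
  I : Type
  Y : I → CubeCx.{v}
  map : ∀ i, Hom (Y i) X
  base : X.V

namespace CubicalPresentation

variable (P : CubicalPresentation.{v})

/-- The closed paths of `X` that are images of closed paths of some `Y i`. They are the paths that
the cones on the `Y i` make null-homotopic. -/
def ConePath (c : List P.X.E) : Prop :=
  ∃ (i : P.I) (y : (P.Y i).V) (d : List (P.Y i).E), (P.Y i).IsPath y d y ∧ c = d.map (P.map i).onE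

/-- The cubical part of the universal cover of `X` with a cone attached on each `Y i`, i.e. the
preimage of `X` in this universal cover. -/
def cubicalPart : CubeCx.{v} := P.X.cover P.ConePath P.base

/-- A lift of `Y i → X` to the universal cover. -/
structure Lift (i : P.I) extends Hom (P.Y i) P.cubicalPart where
  lift_V : ∀ y, (P.X.coverProj P.ConePath P.base).onV (onV y) = (P.map i).onV y
  lift_E : ∀ e, (P.X.coverProj P.ConePath P.base).onE (onE e) = (P.map i).onE e

/-- The vertex map `ψ` of `Y i` underlies an automorphism of `Y i` over `X`. -/
def IsAut (i : P.I) (ψ : (P.Y i).V → (P.Y i).V) : Prop :=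
  ∃ f g : Hom (P.Y i) (P.Y i), f.onV = ψ ∧
    f.onV ∘ g.onV = id ∧ g.onV ∘ f.onV = id ∧ f.onE ∘ g.onE = id ∧ g.onE ∘ f.onE = id ∧
    (P.map i).onV ∘ f.onV = (P.map i).onV ∧ (P.map i).onE ∘ f.onE = (P.map i).onE

/-- The 1-skeleton of the intersection (fibre product) of a lift of `Y i` and a lift of `Y j`. When
the lifts are embeddings this is the intersection of their images. Multiple edges and loops do not
matter for distances. -/
def coneInter {i j : P.I} (f : P.Lift i) (g : P.Lift j) :
    SimpleGraph {x : (P.Y i).V × (P.Y j).V // f.onV x.1 = g.onV x.2} :=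
  SimpleGraph.fromRel fun x y => ∃ (a : (P.Y i).E) (b : (P.Y j).E), f.onE a = g.onE b ∧
    (P.Y i).src a = x.1.1 ∧ (P.Y i).tgt a = y.1.1 ∧
    (P.Y j).src b = x.1.2 ∧ (P.Y j).tgt b = y.1.2

/-- The components of the intersection that are not counted as pieces: `i = j` and the two lifts
agree, up to an automorphism `ψ` of `Y i` over `X`, on the component. (Two lifts to a covering
space that agree at one vertex of a connected complex are equal; so the component is the graph
of `ψ` and the two lifts differ by `ψ`.) -/
def SameLift {i j : P.I} {f : P.Lift i} {g : P.Lift j}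
    (c : (P.coneInter f g).ConnectedComponent) : Prop :=
  ∃ ψ : (P.Y i).V → (P.Y i).V, P.IsAut i ψ ∧ ∃ x ∈ c.supp,
    (⟨i, ψ x.1.1⟩ : Σ k, (P.Y k).V) = ⟨j, x.1.2⟩

/-- The 1-skeleton of the part of `Y i` that a lift maps to the carrier of the hyperplane
dual to the edge `e` of the universal cover. -/
def wallInter {i : P.I} (f : P.Lift i) (e : P.cubicalPart.E) :
    SimpleGraph {y : (P.Y i).V // P.cubicalPart.CarrierV e (f.onV y)} :=
  SimpleGraph.fromRel fun x y => ∃ d : (P.Y i).E, P.cubicalPart.CarrierE e (f.onE d) ∧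
    (P.Y i).src d = x.1 ∧ (P.Y i).tgt d = y.1

/-- The hyperplane dual to `e` is disjoint from the lift. -/
def WallDisjoint {i : P.I} (f : P.Lift i) (e : P.cubicalPart.E) : Prop :=
  ∀ d : (P.Y i).E, ¬ P.cubicalPart.Parallel e (f.onE d)

/-- The diameter of a component, in its own combinatorial metric. -/
def pieceDiam {W : Type v} {Γ : SimpleGraph W} (c : Γ.ConnectedComponent) : ℝ≥0∞ :=
  (c.toSimpleGraph.ediam : ℝ≥0∞)

/-- The metric small cancellation condition `C'(α)`: every cone-piece and every wall-piece in
`Y i` has diameter less than `α` times the systole of `Y i`. -/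
def SmallCancellation (α : ℝ) : Prop :=
  ∀ (i : P.I) (f : P.Lift i),
    (∀ (j : P.I) (g : P.Lift j) (c : (P.coneInter f g).ConnectedComponent), ¬ P.SameLift c →
      pieceDiam c < ENNReal.ofReal α * (P.Y i).systole) ∧
    (∀ e : P.cubicalPart.E, P.WallDisjoint f e →
      ∀ c : (P.wallInter f e).ConnectedComponent,
        pieceDiam c < ENNReal.ofReal α * (P.Y i).systole)

end CubicalPresentation

/-! ### CAT(0) cube complexes, nonpositively curved cube complexes, convex hulls -/

section CatZero

variable {V : Type v}

/-- A CAT(0) cube complex, given by its 1-skeleton, is a median graph: it is connected, and any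
three vertices have exactly one median. The cubes are all the cube subgraphs. -/
structure IsMedianGraph (Γ : SimpleGraph V) : Prop where
  connected : Γ.Connected
  median : ∀ x y z : V, ∃! m : V, Γ.dist x m + Γ.dist m y = Γ.dist x y ∧
    Γ.dist y m + Γ.dist m z = Γ.dist y z ∧ Γ.dist z m + Γ.dist m x = Γ.dist z x

/-- `S` is the vertex set of an `n`-cube, for some `n ≥ 0`. -/
def IsCube (Γ : SimpleGraph V) (S : Set V) : Prop :=
  ∃ (n : ℕ) (f : (Fin n → Bool) → V), Function.Injective f ∧
    (∀ x y, Γ.Adj (f x) (f y) ↔ hammingDist x y = 1) ∧ Set.range f = S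

/-- Convexity for the combinatorial metric: geodesics between points of `S` stay in `S`. -/
def IsConvex (Γ : SimpleGraph V) (S : Set V) : Prop :=
  ∀ x ∈ S, ∀ y ∈ S, ∀ z, Γ.dist x z + Γ.dist z y = Γ.dist x y → z ∈ S

/-- The combinatorial convex hull. -/
def hull (Γ : SimpleGraph V) (S : Set V) : Set V := ⋂₀ {T | S ⊆ T ∧ IsConvex Γ T}

theorem subset_hull (Γ : SimpleGraph V) (S : Set V) : S ⊆ hull Γ S :=
  Set.subset_sInter fun _ h => h.1

/-- Two vertex-edge corners and the opposite sides: a 4-cycle of the graph. -/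
def GraphSq (Γ : SimpleGraph V) (a b a' b' : Γ.Dart) : Prop :=
  a.fst = b.fst ∧ b'.fst = a.snd ∧ a'.fst = b.snd ∧ a'.snd = b'.snd ∧
    a.snd ≠ b.snd ∧ a.fst ≠ a'.snd

/-- The cube complex of a graph whose squares are all the 4-cycles. -/
def graphCx (Γ : SimpleGraph V) : CubeCx.{v} where
  V := V
  E := Γ.Dart
  src a := a.fst
  inv a := a.symm
  inv_inv a := a.symm_symm
  inv_ne a := a.symm_ne
  sq := GraphSq Γ
  sq_corner h := ⟨h.1, h.2.1, h.2.2.1, h.2.2.2.1⟩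
  sq_swap h := ⟨h.1.symm, h.2.2.1, h.2.1, h.2.2.2.1.symm, h.2.2.2.2.1.symm,
    fun k => h.2.2.2.2.2 (h.1.trans (k.trans h.2.2.2.1.symm))⟩
  sq_flip h := ⟨h.2.1.symm, h.1.symm, h.2.2.2.1, h.2.2.1,
    fun k => h.2.2.2.2.2 (k.trans h.2.2.2.1.symm),
    fun k => h.2.2.2.2.1 (k.trans h.2.2.1)⟩

end CatZero

/-- A nonpositively curved cube complex with a base vertex and with fundamental group `G`, given by
its universal cover: a CAT(0) cube complex with a base vertex on which `G` acts freely by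
automorphisms (free on the points of the complex: no nontrivial element stabilizes a cube). -/
structure NPCComplex (G : Type u) [Group G] where
  V : Type v
  graph : SimpleGraph V
  isMedian : IsMedianGraph graph
  action : MulAction G V
  adj_smul : ∀ (g : G) (x y : V), graph.Adj x y → graph.Adj (g • x) (g • y)
  free : ∀ g : G, g ≠ 1 → ∀ S : Set V, IsCube graph S → (fun x => g • x) '' S ≠ S
  base : V

namespace NPCComplex

variable {G : Type u} [Group G] (X : NPCComplex.{u, v} G)

instance : MulAction G X.V := X.action

/-- The action on oriented edges. -/
def smulDart (g : G) (a : X.graph.Dart) : X.graph.Dart :=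
  ⟨(g • a.fst, g • a.snd), X.adj_smul g _ _ a.adj⟩

/-- Two oriented edges in the same orbit. -/
def dartSetoid : Setoid X.graph.Dart where
  r a b := ∃ g : G, X.smulDart g a = b
  iseqv := by
    refine ⟨fun a => ⟨1, ?_⟩, ?_, ?_⟩
    · ext <;> simp [smulDart]
    · rintro a _ ⟨g, rfl⟩
      exact ⟨g⁻¹, by ext <;> simp [smulDart]⟩
    · rintro a _ _ ⟨g, rfl⟩ ⟨h, rfl⟩
      exact ⟨h * g, by ext <;> simp [smulDart, mul_smul]⟩

theorem isCube_edge (a : X.graph.Dart) : IsCube X.graph {a.fst, a.snd} := by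
  refine ⟨1, fun x => if x 0 then a.snd else a.fst, ?_, ?_, ?_⟩
  · intro x y h
    have hne := a.fst_ne_snd
    funext k
    rw [Subsingleton.elim k 0]
    cases hx : x 0 <;> cases hy : y 0 <;> simp_all
  · intro x y
    have := a.adj
    cases hx : x 0 <;> cases hy : y 0 <;>
      simp [hammingDist, hx, hy, this, this.symm, Finset.filter_singleton]
  · ext z
    constructor
    · rintro ⟨x, rfl⟩
      dsimp only
      split <;> simp
    · rintro (rfl | rfl)
      · exact ⟨fun _ => false, by simp⟩
      · exact ⟨fun _ => true, by simp⟩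

theorem smulDart_ne_symm (g : G) (a : X.graph.Dart) : X.smulDart g a ≠ a.symm := by
  intro h
  have h1 : g • a.fst = a.snd := congrArg (fun d : X.graph.Dart => d.fst) h
  have h2 : g • a.snd = a.fst := congrArg (fun d : X.graph.Dart => d.snd) h
  have hg : g ≠ 1 := by
    rintro rfl
    rw [one_smul] at h1
    exact a.fst_ne_snd h1
  refine X.free g hg _ (X.isCube_edge a) ?_
  rw [Set.image_pair, h1, h2, Set.pair_comm]

/-- The universal cover, as a cube complex. -/
def univ : CubeCx.{v} := graphCx X.graph

/-- The squares of the quotient are the images of the squares of the universal cover. -/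
inductive QuotSq : Quotient X.dartSetoid → Quotient X.dartSetoid → Quotient X.dartSetoid →
    Quotient X.dartSetoid → Prop
  | mk {a b a' b' : X.graph.Dart} (h : GraphSq X.graph a b a' b') :
      QuotSq (Quotient.mk _ a) (Quotient.mk _ b) (Quotient.mk _ a') (Quotient.mk _ b')

/-- The nonpositively curved cube complex itself: the quotient of the universal cover by `G`. -/
def cx : CubeCx.{v} where
  V := MulAction.orbitRel.Quotient G X.V
  E := Quotient X.dartSetoid
  src := Quotient.lift (fun a => Quotient.mk _ a.fst) (by
    rintro a _ ⟨g, rfl⟩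
    exact (Quotient.sound (s := MulAction.orbitRel G X.V) ⟨g, rfl⟩).symm)
  inv := Quotient.map (fun a => a.symm) (by
    rintro a _ ⟨g, rfl⟩
    exact ⟨g, rfl⟩)
  inv_inv := by
    rintro ⟨a⟩
    change Quotient.mk _ a.symm.symm = Quotient.mk _ a
    rw [a.symm_symm]
  inv_ne := by
    rintro ⟨a⟩ h
    obtain ⟨g, hg⟩ := Quotient.exact h.symm
    exact X.smulDart_ne_symm g a hg
  sq := X.QuotSq
  sq_corner := by
    rintro _ _ _ _ ⟨h⟩
    have k := (graphCx X.graph).sq_corner h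
    exact ⟨congrArg (Quotient.mk _) k.1, congrArg (Quotient.mk _) k.2.1,
      congrArg (Quotient.mk _) k.2.2.1, congrArg (Quotient.mk _) k.2.2.2⟩
  sq_swap := by
    rintro _ _ _ _ ⟨h⟩
    exact .mk ((graphCx X.graph).sq_swap h)
  sq_flip := by
    rintro _ _ _ _ ⟨h⟩
    exact .mk ((graphCx X.graph).sq_flip h)

/-- The base vertex of the quotient. -/
def cxBase : X.cx.V := (Quotient.mk _ X.base : MulAction.orbitRel.Quotient G X.V)

/-- The vertices of the bead of `h`: the combinatorial convex hull of the base vertex `p` of the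
universal cover and its translate `h p`. -/
def beadSet (h : G) : Set X.V := hull X.graph {X.base, h • X.base}

/-- The bead of `h`: the full subcomplex on the hull of `p` and `h p`. -/
def bead (h : G) : CubeCx.{v} := graphCx (X.graph.induce (X.beadSet h))

/-- The initial vertex `p` of the bead. -/
def beadIni (h : G) : (X.bead h).V := (⟨X.base, subset_hull _ _ (by simp)⟩ : X.beadSet h)

/-- The terminal vertex `h p` of the bead. -/
def beadTer (h : G) : (X.bead h).V := (⟨h • X.base, subset_hull _ _ (by simp)⟩ : X.beadSet h)

/-- The inclusion of the edges of the bead in the universal cover. -/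
def beadDart (h : G) (a : (X.graph.induce (X.beadSet h)).Dart) : X.graph.Dart :=
  ⟨(a.fst.1, a.snd.1), a.adj⟩

/-- The map from the bead to the nonpositively curved cube complex. -/
def beadMap (h : G) : Hom (X.bead h) X.cx where
  onV x := (Quotient.mk _ (x : X.beadSet h).1 : MulAction.orbitRel.Quotient G X.V)
  onE a := Quotient.mk X.dartSetoid (X.beadDart h a)
  src_comp _ := rfl
  inv_comp _ := rfl
  sq_comp {a b a' b'} k := by
    have k' : GraphSq _ a b a' b' := k
    exact .mk ⟨congrArg Subtype.val k'.1, congrArg Subtype.val k'.2.1,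
      congrArg Subtype.val k'.2.2.1, congrArg Subtype.val k'.2.2.2.1,
      fun e => k'.2.2.2.2.1 (Subtype.ext e), fun e => k'.2.2.2.2.2 (Subtype.ext e)⟩

theorem beadMap_ini (h : G) : (X.beadMap h).onV (X.beadIni h) = X.cxBase := rfl

theorem beadMap_ter (h : G) : (X.beadMap h).onV (X.beadTer h) = X.cxBase :=
  Quotient.sound (s := MulAction.orbitRel G X.V) ⟨h, rfl⟩

end NPCComplex

/-! ### The long wedge with subdivided edges -/

section LongWedge

variable {r : ℕ} (C : Fin r → CubeCx.{v}) (b : ∀ j, (C j).V) (q : ℕ)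

/-- The vertices: the common initial vertex of the edges `e j`, the interior vertices of the edges
`e j` (subdivided into `q` edges), and the vertices of the complexes `C j`. -/
inductive WedgeV : Type v
  | center : WedgeV
  | arc (j : Fin r) (k : ℕ) (h0 : 0 < k) (h1 : k < q) : WedgeV
  | pt (j : Fin r) (x : (C j).V) : WedgeV

/-- The oriented edges: the `k`-th edge of the subdivided edge `e j`, directed away from the center
(`true`) or towards the center (`false`), and the edges of the complexes `C j`. -/
inductive WedgeE : Type v
  | arc (j : Fin r) (k : Fin q) (out : Bool) : WedgeE
  | edge (j : Fin r) (e : (C j).E) : WedgeE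

/-- The vertex at distance `k` from the center on the subdivided edge `e j`, for `0 ≤ k ≤ q`. -/
def wedgePos (j : Fin r) (k : ℕ) : WedgeV C q :=
  if h0 : 0 < k then if h1 : k < q then .arc j k h0 h1 else .pt j (b j) else .center

/-- Squares of the long wedge. -/
inductive WedgeSq : WedgeE C q → WedgeE C q → WedgeE C q → WedgeE C q → Prop
  | mk (j : Fin r) {a b a' b' : (C j).E} (h : (C j).sq a b a' b') :
      WedgeSq (.edge j a) (.edge j b) (.edge j a') (.edge j b')

/-- The long wedge of the complexes `C j` with base vertices `b j`, where each edge `e j`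
is subdivided into `q` edges. -/
def longWedge : CubeCx.{v} where
  V := WedgeV C q
  E := WedgeE C q
  src
    | .arc j k true => wedgePos C b q j k
    | .arc j k false => wedgePos C b q j (k + 1)
    | .edge j e => .pt j ((C j).src e)
  inv
    | .arc j k out => .arc j k (!out)
    | .edge j e => .edge j ((C j).inv e)
  inv_inv := by
    rintro (⟨j, k, o⟩ | ⟨j, e⟩)
    · simp
    · simp [(C j).inv_inv]
  inv_ne := by
    rintro (⟨j, k, o⟩ | ⟨j, e⟩)
    · simp
    · simpa using (C j).inv_ne e
  sq := WedgeSq C q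
  sq_corner := by
    rintro _ _ _ _ ⟨j, h⟩
    have k := (C j).sq_corner h
    exact ⟨congrArg (WedgeV.pt j) k.1, congrArg (WedgeV.pt j) k.2.1,
      congrArg (WedgeV.pt j) k.2.2.1, congrArg (WedgeV.pt j) k.2.2.2⟩
  sq_swap := by
    rintro _ _ _ _ ⟨j, h⟩
    exact .mk j ((C j).sq_swap h)
  sq_flip := by
    rintro _ _ _ _ ⟨j, h⟩
    exact .mk j ((C j).sq_flip h)

end LongWedge

/-! ### Necklaces -/

section Necklace

/-- The cyclic successor. -/
def next {t : ℕ} (k : Fin t) : Fin t := ⟨(k + 1) % t, Nat.mod_lt _ k.pos⟩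

variable {t : ℕ} (B : Fin t → CubeCx.{v}) (ini ter : ∀ k, (B k).V) (q : ℕ)

/-- The vertices: those of the beads `B k`, and the interior vertices of the strings `σ k`,
where `σ k` consists of `2 q` edges. -/
inductive NeckV : Type v
  | bead (k : Fin t) (x : (B k).V) : NeckV
  | string (k : Fin t) (s : ℕ) (h0 : 0 < s) (h1 : s < 2 * q) : NeckV

/-- The oriented edges: those of the beads, and the `s`-th edge of the string `σ k`, directed
forwards (`true`) or backwards (`false`). -/
inductive NeckE : Type v
  | bead (k : Fin t) (e : (B k).E) : NeckE
  | string (k : Fin t) (s : Fin (2 * q)) (fwd : Bool) : NeckE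

/-- The `s`-th vertex of the string `σ k`, for `0 ≤ s ≤ 2 q`. The string joins the terminal vertex
of the bead `B k` to the initial vertex of the cyclically next bead. -/
def neckPos (k : Fin t) (s : ℕ) : NeckV B q :=
  if h0 : 0 < s then
    if h1 : s < 2 * q then .string k s h0 h1 else .bead (next k) (ini (next k))
  else .bead k (ter k)

/-- Squares of the necklace. -/
inductive NeckSq : NeckE B q → NeckE B q → NeckE B q → NeckE B q → Prop
  | mk (k : Fin t) {a b a' b' : (B k).E} (h : (B k).sq a b a' b') :
      NeckSq (.bead k a) (.bead k b) (.bead k a') (.bead k b')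

/-- The necklace: beads and strings glued in cyclic order. -/
def necklace : CubeCx.{v} where
  V := NeckV B q
  E := NeckE B q
  src
    | .bead k e => .bead k ((B k).src e)
    | .string k s true => neckPos B ini ter q k s
    | .string k s false => neckPos B ini ter q k (s + 1)
  inv
    | .bead k e => .bead k ((B k).inv e)
    | .string k s fwd => .string k s (!fwd)
  inv_inv := by
    rintro (⟨k, e⟩ | ⟨k, s, o⟩)
    · simp [(B k).inv_inv]
    · simp
  inv_ne := by
    rintro (⟨k, e⟩ | ⟨k, s, o⟩)
    · simpa using (B k).inv_ne e
    · simp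
  sq := NeckSq B q
  sq_corner := by
    rintro _ _ _ _ ⟨j, h⟩
    have k := (B j).sq_corner h
    exact ⟨congrArg (NeckV.bead j) k.1, congrArg (NeckV.bead j) k.2.1,
      congrArg (NeckV.bead j) k.2.2.1, congrArg (NeckV.bead j) k.2.2.2⟩
  sq_swap := by
    rintro _ _ _ _ ⟨j, h⟩
    exact .mk j ((B j).sq_swap h)
  sq_flip := by
    rintro _ _ _ _ ⟨j, h⟩
    exact .mk j ((B j).sq_flip h)

variable {r : ℕ} (C : Fin r → CubeCx.{v}) (b : ∀ j, (C j).V) (m : Fin t → Fin r)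
  (β : ∀ k, Hom (B k) (C (m k)))

/-- The image of the `s`-th vertex of `σ k` in the long wedge: the string `σ k` is a copy of the
reversed edge `e (m k)` followed by the edge `e (m (k + 1))`. -/
def stringPos (k : Fin t) (s : ℕ) : WedgeV C q :=
  if s ≤ q then wedgePos C b q (m k) (q - s) else wedgePos C b q (m (next k)) (s - q)

/-- The image of the `s`-th edge of `σ k` in the long wedge. -/
def stringEdge (k : Fin t) (s : Fin (2 * q)) (fwd : Bool) : WedgeE C q :=
  if h : s.1 < q then .arc (m k) ⟨q - 1 - s, by omega⟩ (!fwd)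
  else .arc (m (next k)) ⟨s - q, by omega⟩ fwd

/-- The vertex map from a necklace to the long wedge that is induced by maps of the beads. -/
def necklaceV : NeckV B q → WedgeV C q
  | .bead k x => .pt (m k) ((β k).onV x)
  | .string k s _ _ => stringPos q C b m k s

variable {B ini ter}

theorem stringPos_eq (hini : ∀ k, (β k).onV (ini k) = b (m k))
    (hter : ∀ k, (β k).onV (ter k) = b (m k)) (k : Fin t) (s : ℕ) (hq : 0 < q) (hs : s ≤ 2 * q) :
    necklaceV B q C b m β (neckPos B ini ter q k s) = stringPos q C b m k s := by
  unfold neckPos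
  by_cases h0 : 0 < s
  · by_cases h1 : s < 2 * q
    · simp [h0, h1, necklaceV]
    · have hs' : ¬ s ≤ q := by omega
      have h3 : ¬ s - q < q := by omega
      have h4 : 0 < s - q := by omega
      simp [h1, necklaceV, stringPos, wedgePos, hini, hs', h3, h4, h0]
  · have h0' : s = 0 := by omega
    subst h0'
    simp [necklaceV, stringPos, wedgePos, hter, hq]

/-- The map from a necklace to the long wedge that is induced by maps of the beads. -/
def necklaceMap (hini : ∀ k, (β k).onV (ini k) = b (m k))
    (hter : ∀ k, (β k).onV (ter k) = b (m k)) :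
    Hom (necklace B ini ter q) (longWedge C b q) where
  onV := necklaceV B q C b m β
  onE
    | .bead k e => .edge (m k) ((β k).onE e)
    | .string k s fwd => stringEdge q C m k s fwd
  src_comp := by
    rintro (⟨k, e⟩ | ⟨k, s, o⟩)
    · exact congrArg (WedgeV.pt (m k)) ((β k).src_comp e)
    · have hq : 0 < q := by have := s.2; omega
      cases o
      · refine Eq.trans ?_ (stringPos_eq q C b m β hini hter k (s + 1) hq (by omega)).symm
        by_cases h : s.1 < q
        · simp [stringEdge, h, longWedge, stringPos, show s.1 + 1 ≤ q by omega,
            show q - 1 - s.1 = q - (s.1 + 1) by omega]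
        · simp [stringEdge, h, longWedge, stringPos, show ¬ s.1 + 1 ≤ q by omega,
            show s.1 - q + 1 = s.1 + 1 - q by omega]
      · refine Eq.trans ?_ (stringPos_eq q C b m β hini hter k s hq (by omega)).symm
        by_cases h : s.1 < q
        · simp [stringEdge, h, longWedge, stringPos, h.le,
            show q - 1 - s.1 + 1 = q - s.1 by omega]
        · by_cases h' : s.1 = q
          · simp [stringEdge, longWedge, stringPos, h', wedgePos]
          · simp [stringEdge, h, longWedge, stringPos, show ¬ s.1 ≤ q by omega]
  inv_comp := by
    rintro (⟨k, e⟩ | ⟨k, s, o⟩)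
    · exact congrArg (WedgeE.edge (m k)) ((β k).inv_comp e)
    · by_cases h : s.1 < q <;> simp [necklace, longWedge, stringEdge, h]
  sq_comp := by
    rintro _ _ _ _ ⟨k, h⟩
    exact .mk (m k) ((β k).sq_comp h)

end Necklace

/-! ### Presentations over a free product -/

section FreeProduct

open Monoid.CoprodI

variable {r : ℕ} {G : Fin r → Type u} [∀ j, Group (G j)]

/-- The syllable length of a normal form. -/
def syllableLength (W : Word G) : ℕ := W.toList.length

/-- The first and the last syllable lie in different factors. -/
def CyclicallyReduced (W : Word G) : Prop :=
  ∃ a ∈ W.toList.head?, ∃ z ∈ W.toList.getLast?, a.1 ≠ z.1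

/-- The last syllable is not the inverse of the first one, or there is at most one syllable. -/
def WeaklyCyclicallyReduced (W : Word G) : Prop :=
  syllableLength W ≤ 1 ∨ ∀ (j : Fin r) (x : G j), W.toList.head? = some ⟨j, x⟩ →
    W.toList.getLast? ≠ some ⟨j, x⁻¹⟩

/-- The concatenation of the normal forms `P` and `U` has no cancellation: the last syllable of `P`
is not the inverse of the first syllable of `U`. -/
def NoCancellation (P U : Word G) : Prop :=
  ∀ (j : Fin r) (x : G j), P.toList.getLast? = some ⟨j, x⟩ → U.toList.head? ≠ some ⟨j, x⁻¹⟩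

/-- `W` is a weakly cyclically reduced conjugate of `R` or of its inverse. -/
def IsRelatorForm (R W : Word G) : Prop :=
  WeaklyCyclicallyReduced W ∧ (IsConj R.prod W.prod ∨ IsConj R.prod⁻¹ W.prod)

/-- `W` is the concatenation of `P` and some `U`, without cancellation. -/
def IsInitial (P W : Word G) : Prop :=
  ∃ U : Word G, NoCancellation P U ∧ W.prod = P.prod * U.prod

/-- The metric small cancellation condition `C'_*(α)` over a free product. A piece is a common
initial part `P` of weakly cyclically reduced conjugates `W`, `W'` of (the inverses of) `R i` and
`R j`, where the trivial case `i = j`, `W = W'` is excluded. -/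
def FreeProductSmallCancellation {s : ℕ} (R : Fin s → Word G) (α : ℝ) : Prop :=
  ∀ (i j : Fin s) (W W' P : Word G), IsRelatorForm (R i) W → IsRelatorForm (R j) W' →
    (i ≠ j ∨ W ≠ W') → IsInitial P W → IsInitial P W' →
    (syllableLength P : ℝ) < α * syllableLength W

variable (X : ∀ j, NPCComplex.{u, v} (G j))

/-- The long wedge of nonpositively curved cube complexes, with `q`-fold subdivided edges. -/
def wedgeCx (q : ℕ) : CubeCx.{v} := longWedge (fun j => (X j).cx) (fun j => (X j).cxBase) q

/-- The `k`-th bead of the necklace of a normal form `h 1 ⋯ h t`. -/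
def relatorBead (W : Word G) (k : Fin W.toList.length) : CubeCx.{v} :=
  (X (W.toList.get k).1).bead (W.toList.get k).2

/-- The necklace of a normal form, with strings subdivided as the edges of the long wedge. -/
def relatorNecklace (W : Word G) (q : ℕ) : CubeCx.{v} :=
  necklace (relatorBead X W) (fun k => (X (W.toList.get k).1).beadIni (W.toList.get k).2)
    (fun k => (X (W.toList.get k).1).beadTer (W.toList.get k).2) q

/-- The map from the necklace to the long wedge. -/
def relatorMap (W : Word G) (q : ℕ) : Hom (relatorNecklace X W q) (wedgeCx X q) :=
  necklaceMap q (fun j => (X j).cx) (fun j => (X j).cxBase) (fun k => (W.toList.get k).1)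
    (fun k => (X (W.toList.get k).1).beadMap (W.toList.get k).2)
    (fun k => (X (W.toList.get k).1).beadMap_ini (W.toList.get k).2)
    (fun k => (X (W.toList.get k).1).beadMap_ter (W.toList.get k).2)

/-- The cubical presentation associated to a presentation `⟨G 1, …, G r | R 1, …, R s⟩` over a free
product, after subdividing each edge of the long wedge into `q` edges. -/
def associatedPresentation {s : ℕ} (R : Fin s → Word G) (q : ℕ) : CubicalPresentation.{v} where
  X := wedgeCx X q
  I := Fin s
  Y i := relatorNecklace X (R i) q
  map i := relatorMap X (R i) q
  base := (WedgeV.center : WedgeV (fun j => (X j).cx) q)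

end FreeProduct

end CubicalSC

end

/-! As `q` grows, the length of a necklace concentrates in its strings. Let `t` be the syllable
length of `R i`. A closed path of length less than `2 q t` misses some string edge; the necklace cut
open there is a chain of beads joined by strings, and the beads are convex in CAT(0) cube complexes,
hence simply connected. So the systole is at least `2 q t` (`le_systole_neck`). Each bead is finite,
because the hull of two vertices of a median graph lies in a finite interval. So one constant `C`,
independent of `q`, bounds the number of vertices of every bead. Diameters of pieces are then
bounded by counting vertices.

For cone-pieces the universal cover is only used through its projection: a component of the
intersection of two lifts maps injectively into a connected part of the fibre product of the two
necklaces over `X`. Suppose that this part contains a pair of string vertices at which the two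
necklaces run in the same direction. It then extends in both directions as long as the syllables
agree. It can cross a whole bead only if the two syllables are equal, since the action is free. At
the first disagreement on either side it can still enter the beads if the two syllables lie in the
same factor. The syllables met in this way form a piece of some length `l` in the free product:
equality is needed in the interior, and only equality of factors at the two ends, because pieces may
cut syllables (`lt_of_agree`). Hence `n l < t`, or the overlap is total; in the latter case the
necklaces are isomorphic over `X` and the component is not a cone-piece. The overlap has at most `l
(C² + 2q)` vertices, and `n l ≤ t - 1` leaves a surplus of `2q`, which absorbs the beads once `2q >
t C²` (`string_overlap`). Opposite directions reduce to this case by flipping one necklace, and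
overlaps without string vertices have at most `C²` vertices.

For wall-pieces, the carrier of a hyperplane disjoint from the lift meets the lift only in edges
that are sides of squares. String edges are not, so a wall-piece lies in one bead or is a single
vertex (`wallPiece_lt`). -/

noncomputable section

namespace CubicalSC

/-! ### Median graphs -/

namespace IsMedianGraph

variable {V : Type v} {Γ : SimpleGraph V} (hΓ : IsMedianGraph Γ)
include hΓ

theorem triangle (x y z : V) : Γ.dist x z ≤ Γ.dist x y + Γ.dist y z :=
  hΓ.connected.dist_triangle

theorem dist_eq_zero {x y : V} : Γ.dist x y = 0 ↔ x = y :=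
  hΓ.connected.dist_eq_zero_iff

/-- A median, with the equations oriented for arithmetic. -/
theorem exists_median (x y z : V) : ∃ m : V, Γ.dist x m + Γ.dist y m = Γ.dist x y ∧
    Γ.dist y m + Γ.dist z m = Γ.dist y z ∧ Γ.dist x m + Γ.dist z m = Γ.dist x z := by
  obtain ⟨m, ⟨h1, h2, h3⟩, -⟩ := hΓ.median x y z
  refine ⟨m, ?_, ?_, ?_⟩
  · rw [Γ.dist_comm (u := y) (v := m)]; exact h1
  · rw [Γ.dist_comm (u := z) (v := m)]; exact h2
  · rw [Γ.dist_comm (u := x) (v := m), Γ.dist_comm (u := x) (v := z), add_comm]; exact h3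

/-- The median of `w`, `x`, `y` lies on the edge, so it is `x` or `y`. In particular median graphs
are bipartite, the source of all parity arguments below. -/
theorem dist_adj {x y : V} (h : Γ.Adj x y) (w : V) :
    Γ.dist w x = Γ.dist w y + 1 ∨ Γ.dist w y = Γ.dist w x + 1 := by
  obtain ⟨m, h1, h2, h3⟩ := hΓ.exists_median w x y
  have hxy : Γ.dist x y = 1 := SimpleGraph.dist_eq_one_iff_adj.2 h
  rw [hxy] at h2
  rcases Nat.eq_zero_or_pos (Γ.dist x m) with h0 | h0
  · right
    rw [hΓ.dist_eq_zero] at h0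
    subst h0
    have : Γ.dist x x = 0 := Γ.dist_self
    omega
  · left
    have h0' : Γ.dist y m = 0 := by omega
    rw [hΓ.dist_eq_zero] at h0'
    subst h0'
    have : Γ.dist y y = 0 := Γ.dist_self
    omega

theorem dist_two {z x y : V} (hx : Γ.Adj z x) (hy : Γ.Adj z y) (hne : x ≠ y) :
    Γ.dist x y = 2 := by
  have h1 : Γ.dist x z = 1 := SimpleGraph.dist_eq_one_iff_adj.2 hx.symm
  have h2 := hΓ.dist_adj hy x
  have h3 : Γ.dist x y ≠ 0 := fun h => hne (hΓ.dist_eq_zero.1 h)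
  omega

/-- The quadrangle condition. -/
theorem quadrangle {w z x y : V} (hx : Γ.Adj z x) (hy : Γ.Adj z y) (hne : x ≠ y) {k : ℕ}
    (kx : Γ.dist w x = k) (ky : Γ.dist w y = k) :
    ∃ m, Γ.Adj x m ∧ Γ.Adj y m ∧ Γ.dist w m + 1 = k := by
  obtain ⟨m, h1, h2, h3⟩ := hΓ.exists_median w x y
  have h := hΓ.dist_two hx hy hne
  exact ⟨m, SimpleGraph.dist_eq_one_iff_adj.1 (by omega),
    SimpleGraph.dist_eq_one_iff_adj.1 (by omega), by omega⟩

/-- A median graph contains no complete bipartite graph on `2 + 3` vertices. -/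
theorem no_K23 {x y a b c : V} (hxy : x ≠ y) (hab : a ≠ b) (hbc : b ≠ c) (hac : a ≠ c)
    (xa : Γ.Adj x a) (xb : Γ.Adj x b) (xc : Γ.Adj x c)
    (ya : Γ.Adj y a) (yb : Γ.Adj y b) (yc : Γ.Adj y c) : False := by
  have key : ∀ w, Γ.Adj w a → Γ.Adj w b → Γ.Adj w c →
      Γ.dist a w + Γ.dist w b = Γ.dist a b ∧ Γ.dist b w + Γ.dist w c = Γ.dist b c ∧
        Γ.dist c w + Γ.dist w a = Γ.dist c a := by
    intro w wa wb wc
    rw [hΓ.dist_two wa wb hab, hΓ.dist_two wb wc hbc, hΓ.dist_two wc wa hac.symm,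
      SimpleGraph.dist_eq_one_iff_adj.2 wa, SimpleGraph.dist_eq_one_iff_adj.2 wb,
      SimpleGraph.dist_eq_one_iff_adj.2 wc, SimpleGraph.dist_eq_one_iff_adj.2 wa.symm,
      SimpleGraph.dist_eq_one_iff_adj.2 wb.symm, SimpleGraph.dist_eq_one_iff_adj.2 wc.symm]
    exact ⟨rfl, rfl, rfl⟩
  exact hxy ((hΓ.median a b c).unique (key x xa xb xc) (key y ya yb yc))

/-- A vertex has a neighbour that is closer to a given other vertex. -/
theorem exists_closer {x y : V} (h : x ≠ y) : ∃ z, Γ.Adj x z ∧ Γ.dist x y = Γ.dist z y + 1 := by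
  obtain ⟨p, hp⟩ := hΓ.connected.exists_walk_length_eq_dist x y
  cases p with
  | nil => exact absurd rfl h
  | cons hadj q =>
    rename_i z
    refine ⟨z, hadj, ?_⟩
    have h1 := SimpleGraph.dist_le q
    have h2 := hΓ.triangle x z y
    rw [SimpleGraph.dist_eq_one_iff_adj.2 hadj] at h2
    simp only [SimpleGraph.Walk.length_cons] at hp
    omega

/-- Intervals in a median graph are convex. -/
theorem isConvex_interval (a b : V) :
    IsConvex Γ {x | Γ.dist a x + Γ.dist b x = Γ.dist a b} := by
  set S : Set V := {x | Γ.dist a x + Γ.dist b x = Γ.dist a b} with hS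
  have memS : ∀ x, x ∈ S ↔ Γ.dist a x + Γ.dist b x = Γ.dist a b := fun x => Iff.rfl
  have hab : ∀ x, Γ.dist a b ≤ Γ.dist a x + Γ.dist b x := fun x => by
    have := hΓ.triangle a x b
    rwa [Γ.dist_comm (u := x) (v := b)] at this
  -- geodesics from a point of the interval to `a` stay in the interval
  have toA : ∀ x ∈ S, ∀ w, Γ.dist a w + Γ.dist x w = Γ.dist a x → w ∈ S := by
    intro x hx w hw
    rw [memS] at hx ⊢
    have h1 := hΓ.triangle b x w
    have := hab w
    omega
  -- common neighbours of points of the interval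
  have two : ∀ x ∈ S, ∀ y ∈ S, x ≠ y → ∀ z, Γ.Adj z x → Γ.Adj z y → z ∈ S := by
    intro x hx y hy hne z zx zy
    by_contra hz
    rw [memS] at hx hy hz
    have := hab z
    have ax := hΓ.dist_adj zx a
    have ay := hΓ.dist_adj zy a
    have bx := hΓ.dist_adj zx b
    have bY := hΓ.dist_adj zy b
    -- By parity a common neighbour `z` outside the interval is one step farther than `x` and `y`
    -- from both `a` and `b`. The corners `m` towards `a` and `m'` towards `b` are then, with `z`,
    -- three common neighbours of `x` and `y`.
    obtain ⟨m, xm, ym, hm⟩ := hΓ.quadrangle (w := a) zx zy hne rfl (by omega)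
    obtain ⟨m', xm', ym', hm'⟩ := hΓ.quadrangle (w := b) zx zy hne rfl (by omega)
    have hmm := hab m
    have hmm' := hab m'
    refine hΓ.no_K23 (x := x) (y := y) (a := z) (b := m) (c := m') hne ?_ ?_ ?_ zx.symm xm xm'
      zy.symm ym ym'
    · rintro rfl; omega
    · rintro rfl; omega
    · rintro rfl; omega
  suffices H : ∀ d, ∀ x ∈ S, ∀ y ∈ S, Γ.dist x y = d → ∀ z,
      Γ.dist x z + Γ.dist z y = Γ.dist x y → z ∈ S from
    fun x hx y hy z hz => H _ x hx y hy rfl z hz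
  intro d
  induction d using Nat.strong_induction_on with
  | _ d ih =>
  -- it suffices to find the first step of a geodesic in the interval
  intro x hx y hy hd z hz
  by_cases hxz : x = z
  · exact hxz ▸ hx
  obtain ⟨x1, hadj, h1⟩ := hΓ.exists_closer hxz
  have d1 := SimpleGraph.dist_eq_one_iff_adj.2 hadj
  have h2 : Γ.dist x y = Γ.dist x1 y + 1 := by
    have t1 := hΓ.triangle x x1 y
    have t2 := hΓ.triangle x1 z y
    omega
  suffices hx1 : x1 ∈ S by
    refine ih (Γ.dist x1 y) (by omega) x1 hx1 y hy rfl z ?_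
    have t2 := hΓ.triangle x1 z y
    omega
  -- If `m = x`, then `x1` lies on a geodesic from `y` to `a`. Otherwise a neighbour `c` of `x`
  -- towards `m` lies in the interval and is closer to `y`. If `c ≠ x1`, these two span a square
  -- with far corner `e`; induction for `c` and `y` puts `e` in the interval, and `x1` is a common
  -- neighbour of `x` and `e`.
  obtain ⟨m, m1, m2, m3⟩ := hΓ.exists_median a x y
  by_cases hm : x = m
  · subst hm
    have : Γ.dist x x = 0 := Γ.dist_self
    refine toA y hy x1 ?_
    have t1 := hΓ.triangle a x x1
    have t2 := hΓ.triangle a x1 y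
    rw [Γ.dist_comm (u := y) (v := x1)]
    rw [Γ.dist_comm (u := y) (v := x)] at m2
    have e1 : Γ.dist y x = Γ.dist x y := Γ.dist_comm
    omega
  obtain ⟨c, hc, hc1⟩ := hΓ.exists_closer hm
  have dc := SimpleGraph.dist_eq_one_iff_adj.2 hc
  have hcS : c ∈ S := by
    refine toA x hx c ?_
    have t1 := hΓ.triangle a m c
    have t2 := hΓ.triangle a c x
    rw [Γ.dist_comm (u := m) (v := c)] at t1
    rw [Γ.dist_comm (u := c) (v := x)] at t2
    omega
  have hcy : Γ.dist x y = Γ.dist c y + 1 := by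
    have t1 := hΓ.triangle x c y
    have t2 := hΓ.triangle c m y
    rw [Γ.dist_comm (u := m) (v := y)] at t2
    omega
  by_cases hcx : c = x1
  · exact hcx ▸ hcS
  obtain ⟨e, he1, he2, he3⟩ := hΓ.quadrangle (w := y) hc hadj hcx
    (k := Γ.dist x1 y) (by rw [Γ.dist_comm]; omega) (Γ.dist_comm)
  have de1 := SimpleGraph.dist_eq_one_iff_adj.2 he1
  have heS : e ∈ S := by
    refine ih (Γ.dist c y) (by omega) c hcS y hy rfl e ?_
    rw [Γ.dist_comm (u := e) (v := y)]
    omega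
  refine two x hx e heS ?_ x1 hadj.symm he2
  rintro rfl
  rw [Γ.dist_comm] at he3
  omega

/-- Intervals in a median graph are finite. -/
theorem finite_interval (a b : V) : {x | Γ.dist a x + Γ.dist b x = Γ.dist a b}.Finite := by
  -- simultaneously with the finiteness of the set of first steps of geodesics
  have nbrs : ∀ d, ∀ a, Γ.dist a b = d → {c | Γ.Adj a c ∧ Γ.dist a b = Γ.dist c b + 1}.Finite := by
    intro d
    induction d with
    | zero =>
      intro a h
      rw [h]
      convert Set.finite_empty
      ext c
      simp
    | succ d ih =>
      intro a h
      by_cases hab : a = b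
      · subst hab
        simp at h
      obtain ⟨a1, h1, h2⟩ := hΓ.exists_closer hab
      have fin := ih a1 (by omega)
      -- Every first step `c` other than `a1` spans a square with `a1`, and the far corner is a
      -- first step from `a1`. The corner determines `c`, since two such `c` together with `a1`
      -- would be three common neighbours of `a` and the corner.
      have key : ∀ c, c ≠ a1 → Γ.Adj a c → Γ.dist a b = Γ.dist c b + 1 →
          ∃ m, Γ.Adj c m ∧ (Γ.Adj a1 m ∧ Γ.dist a1 b = Γ.dist m b + 1) := by
        intro c hc hadj hd
        obtain ⟨m, m1, m2, m3⟩ := hΓ.quadrangle (w := b) hadj h1 hc (k := Γ.dist a1 b)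
          (by rw [Γ.dist_comm]; omega) Γ.dist_comm
        exact ⟨m, m1, m2, by rw [Γ.dist_comm (u := m)]; omega⟩
      choose! f hf using key
      refine Set.Finite.of_sdiff ?_ (Set.finite_singleton a1)
      refine Set.Finite.of_finite_image (f := f) (fin.subset ?_) ?_
      · rintro _ ⟨c, ⟨⟨hc1, hc2⟩, hc3⟩, rfl⟩
        exact (hf c hc3 hc1 hc2).2
      · rintro c ⟨⟨hc1, hc2⟩, hc3⟩ e ⟨⟨he1, he2⟩, he3⟩ hce
        by_contra hne
        have Hc := hf c hc3 hc1 hc2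
        have He := hf e he3 he1 he2
        rw [← hce] at He
        refine hΓ.no_K23 (x := a) (y := f c) ?_ (Ne.symm hc3) hne (Ne.symm he3) h1 hc1 he1
          Hc.2.1.symm Hc.1.symm He.1.symm
        rintro h
        have := Hc.2.2
        rw [← h] at this
        omega
  suffices H : ∀ d, ∀ a, Γ.dist a b = d → {x | Γ.dist a x + Γ.dist b x = Γ.dist a b}.Finite from
    H _ a rfl
  intro d
  induction d with
  | zero =>
    intro a h
    refine (Set.finite_singleton a).subset ?_
    intro x hx
    have hx' : Γ.dist a x + Γ.dist b x = Γ.dist a b := hx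
    exact (hΓ.dist_eq_zero.1 (by omega)).symm
  | succ d ih =>
    intro a h
    refine ((Set.finite_singleton a).union ((nbrs _ a rfl).biUnion
      fun c hc => ih c (by have := hc.2; omega))).subset ?_
    intro x hx
    have hx' : Γ.dist a x + Γ.dist b x = Γ.dist a b := hx
    by_cases hax : a = x
    · exact Or.inl hax.symm
    right
    obtain ⟨c, hc, hd⟩ := hΓ.exists_closer hax
    have t1 := hΓ.triangle c x b
    have t2 := hΓ.triangle a c b
    have e1 : Γ.dist x b = Γ.dist b x := Γ.dist_comm
    have d1 := SimpleGraph.dist_eq_one_iff_adj.2 hc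
    refine Set.mem_biUnion (x := c) ⟨hc, by omega⟩ ?_
    change Γ.dist c x + Γ.dist b x = Γ.dist c b
    omega

/-- The interval is convex and contains both points, so it contains the hull. This is what makes
beads finite. -/
theorem finite_hull_pair (a b : V) : (hull Γ {a, b}).Finite := by
  refine (hΓ.finite_interval a b).subset (Set.sInter_subset_of_mem ⟨?_, hΓ.isConvex_interval a b⟩)
  rintro x (rfl | rfl)
  · simp [Γ.dist_comm]
  · change Γ.dist a x + Γ.dist x x = Γ.dist a x
    simp

end IsMedianGraph

theorem isConvex_hull {V : Type v} {Γ : SimpleGraph V} (S : Set V) : IsConvex Γ (hull Γ S) := by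
  intro x hx y hy z hz T hT
  exact hT.2 x (hx T hT) y (hy T hT) z hz

end CubicalSC

namespace CubicalSC

/-! ### Homotopy of combinatorial paths -/

namespace CubeCx

variable {C D : CubeCx.{v}}

theorem IsPath.of_append {x z : C.V} {l m : List C.E} (h : C.IsPath x (l ++ m) z) :
    ∃ y, C.IsPath x l y ∧ C.IsPath y m z := by
  induction l generalizing x with
  | nil => exact ⟨x, rfl, h⟩
  | cons e l ih =>
    obtain ⟨y, h1, h2⟩ := ih h.2
    exact ⟨y, ⟨h.1, h1⟩, h2⟩

theorem IsPath.end_unique {x y z : C.V} {l : List C.E} (h : C.IsPath x l y)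
    (k : C.IsPath x l z) : y = z := by
  induction l generalizing x with
  | nil => exact h.symm.trans k
  | cons e l ih => exact ih h.2 k.2

theorem Hom.tgt_comp (f : Hom C D) (e : C.E) : D.tgt (f.onE e) = f.onV (C.tgt e) := by
  unfold CubeCx.tgt
  rw [f.inv_comp, f.src_comp]

theorem IsPath.map (f : Hom C D) {x y : C.V} {l : List C.E} (h : C.IsPath x l y) :
    D.IsPath (f.onV x) (l.map f.onE) (f.onV y) := by
  induction l generalizing x with
  | nil => exact congrArg f.onV h
  | cons e l ih =>
    refine ⟨by rw [f.src_comp, h.1], ?_⟩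
    rw [f.tgt_comp]
    exact ih h.2

/-- The reversed path. -/
def revPath (C : CubeCx.{v}) (l : List C.E) : List C.E := (l.map C.inv).reverse

theorem tgt_inv (e : C.E) : C.tgt (C.inv e) = C.src e := by
  unfold CubeCx.tgt
  rw [C.inv_inv]

theorem IsPath.rev {x y : C.V} {l : List C.E} (h : C.IsPath x l y) :
    C.IsPath y (C.revPath l) x := by
  induction l generalizing x with
  | nil => exact Eq.symm h
  | cons e l ih =>
    simp only [revPath, List.map_cons, List.reverse_cons]
    refine (ih h.2).append ⟨rfl, ?_⟩
    rw [tgt_inv]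
    exact h.1

theorem Step.prepend {K : List C.E → Prop} {l m : List C.E} (h : C.Step K l m) (t : List C.E) :
    C.Step K (t ++ l) (t ++ m) := by
  cases h with
  | backtrack l m e => simpa using Step.backtrack (K := K) (t ++ l) m e
  | square l m h => simpa using Step.square (K := K) (t ++ l) m h
  | kill l m h => simpa using Step.kill (t ++ l) m h

theorem Step.map (f : Hom C D) {l m : List C.E} (h : C.Step (fun _ => False) l m) :
    D.Step (fun _ => False) (l.map f.onE) (m.map f.onE) := by
  cases h with
  | backtrack l m e =>
    simpa [f.inv_comp] using
      Step.backtrack (K := fun _ => False) (l.map f.onE) (m.map f.onE) (f.onE e)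
  | square l m h =>
    simpa using Step.square (K := fun _ => False) (l.map f.onE) (m.map f.onE) (f.sq_comp h)
  | kill l m h => exact h.elim

/-- Homotopy relative to the endpoints of paths that start at `x`. -/
def Htp (C : CubeCx.{v}) (x : C.V) (l m : List C.E) : Prop :=
  ∃ (y : C.V) (hl : C.IsPath x l y) (hm : C.IsPath x m y),
    Relation.EqvGen (PathFrom.Rel fun _ => False) (⟨y, l, hl⟩ : C.PathFrom x) ⟨y, m, hm⟩

namespace Htp

variable {x y z : C.V} {l m n : List C.E}

theorem refl (h : C.IsPath x l y) : C.Htp x l l := ⟨y, h, h, .refl _⟩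

theorem symm (h : C.Htp x l m) : C.Htp x m l := by
  obtain ⟨y, hl, hm, h⟩ := h
  exact ⟨y, hm, hl, h.symm⟩

theorem trans (h : C.Htp x l m) (k : C.Htp x m n) : C.Htp x l n := by
  obtain ⟨y, hl, hm, h⟩ := h
  obtain ⟨z, hm', hn, k⟩ := k
  obtain rfl := hm.end_unique hm'
  exact ⟨y, hl, hn, h.trans _ _ _ k⟩

theorem of_step (hl : C.IsPath x l y) (hm : C.IsPath x m y) (h : C.Step (fun _ => False) l m) :
    C.Htp x l m := ⟨y, hl, hm, .rel _ _ ⟨rfl, h⟩⟩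

theorem last_eq {p p' : C.PathFrom x}
    (h : Relation.EqvGen (PathFrom.Rel fun _ => False) p p') : p.last = p'.last := by
  induction h with
  | rel _ _ h => exact h.1
  | refl => rfl
  | symm _ _ _ ih => exact ih.symm
  | trans _ _ _ _ _ h1 h2 => exact h1.trans h2

/-- Homotopy is preserved by operations on paths that preserve elementary moves. -/
theorem transfer {x' z' : D.V} (F : List C.E → List D.E)
    (hF : ∀ l m, C.Step (fun _ => False) l m → D.Step (fun _ => False) (F l) (F m))
    (hy : ∀ l, C.IsPath x l y → D.IsPath x' (F l) z') (hl : C.IsPath x l y) (h : C.Htp x l m) :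
    D.Htp x' (F l) (F m) := by
  obtain ⟨y', hl', hm, h⟩ := h
  obtain rfl := hl'.end_unique hl
  suffices H : ∀ p p' : C.PathFrom x, Relation.EqvGen (PathFrom.Rel fun _ => False) p p' →
      p.last = y' → D.Htp x' (F p.edges) (F p'.edges) from H _ _ h rfl
  intro p p' h
  induction h with
  | rel p p' k =>
    rintro rfl
    exact of_step (hy _ p.isPath) (hy _ (k.1 ▸ p'.isPath)) (hF _ _ k.2)
  | refl p =>
    rintro rfl
    exact refl (hy _ p.isPath)
  | symm p p' k ih => exact fun e => (ih ((last_eq k).trans e)).symm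
  | trans p p' p'' h1 h2 ih1 ih2 => exact fun e => (ih1 e).trans (ih2 ((last_eq h1).symm.trans e))

theorem append (h : C.Htp x l m) (hl : C.IsPath x l y) {t : List C.E} (ht : C.IsPath y t z) :
    C.Htp x (l ++ t) (m ++ t) :=
  transfer (· ++ t) (fun _ _ h => h.append t) (fun _ k => k.append ht) hl h

theorem prepend (h : C.Htp y l m) {t : List C.E} (ht : C.IsPath x t y) :
    C.Htp x (t ++ l) (t ++ m) := by
  obtain ⟨z, hl, hm, h⟩ := h
  exact transfer (t ++ ·) (fun _ _ h => h.prepend t) (fun _ k => ht.append k) hl ⟨z, hl, hm, h⟩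

theorem map (f : Hom C D) (h : C.Htp x l m) : D.Htp (f.onV x) (l.map f.onE) (m.map f.onE) := by
  obtain ⟨z, hl, hm, h⟩ := h
  exact transfer (List.map f.onE) (fun _ _ h => h.map f) (fun _ k => k.map f) hl ⟨z, hl, hm, h⟩

theorem backtrack (h : C.IsPath x l y) {e : C.E} (he : C.src e = y) :
    C.Htp x (l ++ [e, C.inv e]) l := by
  refine of_step (y := y) (h.append ⟨he, rfl, ?_⟩) h ?_
  · rw [tgt_inv]; exact he
  · simpa using Step.backtrack (K := fun _ => False) l [] e

theorem square (h : C.IsPath x l y) {a b a' b' : C.E} (hs : C.sq a b a' b') (he : C.src a = y) :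
    C.Htp x (l ++ [a, b']) (l ++ [b, a']) := by
  have hc := C.sq_corner hs
  refine of_step (y := C.tgt b') (h.append ⟨he, hc.2.1, rfl⟩)
    (h.append ⟨hc.1.symm.trans he, hc.2.2.1, hc.2.2.2⟩) ?_
  exact Step.square (K := fun _ => False) l [] hs

theorem rev_self (h : C.IsPath x l y) : C.Htp y (C.revPath l ++ l) [] := by
  induction l generalizing x with
  | nil => exact refl (y := y) rfl
  | cons e l ih =>
    refine trans ?_ (ih h.2)
    simp only [revPath, List.map_cons, List.reverse_cons, List.append_assoc, List.cons_append,
      List.nil_append]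
    have h1 := h.2.rev
    have h2 : C.Htp (C.tgt e) [C.inv e, e] [] := by
      have := backtrack (C := C) (x := C.tgt e) (l := []) (y := C.tgt e) rfl (e := C.inv e) rfl
      rw [C.inv_inv] at this
      exact this
    have h3 : C.IsPath (C.tgt e) [C.inv e, e] (C.tgt e) := ⟨rfl, (tgt_inv e).symm, rfl⟩
    have h4 := (h2.append h3 h.2).prepend h1
    simpa [revPath] using h4

/-- Gives the compatibility of preferred paths with a reversed edge from that with the edge itself.
-/
theorem snoc_inv (h : C.IsPath x l (C.src n')) (k : C.Htp x (l ++ [n']) m) :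
    C.Htp x (m ++ [C.inv n']) l := by
  have h1 : C.IsPath x (l ++ [n']) (C.tgt n') := h.append ⟨rfl, rfl⟩
  have h2 := k.append h1 (t := [C.inv n']) (z := C.src n') ⟨rfl, tgt_inv n'⟩
  refine h2.symm.trans ?_
  simpa using backtrack h (e := n') rfl

end Htp

/-- If each vertex of `U` is joined to `x₀` by a preferred path, and the preferred paths are
compatible with the edges in `A`, then the closed paths with edges in `A` are null-homotopic. -/
theorem nullHomotopic_of_section {x₀ : C.V} {U : Set C.V} {A : Set C.E} (γ : C.V → List C.E)
    (hγ : ∀ y ∈ U, C.IsPath x₀ (γ y) y)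
    (hA : ∀ e ∈ A, C.src e ∈ U → C.tgt e ∈ U ∧ C.Htp x₀ (γ (C.src e) ++ [e]) (γ (C.tgt e)))
    {y : C.V} (hy : y ∈ U) {l : List C.E} (hl : C.IsPath y l y) (hlA : ∀ e ∈ l, e ∈ A) :
    C.NullHomotopic hl := by
  -- Absorbing the edges one at a time, the preferred path to `w` followed by a path to `z` is
  -- homotopic to the preferred path to `z`. For a closed path at `y`, cancelling the preferred path
  -- on the left gives the claim.
  have key : ∀ (l : List C.E) (w z : C.V), w ∈ U → C.IsPath w l z → (∀ e ∈ l, e ∈ A) →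
      C.Htp x₀ (γ w ++ l) (γ z) := by
    intro l
    induction l with
    | nil =>
      rintro w _ hw rfl -
      simpa using Htp.refl (hγ w hw)
    | cons e l ih =>
      rintro _ z hw ⟨rfl, h2⟩ hA'
      obtain ⟨h3, h4⟩ := hA e (hA' e (by simp)) hw
      have h5 := h4.append ((hγ _ hw).append ⟨rfl, rfl⟩) h2
      have h6 := h5.trans (ih _ z h3 h2 fun e he => hA' e (by simp [he]))
      simpa using h6
  have h1 := (key l y y hy hl hlA).prepend (hγ y hy).rev
  have h2 := Htp.rev_self (hγ y hy)
  have h3 := h2.append ((hγ y hy).rev.append (hγ y hy)) hl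
  rw [List.append_assoc] at h3
  obtain ⟨z, k1, k2, k3⟩ := h3.symm.trans (h1.trans h2)
  obtain rfl : y = z := k2
  exact Quot.eqvGen_sound k3

end CubeCx

/-! ### Convex subcomplexes of CAT(0) cube complexes are simply connected -/

section Convex

open CubeCx

variable {V : Type v} {Γ : SimpleGraph V} {S : Set V}

theorem IsPath.dist_le (hΓ : IsMedianGraph Γ) {x z : (graphCx (Γ.induce S)).V}
    {l : List (graphCx (Γ.induce S)).E} (h : (graphCx (Γ.induce S)).IsPath x l z) :
    Γ.dist (x : S).1 (z : S).1 ≤ l.length := by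
  induction l generalizing x with
  | nil =>
    obtain rfl : x = z := h
    simp
  | cons e l ih =>
    obtain ⟨rfl, h2⟩ := h
    have h3 := ih h2
    have e' : (Γ.induce S).Dart := e
    have h4 : Γ.dist ((graphCx (Γ.induce S)).src e : S).1 ((graphCx (Γ.induce S)).tgt e : S).1 = 1 :=
      SimpleGraph.dist_eq_one_iff_adj.2 (SimpleGraph.Dart.adj (G := Γ.induce S) e)
    have := hΓ.triangle ((graphCx (Γ.induce S)).src e : S).1
      ((graphCx (Γ.induce S)).tgt e : S).1 (z : S).1
    simp only [List.length_cons]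
    omega

/-- The dart from `a` to `b` in the subcomplex on `S`. -/
def edgeOf {a b : S} (h : Γ.Adj a.1 b.1) : (graphCx (Γ.induce S)).E :=
  (⟨(a, b), h⟩ : (Γ.induce S).Dart)

/-- Built backwards from `z` by steps towards `x₀`; convexity keeps them in `S`. -/
theorem exists_geodesic (hΓ : IsMedianGraph Γ) (hS : IsConvex Γ S) (x₀ : S) (z : S) :
    ∃ l, (graphCx (Γ.induce S)).IsPath x₀ l z ∧ l.length = Γ.dist x₀.1 z.1 := by
  suffices H : ∀ n, ∀ z : S, Γ.dist x₀.1 z.1 = n →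
      ∃ l, (graphCx (Γ.induce S)).IsPath x₀ l z ∧ l.length = Γ.dist x₀.1 z.1 from H _ z rfl
  intro n
  induction n with
  | zero =>
    intro z hz
    have : x₀ = z := Subtype.ext (hΓ.dist_eq_zero.1 hz)
    subst this
    exact ⟨[], rfl, by simp⟩
  | succ n ih =>
    intro z hz
    have hne : z.1 ≠ x₀.1 := by
      intro h
      rw [h] at hz
      simp at hz
    obtain ⟨w, hw, hd⟩ := hΓ.exists_closer hne
    have d1 := SimpleGraph.dist_eq_one_iff_adj.2 hw
    rw [Γ.dist_comm (u := z.1), Γ.dist_comm (u := w)] at hd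
    have hwS : w ∈ S := hS x₀ x₀.2 z z.2 w (by rw [Γ.dist_comm (u := w)]; omega)
    obtain ⟨l, hl, hlen⟩ := ih ⟨w, hwS⟩ (by simp; omega)
    refine ⟨l ++ [edgeOf (a := ⟨w, hwS⟩) (b := z) hw.symm], hl.append ⟨rfl, rfl⟩, ?_⟩
    simp only [List.length_append, hlen, List.length_singleton]
    omega

/-- Induction on the length. If the last edges start at different vertices `a`, `b`, the quadrangle
condition gives a common neighbour `c` closer to `x₀`, which convexity puts in `S`. By induction
both geodesics can be deformed to pass through `c`, and then they differ by a square. -/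
theorem geodesic_htp (hΓ : IsMedianGraph Γ) (hS : IsConvex Γ S) (x₀ : S) (z : S)
    {l m : List (graphCx (Γ.induce S)).E}
    (hl : (graphCx (Γ.induce S)).IsPath x₀ l z) (hl' : l.length = Γ.dist x₀.1 z.1)
    (hm : (graphCx (Γ.induce S)).IsPath x₀ m z) (hm' : m.length = Γ.dist x₀.1 z.1) :
    (graphCx (Γ.induce S)).Htp x₀ l m := by
  suffices H : ∀ n, ∀ z : S, Γ.dist x₀.1 z.1 = n → ∀ l m : List (graphCx (Γ.induce S)).E,
      (graphCx (Γ.induce S)).IsPath x₀ l z → l.length = n →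
      (graphCx (Γ.induce S)).IsPath x₀ m z → m.length = n →
      (graphCx (Γ.induce S)).Htp x₀ l m from H _ z rfl l m hl hl' hm hm'
  intro n
  induction n with
  | zero =>
    intro z hz l m hl hl' hm hm'
    obtain rfl := List.length_eq_zero_iff.1 hl'
    obtain rfl := List.length_eq_zero_iff.1 hm'
    exact Htp.refl hl
  | succ n ih =>
    have split : ∀ z : S, Γ.dist x₀.1 z.1 = n + 1 → ∀ l : List (graphCx (Γ.induce S)).E,
        (graphCx (Γ.induce S)).IsPath x₀ l z → l.length = n + 1 →
        ∃ (w : S) (h : Γ.Adj w.1 z.1) (l' : List (graphCx (Γ.induce S)).E),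
          l = l' ++ [edgeOf h] ∧ (graphCx (Γ.induce S)).IsPath x₀ l' w ∧
            l'.length = n ∧ Γ.dist x₀.1 w.1 = n := by
      intro z hz l hl hlen
      rcases List.eq_nil_or_concat l with rfl | ⟨l', e, rfl⟩
      · simp at hlen
      · simp only [List.concat_eq_append] at hl hlen ⊢
        obtain ⟨w, h1, rfl, h3⟩ := hl.of_append
        obtain rfl : _ = z := h3
        have hadj := SimpleGraph.Dart.adj (G := Γ.induce S) e
        refine ⟨(graphCx (Γ.induce S)).src e, hadj, l', rfl, h1, by simpa using hlen, ?_⟩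
        have h4 := IsPath.dist_le hΓ h1
        have h5 := hΓ.triangle x₀.1 ((graphCx (Γ.induce S)).src e : S).1
          ((graphCx (Γ.induce S)).tgt e : S).1
        have h6 : Γ.dist ((graphCx (Γ.induce S)).src e : S).1
          ((graphCx (Γ.induce S)).tgt e : S).1 = 1 := SimpleGraph.dist_eq_one_iff_adj.2 hadj
        simp only [List.length_append, List.length_singleton] at hlen
        omega
    intro z hz l m hl hl' hm hm'
    obtain ⟨a, ha, l₁, rfl, hl1, hl2, hl3⟩ := split z hz l hl hl'
    obtain ⟨b, hb, m₁, rfl, hm1, hm2, hm3⟩ := split z hz m hm hm'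
    have pa : (graphCx (Γ.induce S)).IsPath a [edgeOf ha] z := ⟨rfl, rfl⟩
    have pb : (graphCx (Γ.induce S)).IsPath b [edgeOf hb] z := ⟨rfl, rfl⟩
    by_cases hab : a = b
    · subst hab
      exact (ih a hl3 l₁ m₁ hl1 hl2 hm1 hm2).append hl1 pa
    have hab' : a.1 ≠ b.1 := fun h => hab (Subtype.ext h)
    obtain ⟨c, hc1, hc2, hc3⟩ := hΓ.quadrangle (w := x₀.1) ha.symm hb.symm hab' hl3 hm3
    have d1 := SimpleGraph.dist_eq_one_iff_adj.2 hc1.symm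
    have hcS : c ∈ S := hS x₀ x₀.2 a a.2 c (by omega)
    obtain ⟨k, hk, hk'⟩ := exists_geodesic hΓ hS x₀ ⟨c, hcS⟩
    have hk'' : k.length + 1 = n := by rw [hk']; exact hc3
    have ka : (graphCx (Γ.induce S)).IsPath x₀
      (k ++ [edgeOf (a := ⟨c, hcS⟩) (b := a) hc1.symm]) a := hk.append ⟨rfl, rfl⟩
    have kb : (graphCx (Γ.induce S)).IsPath x₀
      (k ++ [edgeOf (a := ⟨c, hcS⟩) (b := b) hc2.symm]) b := hk.append ⟨rfl, rfl⟩
    have ea := (ih a hl3 l₁ _ hl1 hl2 ka (by simpa using hk'')).append hl1 pa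
    have eb := (ih b hm3 m₁ _ hm1 hm2 kb (by simpa using hk'')).append hm1 pb
    refine ea.trans (Htp.trans ?_ eb.symm)
    simp only [List.append_assoc, List.cons_append, List.nil_append]
    have hs : (graphCx (Γ.induce S)).sq (edgeOf (a := ⟨c, hcS⟩) (b := a) hc1.symm)
        (edgeOf (a := ⟨c, hcS⟩) (b := b) hc2.symm) (edgeOf hb) (edgeOf ha) := by
      refine ⟨rfl, rfl, rfl, rfl, hab, ?_⟩
      intro h
      have h' : c = z.1 := congrArg Subtype.val h
      rw [h'] at hc3
      omega
    exact Htp.square hk hs rfl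

/-- A convex subcomplex has preferred paths from a given vertex which are compatible with all
edges. -/
theorem exists_section (hΓ : IsMedianGraph Γ) (hS : IsConvex Γ S) (x₀ : S) :
    ∃ γ : (graphCx (Γ.induce S)).V → List (graphCx (Γ.induce S)).E, γ x₀ = [] ∧
      (∀ z, (graphCx (Γ.induce S)).IsPath x₀ (γ z) z) ∧
      ∀ e, (graphCx (Γ.induce S)).Htp x₀ (γ ((graphCx (Γ.induce S)).src e) ++ [e])
        (γ ((graphCx (Γ.induce S)).tgt e)) := by
  have hex := fun z : S => exists_geodesic hΓ hS x₀ z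
  choose γ h1 h2 using hex
  refine ⟨γ, ?_, h1, fun e => ?_⟩
  · refine List.length_eq_zero_iff.1 ?_
    rw [h2]
    simp
  · have hadj : Γ.Adj ((graphCx (Γ.induce S)).src e : S).1 ((graphCx (Γ.induce S)).tgt e : S).1 :=
      SimpleGraph.Dart.adj (G := Γ.induce S) e
    -- The preferred paths are geodesics. One end of `e` is a step farther from `x₀` than the other,
    -- so prolonging the path to the nearer end by `e` or its inverse gives a geodesic to the
    -- farther one.
    rcases hΓ.dist_adj hadj x₀.1 with h | h
    · have k1 : (graphCx (Γ.induce S)).IsPath x₀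
          (γ ((graphCx (Γ.induce S)).tgt e) ++ [(graphCx (Γ.induce S)).inv e])
            ((graphCx (Γ.induce S)).src e) := (h1 _).append ⟨rfl, tgt_inv e⟩
      have k2 : (graphCx (Γ.induce S)).Htp x₀ _ _ :=
        geodesic_htp hΓ hS x₀ _ k1
          (by rw [List.length_append, h]; exact congrArg (· + 1) (h2 _)) (h1 _) (h2 _)
      have k3 := Htp.snoc_inv (n' := (graphCx (Γ.induce S)).inv e) (h1 _) k2
      rwa [(graphCx (Γ.induce S)).inv_inv] at k3
    · exact geodesic_htp hΓ hS x₀ _ ((h1 _).append ⟨rfl, rfl⟩)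
        (by rw [List.length_append, h]; exact congrArg (· + 1) (h2 _)) (h1 _) (h2 _)

end Convex

end CubicalSC

namespace CubicalSC

open CubeCx

/-! ### The systole of a necklace -/

theorem next_val {t : ℕ} (k : Fin t) : (next k).1 = if k.1 + 1 = t then 0 else k.1 + 1 := by
  have := k.2
  unfold next
  split_ifs with h
  · simp [h]
  · exact Nat.mod_eq_of_lt (by omega)

theorem next_injective {t : ℕ} : Function.Injective (next (t := t)) := by
  intro k l h
  have h' := congrArg Fin.val h
  rw [next_val, next_val] at h'
  have := k.2
  have := l.2
  apply Fin.ext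
  split_ifs at h' <;> omega

/-- Recursion along a cycle that is cut open after `k₀`. -/
theorem exists_cyclic_rec {t : ℕ} {α : Type*} (P : Fin t → α → Prop) (k₀ : Fin t) (a₀ : α)
    (h₀ : P (next k₀) a₀) (F : Fin t → α → α) (hF : ∀ k a, P k a → P (next k) (F k a)) :
    ∃ δ : Fin t → α, (∀ k, P k (δ k)) ∧ δ (next k₀) = a₀ ∧
      ∀ k, k ≠ k₀ → δ (next k) = F k (δ k) := by
  let κ : ℕ → Fin t := fun i => next^[i] (next k₀)
  let D : ℕ → α := fun i => Nat.rec a₀ (fun i a => F (κ i) a) i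
  have hκ : ∀ i, κ (i + 1) = next (κ i) := fun i => Function.iterate_succ_apply' _ _ _
  have hD : ∀ i, P (κ i) (D i) := by
    intro i
    induction i with
    | zero => exact h₀
    | succ i ih => rw [hκ]; exact hF _ _ ih
  -- The number of cyclic steps from `next k₀` to `k`. It increases by one along every step except
  -- the one that leaves `k₀`, where the cycle is cut.
  let idx : Fin t → ℕ := fun k => if k₀.1 < k.1 then k.1 - k₀.1 - 1 else k.1 + t - k₀.1 - 1
  have hval : ∀ i, i < t → (κ i).1 = if k₀.1 + 1 + i < t then k₀.1 + 1 + i else k₀.1 + 1 + i - t := by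
    intro i
    have := k₀.2
    induction i with
    | zero =>
      intro _
      change (next k₀).1 = _
      rw [next_val]
      split_ifs <;> omega
    | succ i ih =>
      intro hi
      rw [hκ, next_val, ih (by omega)]
      split_ifs <;> omega
  have hidx : ∀ k, κ (idx k) = k := by
    intro k
    have := k.2
    have := k₀.2
    have hlt : idx k < t := by
      simp only [idx]; split_ifs <;> omega
    apply Fin.ext
    rw [hval _ hlt]
    simp only [idx]
    split_ifs <;> omega
  refine ⟨fun k => D (idx k), fun k => ?_, ?_, fun k hk => ?_⟩
  · have := hD (idx k)
    rwa [hidx] at this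
  · have : idx (next k₀) = 0 := by
      have := k₀.2
      simp only [idx, next_val]
      split_ifs <;> omega
    simp only [this]
    rfl
  · have : idx (next k) = idx k + 1 := by
      have := k₀.2
      have := k.2
      have : k.1 ≠ k₀.1 := fun h => hk (Fin.ext h)
      simp only [idx, next_val]
      split_ifs <;> omega
    simp only [this]
    change F (κ (idx k)) (D (idx k)) = _
    rw [hidx]

section Necklace

variable {t : ℕ} {B : Fin t → CubeCx.{v}} {ini ter : ∀ k, (B k).V} {q : ℕ}

/-- The inclusion of a bead in a necklace. -/
def beadIncl (ini ter : ∀ k, (B k).V) (q : ℕ) (k : Fin t) : Hom (B k) (necklace B ini ter q) where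
  onV := .bead k
  onE := .bead k
  src_comp _ := rfl
  inv_comp _ := rfl
  sq_comp h := .mk k h

/-- The `s`-th edge of the string `σ k`. -/
def stringE (ini ter : ∀ k, (B k).V) (q : ℕ) (k : Fin t) (s : Fin (2 * q)) (fwd : Bool) :
    (necklace B ini ter q).E := NeckE.string k s fwd

/-- The forward path on the string `σ k` from position `a` to position `s`. -/
def stringPath (ini ter : ∀ k, (B k).V) (q : ℕ) (k : Fin t) (a : ℕ) :
    ℕ → List (necklace B ini ter q).E
  | 0 => []
  | s + 1 => if h : a ≤ s ∧ s < 2 * q then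
        stringPath ini ter q k a s ++ [stringE ini ter q k ⟨s, h.2⟩ true]
      else stringPath ini ter q k a s

theorem stringPath_of_le {k : Fin t} {a s : ℕ} (h : s ≤ a) : stringPath ini ter q k a s = [] := by
  induction s with
  | zero => rfl
  | succ s ih =>
    rw [stringPath, dif_neg (by omega), ih (by omega)]

theorem stringPath_succ {k : Fin t} {a s : ℕ} (h : a ≤ s) (hs : s < 2 * q) :
    stringPath ini ter q k a (s + 1) = stringPath ini ter q k a s ++ [stringE ini ter q k ⟨s, hs⟩ true] := by
  rw [stringPath, dif_pos ⟨h, hs⟩]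

theorem isPath_stringPath {k : Fin t} {a s : ℕ} (h : a ≤ s) (hs : s ≤ 2 * q) :
    (necklace B ini ter q).IsPath (neckPos B ini ter q k a) (stringPath ini ter q k a s)
      (neckPos B ini ter q k s) := by
  induction s with
  | zero =>
    obtain rfl : a = 0 := by omega
    rfl
  | succ s ih =>
    rcases Nat.lt_or_ge s a with h' | h'
    · obtain rfl : a = s + 1 := by omega
      rw [stringPath_of_le le_rfl]
      rfl
    · rw [stringPath_succ h' (by omega)]
      exact (ih h' (by omega)).append ⟨rfl, rfl⟩

/-- The strings have `2 q t` unoriented edges in all, so a shorter closed path misses one. The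
hypothesis on the beads provides preferred paths in each of them; along the cut-open necklace these
fit together to preferred paths compatible with all edges but the missing one. -/
theorem nullHomotopic_of_short
    (hB : ∀ k, ∃ γ : (B k).V → List (B k).E, γ (ini k) = [] ∧
      (∀ z, (B k).IsPath (ini k) (γ z) z) ∧
      ∀ e, (B k).Htp (ini k) (γ ((B k).src e) ++ [e]) (γ ((B k).tgt e)))
    {y : (necklace B ini ter q).V} {l : List (necklace B ini ter q).E}
    (hl : (necklace B ini ter q).IsPath y l y) (hlen : l.length < 2 * q * t) :
    (necklace B ini ter q).NullHomotopic hl := by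
  classical
  choose γ γini γpath γedge using hB
  have hq : 0 < q := by
    rcases Nat.eq_zero_or_pos q with rfl | h
    · simp at hlen
    · exact h
  -- an edge of a string that is not used
  obtain ⟨k₀, s₀, hks⟩ : ∃ (k₀ : Fin t) (s₀ : Fin (2 * q)), ∀ o, NeckE.string k₀ s₀ o ∉ l := by
    let φ : (necklace B ini ter q).E → Option (Fin t × Fin (2 * q)) := fun e =>
      match (e : NeckE B q) with
      | .bead _ _ => none
      | .string k s _ => some (k, s)
    have hcard : ((l.map φ).reduceOption.toFinset).card < Fintype.card (Fin t × Fin (2 * q)) := by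
      refine ((List.toFinset_card_le _).trans (List.reduceOption_length_le _)).trans_lt ?_
      have h2 : l.length < t * (2 * q) := hlen.trans_eq (mul_comm _ _)
      rw [List.length_map]
      simpa using h2
    obtain ⟨⟨k₀, s₀⟩, hk⟩ : ∃ x, x ∉ (l.map φ).reduceOption.toFinset := by
      by_contra hcon
      push Not at hcon
      have := Finset.eq_univ_iff_forall.2 hcon
      rw [this, Finset.card_univ] at hcard
      exact lt_irrefl _ hcard
    refine ⟨k₀, s₀, fun o ho => hk ?_⟩
    rw [List.mem_toFinset, List.reduceOption_mem_iff]
    exact List.mem_map.2 ⟨_, ho, rfl⟩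
  -- Preferred paths start at the forward end of the missing edge and run forwards around the
  -- necklace; `δ k` below is the one to the initial vertex of the bead `k`.
  let x₀ : (necklace B ini ter q).V := neckPos B ini ter q k₀ (s₀ + 1)
  let β : ∀ k, Hom (B k) (necklace B ini ter q) := beadIncl ini ter q
  have pos0 : ∀ k, neckPos B ini ter q k 0 = .bead k (ter k) := fun k => by simp [neckPos]
  have pos1 : ∀ k, neckPos B ini ter q k (2 * q) = .bead (next k) (ini (next k)) := fun k => by
    simp [neckPos, hq]
  obtain ⟨δ, hδ, hδ0, hδ1⟩ := exists_cyclic_rec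
    (P := fun k (p : List (necklace B ini ter q).E) =>
      (necklace B ini ter q).IsPath x₀ p ((β k).onV (ini k))) k₀
    (stringPath ini ter q k₀ (s₀ + 1) (2 * q))
    (by
      have := isPath_stringPath (B := B) (ini := ini) (ter := ter) (q := q) (k := k₀)
        (a := s₀ + 1) (s := 2 * q) (by omega) le_rfl
      rw [pos1] at this
      exact this)
    (fun k p => p ++ ((γ k (ter k)).map (β k).onE ++ stringPath ini ter q k 0 (2 * q)))
    (by
      intro k p hp
      have h1 := (γpath k (ter k)).map (β k)
      have h2 := isPath_stringPath (B := B) (ini := ini) (ter := ter) (q := q) (k := k)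
        (a := 0) (s := 2 * q) (by omega) le_rfl
      rw [pos0, pos1] at h2
      exact hp.append (h1.append h2))
  -- the preferred path to the position `s` of the string `σ k`
  let ps : Fin t → ℕ → List (necklace B ini ter q).E := fun k s =>
    if k = k₀ ∧ s₀.1 < s then stringPath ini ter q k₀ (s₀ + 1) s
    else δ k ++ ((γ k (ter k)).map (β k).onE ++ stringPath ini ter q k 0 s)
  let Γ : (necklace B ini ter q).V → List (necklace B ini ter q).E := fun y =>
    match y with
    | .bead k z => δ k ++ (γ k z).map (β k).onE
    | .string k s _ _ => ps k s
  have hps : ∀ k s, s ≤ 2 * q → (necklace B ini ter q).IsPath x₀ (ps k s)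
      (neckPos B ini ter q k s) := by
    intro k s hs
    simp only [ps]
    split_ifs with h
    · obtain ⟨rfl, h⟩ := h
      exact isPath_stringPath (Nat.succ_le_of_lt h) hs
    · have h2 := isPath_stringPath (B := B) (ini := ini) (ter := ter) (q := q) (k := k)
        (a := 0) (s := s) (by omega) hs
      rw [pos0] at h2
      exact (hδ k).append (((γpath k (ter k)).map (β k)).append h2)
  have hΓ : ∀ k s, s ≤ 2 * q → Γ (neckPos B ini ter q k s) = ps k s := by
    intro k s hs
    rcases Nat.eq_zero_or_pos s with rfl | h0
    · rw [pos0]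
      simp [Γ, ps, stringPath]
    rcases hs.eq_or_lt with rfl | h1
    · rw [pos1]
      simp only [Γ, γini, List.map_nil, List.append_nil, ps, s₀.2, and_true]
      split_ifs with hk
      · rw [hk]; exact hδ0
      · exact hδ1 k hk
    · simp [neckPos, h0, h1, Γ]
  -- The preferred paths to consecutive string positions differ by one edge, except across the
  -- missing edge, where they jump from the end of the circuit to its start.
  have hstr : ∀ k (s : Fin (2 * q)), (k ≠ k₀ ∨ s ≠ s₀) →
      ps k (s + 1) = ps k s ++ [stringE ini ter q k s true] := by
    intro k s hne
    simp only [ps]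
    by_cases hk : k = k₀
    · subst hk
      have hs : s.1 ≠ s₀.1 := fun h => hne.elim (fun h => h rfl) fun h' => h' (Fin.ext h)
      by_cases h : s₀.1 < s.1
      · rw [if_pos ⟨rfl, by omega⟩, if_pos ⟨rfl, h⟩, stringPath_succ (by omega) s.2]
      · rw [if_neg (by omega), if_neg (by omega), stringPath_succ (by omega) s.2]
        simp
    · rw [if_neg (by simp [hk]), if_neg (by simp [hk]), stringPath_succ (by omega) s.2]
      simp
  have hΓp : ∀ y, (necklace B ini ter q).IsPath x₀ (Γ y) y := by
    rintro (⟨k, z⟩ | ⟨k, s, h0, h1⟩)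
    · exact (hδ k).append ((γpath k z).map (β k))
    · have := hps k s h1.le
      simpa [neckPos, h0, h1] using this
  refine nullHomotopic_of_section (x₀ := x₀) (U := Set.univ)
    (A := {e | ∀ o, e ≠ NeckE.string k₀ s₀ o}) Γ (fun y _ => hΓp y) ?_ (Set.mem_univ y) hl
    (fun e he o heq => hks o (heq ▸ he))
  rintro (⟨k, e⟩ | ⟨k, s, o⟩) hA -
  · refine ⟨Set.mem_univ _, ?_⟩
    have h1 := ((γedge k e).map (β k)).prepend (hδ k)
    have e1 : Γ ((necklace B ini ter q).src (.bead k e)) ++ [(β k).onE e] =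
      δ k ++ ((γ k ((B k).src e) ++ [e]).map (β k).onE) := by
      simp only [List.map_append, ← List.append_assoc]
      rfl
    rw [← e1] at h1
    exact h1
  · refine ⟨Set.mem_univ _, ?_⟩
    have hne : k ≠ k₀ ∨ s ≠ s₀ := by
      by_contra hcon
      push Not at hcon
      obtain ⟨rfl, rfl⟩ := hcon
      exact hA o rfl
    have h1 := hstr k s hne
    have h2 : (necklace B ini ter q).Htp x₀
        (Γ (neckPos B ini ter q k s) ++ [stringE ini ter q k s true])
        (Γ (neckPos B ini ter q k (s + 1))) := by
      rw [hΓ k s (by omega), hΓ k (s + 1) (by omega), h1]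
      exact Htp.refl ((hps k s (by omega)).append ⟨rfl, rfl⟩)
    cases o
    · exact h2.snoc_inv (n' := stringE ini ter q k s true) (hΓp _)
    · exact h2

theorem le_systole
    (hB : ∀ k, ∃ γ : (B k).V → List (B k).E, γ (ini k) = [] ∧
      (∀ z, (B k).IsPath (ini k) (γ z) z) ∧
      ∀ e, (B k).Htp (ini k) (γ ((B k).src e) ++ [e]) (γ ((B k).tgt e))) :
    ((2 * q * t : ℕ) : ℝ≥0∞) ≤ (necklace B ini ter q).systole := by
  refine le_iInf fun y => le_iInf fun l => le_iInf fun hl => le_iInf fun hne => ?_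
  by_contra hlt
  rw [not_le, Nat.cast_lt] at hlt
  exact hne (nullHomotopic_of_short hB hl hlt)

end Necklace

/-! ### Necklaces of cyclic sequences of group elements -/

section Neck

variable {r : ℕ} {G : Fin r → Type u} [∀ j, Group (G j)] (X : ∀ j, NPCComplex.{u, v} (G j))

/-- The bead of an element of one of the factors. -/
def sigmaBead (x : Σ j, G j) : CubeCx.{v} := (X x.1).bead x.2

/-- The necklace of a cyclic sequence. -/
def neck {t : ℕ} (h : Fin t → Σ j, G j) (q : ℕ) : CubeCx.{v} :=
  necklace (fun k => sigmaBead X (h k)) (fun k => (X (h k).1).beadIni (h k).2)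
    (fun k => (X (h k).1).beadTer (h k).2) q

/-- The map from the necklace of a cyclic sequence to the long wedge. -/
def neckMap {t : ℕ} (h : Fin t → Σ j, G j) (q : ℕ) : Hom (neck X h q) (wedgeCx X q) :=
  necklaceMap q (fun j => (X j).cx) (fun j => (X j).cxBase) (fun k => (h k).1)
    (fun k => (X (h k).1).beadMap (h k).2)
    (fun k => (X (h k).1).beadMap_ini (h k).2)
    (fun k => (X (h k).1).beadMap_ter (h k).2)

theorem le_systole_neck {t : ℕ} (h : Fin t → Σ j, G j) (q : ℕ) :
    ((2 * q * t : ℕ) : ℝ≥0∞) ≤ (neck X h q).systole := by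
  refine le_systole fun k => ?_
  exact exists_section (X (h k).1).isMedian (isConvex_hull _) _

theorem finite_bead (x : Σ j, G j) : Finite (sigmaBead X x).V :=
  ((X x.1).isMedian.finite_hull_pair _ _).to_subtype

end Neck

end CubicalSC

namespace CubicalSC

open CubeCx

/-! ### Isomorphisms over a complex -/

/-- `f` is an isomorphism from `C` to `D` over `Z`. -/
structure IsoOver {C D Z : CubeCx.{v}} (M : Hom C Z) (N : Hom D Z) (f : Hom C D) : Prop where
  bijV : Function.Bijective f.onV
  bijE : Function.Bijective f.onE
  sq : ∀ a b a' b', D.sq (f.onE a) (f.onE b) (f.onE a') (f.onE b') → C.sq a b a' b'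
  overV : ∀ x, N.onV (f.onV x) = M.onV x
  overE : ∀ e, N.onE (f.onE e) = M.onE e

namespace IsoOver

variable {C D F Z : CubeCx.{v}} {M : Hom C Z} {N : Hom D Z} {O : Hom F Z} {f : Hom C D}
  {g : Hom D F}

/-- The composition of combinatorial maps. -/
def _root_.CubicalSC.CubeCx.Hom.trans (f : Hom C D) (g : Hom D F) : Hom C F where
  onV x := g.onV (f.onV x)
  onE e := g.onE (f.onE e)
  src_comp e := by rw [g.src_comp, f.src_comp]
  inv_comp e := by rw [g.inv_comp, f.inv_comp]
  sq_comp h := g.sq_comp (f.sq_comp h)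

theorem trans (h : IsoOver M N f) (k : IsoOver N O g) : IsoOver M O (f.trans g) where
  bijV := k.bijV.comp h.bijV
  bijE := k.bijE.comp h.bijE
  sq _ _ _ _ s := h.sq _ _ _ _ (k.sq _ _ _ _ s)
  overV x := (k.overV _).trans (h.overV x)
  overE x := (k.overE _).trans (h.overE x)

theorem exists_symm (h : IsoOver M N f) : ∃ g : Hom D C, IsoOver N M g ∧
    (∀ x, g.onV (f.onV x) = x) ∧ (∀ y, f.onV (g.onV y) = y) ∧
    (∀ x, g.onE (f.onE x) = x) ∧ (∀ y, f.onE (g.onE y) = y) := by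
  let v := Equiv.ofBijective _ h.bijV
  let e := Equiv.ofBijective _ h.bijE
  have hv : ∀ y, f.onV (v.symm y) = y := v.apply_symm_apply
  have he : ∀ y, f.onE (e.symm y) = y := e.apply_symm_apply
  let g : Hom D C :=
    { onV := v.symm
      onE := e.symm
      src_comp := fun a => h.bijV.1 (by rw [hv, ← f.src_comp, he])
      inv_comp := fun a => h.bijE.1 (by rw [← f.inv_comp, he, he])
      sq_comp := fun {a b a' b'} s => h.sq _ _ _ _ (by simpa only [he] using s) }
  refine ⟨g, ⟨v.symm.bijective, e.symm.bijective, fun a b a' b' s => ?_, fun x => ?_, fun x => ?_⟩,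
    v.symm_apply_apply, hv, e.symm_apply_apply, he⟩
  · have := f.sq_comp s
    change D.sq (f.onE (e.symm a)) (f.onE (e.symm b)) (f.onE (e.symm a')) (f.onE (e.symm b')) at this
    simpa only [he] using this
  · change M.onV (v.symm x) = _
    rw [← h.overV, hv]
  · change M.onE (e.symm x) = _
    rw [← h.overE, he]

end IsoOver

theorem CubicalPresentation.isAut_of_isoOver (P : CubicalPresentation.{v}) {i : P.I}
    {f : Hom (P.Y i) (P.Y i)} (h : IsoOver (P.map i) (P.map i) f) : P.IsAut i f.onV := by
  obtain ⟨g, hg, h1, h2, h3, h4⟩ := h.exists_symm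
  exact ⟨f, g, rfl, funext h2, funext h1, funext h4, funext h3, funext h.overV, funext h.overE⟩

/-! ### The action on a CAT(0) cube complex -/

namespace NPCComplex

variable {G : Type u} [Group G] (X : NPCComplex.{u, v} G)

theorem dist_smul_le (g : G) (x y : X.V) : X.graph.dist (g • x) (g • y) ≤ X.graph.dist x y := by
  obtain ⟨p, hp⟩ := X.isMedian.connected.exists_walk_length_eq_dist x y
  have := SimpleGraph.dist_le
    (p.map (⟨fun x => g • x, fun {a b} h => X.adj_smul g a b h⟩ : X.graph →g X.graph))
  rw [SimpleGraph.Walk.length_map, hp] at this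
  exact this

theorem dist_smul (g : G) (x y : X.V) : X.graph.dist (g • x) (g • y) = X.graph.dist x y := by
  refine le_antisymm (X.dist_smul_le g x y) ?_
  have := X.dist_smul_le g⁻¹ (g • x) (g • y)
  rwa [inv_smul_smul, inv_smul_smul] at this

/-- A vertex is a `0`-cube, so freeness on cubes covers it. -/
theorem smul_eq_self {g : G} {x : X.V} (h : g • x = x) : g = 1 := by
  by_contra hg
  refine X.free g hg {x} ⟨0, fun _ => x, fun a b _ => Subsingleton.elim a b, fun a b => ?_, ?_⟩ ?_
  · simp [Subsingleton.elim a b]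
  · ext; simp
  · simp [h]

theorem smul_inj {g g' : G} {x : X.V} (h : g • x = g' • x) : g = g' := by
  have : (g'⁻¹ * g) • x = x := by rw [mul_smul, h, inv_smul_smul]
  have := X.smul_eq_self this
  rwa [inv_mul_eq_one, eq_comm] at this

/-- Translation by `g` is an isometry that carries the pair `p`, `g⁻¹ p` to `g p`, `p`, hence the
hull of one pair to that of the other. -/
theorem smul_mem_beadSet {g : G} {z : X.V} (h : z ∈ X.beadSet g⁻¹) : g • z ∈ X.beadSet g := by
  intro T hT
  have key : z ∈ (fun x => g • x) ⁻¹' T := by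
    refine h _ ⟨?_, ?_⟩
    · rintro x (rfl | rfl)
      · exact hT.1 (by simp)
      · change g • g⁻¹ • X.base ∈ T
        rw [smul_inv_smul]
        exact hT.1 (by simp)
    · intro x hx y hy w hw
      refine hT.2 _ hx _ hy _ ?_
      simpa only [X.dist_smul] using hw
  exact key

end NPCComplex

/-! ### Rotations and flips of necklaces -/

section Symmetry

variable {r : ℕ} {G : Fin r → Type u} [∀ j, Group (G j)] (X : ∀ j, NPCComplex.{u, v} (G j))
  {t : ℕ} (q : ℕ)

/-- Inversion in equational form, needed for squares whose sides are images under a map of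
necklaces. -/
theorem NeckSq.exists_eq {B : Fin t → CubeCx.{v}} {x y z w : NeckE B q} (h : NeckSq B q x y z w) :
    ∃ (k : Fin t) (a b a' b' : (B k).E), (B k).sq a b a' b' ∧
      x = .bead k a ∧ y = .bead k b ∧ z = .bead k a' ∧ w = .bead k b' := by
  cases h with
  | mk k h => exact ⟨k, _, _, _, _, h, rfl, rfl, rfl, rfl⟩

/-- The two sequences agree after a rotation. -/
def rotHom (h : Fin t → Σ j, G j) (e : Fin t ≃ Fin t) (he : ∀ k, e (next k) = next (e k)) :
    Hom (neck X (h ∘ e) q) (neck X h q) where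
  onV
    | .bead k z => .bead (e k) z
    | .string k s h0 h1 => .string (e k) s h0 h1
  onE
    | .bead k a => .bead (e k) a
    | .string k s o => .string (e k) s o
  src_comp := by
    have key : ∀ (k : Fin t) (s : ℕ), (match (neckPos (fun k => sigmaBead X ((h ∘ e) k))
        (fun k => (X ((h ∘ e) k).1).beadIni ((h ∘ e) k).2)
        (fun k => (X ((h ∘ e) k).1).beadTer ((h ∘ e) k).2) q k s) with
      | .bead k z => NeckV.bead (e k) z
      | .string k s h0 h1 => .string (e k) s h0 h1 : NeckV (fun k => sigmaBead X (h k)) q) =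
        neckPos (fun k => sigmaBead X (h k)) (fun k => (X (h k).1).beadIni (h k).2)
          (fun k => (X (h k).1).beadTer (h k).2) q (e k) s := by
      intro k s
      unfold neckPos
      split_ifs
      · rfl
      · simp only
        rw [← he]
        rfl
      · rfl
    rintro (⟨k, a⟩ | ⟨k, s, o⟩)
    · rfl
    · cases o
      · exact (key k (s + 1)).symm
      · exact (key k s).symm
  inv_comp := by
    rintro (⟨k, a⟩ | ⟨k, s, o⟩) <;> rfl
  sq_comp := by
    rintro _ _ _ _ ⟨k, s⟩
    exact .mk (e k) s

theorem rotHom_isoOver (h : Fin t → Σ j, G j) (e : Fin t ≃ Fin t)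
    (he : ∀ k, e (next k) = next (e k)) :
    IsoOver (neckMap X (h ∘ e) q) (neckMap X h q) (rotHom X q h e he) where
  bijV := by
    constructor
    · rintro (⟨k, z⟩ | ⟨k, s, h0, h1⟩) (⟨k', z'⟩ | ⟨k', s', h0', h1'⟩) hh
      · injection hh with hk hz
        obtain rfl := e.injective hk
        obtain rfl := eq_of_heq hz
        rfl
      · injection hh
      · injection hh
      · injection hh with hk hs
        obtain rfl := e.injective hk
        subst hs
        rfl
    · rintro (⟨k, z⟩ | ⟨k, s, h0, h1⟩)
      · obtain ⟨k, rfl⟩ := e.surjective k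
        exact ⟨.bead k z, rfl⟩
      · obtain ⟨k, rfl⟩ := e.surjective k
        exact ⟨.string k s h0 h1, rfl⟩
  bijE := by
    constructor
    · rintro (⟨k, z⟩ | ⟨k, s, o⟩) (⟨k', z'⟩ | ⟨k', s', o'⟩) hh
      · injection hh with hk hz
        obtain rfl := e.injective hk
        obtain rfl := eq_of_heq hz
        rfl
      · injection hh
      · injection hh
      · injection hh with hk hs ho
        obtain rfl := e.injective hk
        subst hs ho
        rfl
    · rintro (⟨k, z⟩ | ⟨k, s, o⟩)
      · obtain ⟨k, rfl⟩ := e.surjective k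
        exact ⟨.bead k z, rfl⟩
      · obtain ⟨k, rfl⟩ := e.surjective k
        exact ⟨.string k s o, rfl⟩
  sq := by
    intro a b a' b' hs
    obtain ⟨k, x, y, z, w, hsq, h1, h2, h3, h4⟩ := NeckSq.exists_eq q hs
    rcases a with ⟨k1, a⟩ | ⟨_, _, _⟩ <;> [skip; injection h1]
    rcases b with ⟨k2, b⟩ | ⟨_, _, _⟩ <;> [skip; injection h2]
    rcases a' with ⟨k3, a'⟩ | ⟨_, _, _⟩ <;> [skip; injection h3]
    rcases b' with ⟨k4, b'⟩ | ⟨_, _, _⟩ <;> [skip; injection h4]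
    injection h1 with e1 h1
    injection h2 with e2 h2
    injection h3 with e3 h3
    injection h4 with e4 h4
    obtain rfl := e.injective (e1.trans e2.symm)
    obtain rfl := e.injective (e1.trans e3.symm)
    obtain rfl := e.injective (e1.trans e4.symm)
    subst e1
    obtain rfl := eq_of_heq h1
    obtain rfl := eq_of_heq h2
    obtain rfl := eq_of_heq h3
    obtain rfl := eq_of_heq h4
    exact .mk k1 hsq
  overV := by
    rintro (⟨k, z⟩ | ⟨k, s, h0, h1⟩)
    · rfl
    · change stringPos q (fun j => (X j).cx) (fun j => (X j).cxBase) (fun k => (h k).1) (e k) s =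
        stringPos q (fun j => (X j).cx) (fun j => (X j).cxBase) (fun k => (h (e k)).1) k s
      simp only [stringPos, ← he]
  overE := by
    rintro (⟨k, z⟩ | ⟨k, s, o⟩)
    · rfl
    · change stringEdge q (fun j => (X j).cx) (fun k => (h k).1) (e k) s o =
        stringEdge q (fun j => (X j).cx) (fun k => (h (e k)).1) k s o
      simp only [stringEdge, ← he]

/-- Sequences that agree up to a rotation have isomorphic necklaces. -/
theorem exists_rot_isoOver (h h' : Fin t → Σ j, G j) (e : Fin t ≃ Fin t)
    (he : ∀ k, e (next k) = next (e k)) (hh : ∀ k, h' (e k) = h k) :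
    ∃ f : Hom (neck X h q) (neck X h' q), IsoOver (neckMap X h q) (neckMap X h' q) f ∧
      ∀ k s h0 h1, f.onV (.string k s h0 h1) = .string (e k) s h0 h1 := by
  obtain rfl : h' ∘ e = h := funext hh
  exact ⟨rotHom X q h' e he, rotHom_isoOver X q h' e he, fun _ _ _ _ => rfl⟩

/-- The inverse of a syllable. -/
def invSyl (x : Σ j, G j) : Σ j, G j := ⟨x.1, x.2⁻¹⟩

/-- The sequence of the inverse word. -/
def flipSeq (h : Fin t → Σ j, G j) (k : Fin t) : Σ j, G j := invSyl (h k.rev)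

/-- The index of a flipped string: the string that follows `k` in the inverse word is the string
from `(next k).rev` to `k.rev`, run backwards. -/
theorem next_rev_next (k : Fin t) : next (next k).rev = k.rev := by
  have := k.2
  apply Fin.ext
  rw [next_val, Fin.val_rev, Fin.val_rev, next_val]
  split_ifs <;> omega

/-- The bead of the inverse is a translate of the bead. -/
def flipVert (x : Σ j, G j) (z : (sigmaBead X (invSyl x)).V) : (sigmaBead X x).V :=
  (⟨x.2 • Subtype.val (p := (· ∈ (X x.1).beadSet x.2⁻¹)) z,
    (X x.1).smul_mem_beadSet (Subtype.property (p := (· ∈ (X x.1).beadSet x.2⁻¹)) z)⟩ :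
    (X x.1).beadSet x.2)

/-- The bead of the inverse is a translate of the bead. -/
def flipBead (x : Σ j, G j) : Hom (sigmaBead X (invSyl x)) (sigmaBead X x) where
  onV := flipVert X x
  onE a := (⟨(flipVert X x (SimpleGraph.Dart.toProd a).1, flipVert X x (SimpleGraph.Dart.toProd a).2),
    (X x.1).adj_smul x.2 _ _ (SimpleGraph.Dart.adj a)⟩ :
      ((X x.1).graph.induce ((X x.1).beadSet x.2)).Dart)
  src_comp _ := rfl
  inv_comp _ := rfl
  sq_comp {a b a' b'} k := by
    have inj : Function.Injective (flipVert X x) := fun z w h =>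
      Subtype.ext (MulAction.injective (β := (X x.1).V) x.2 (congrArg Subtype.val h))
    have k' : GraphSq ((X x.1).graph.induce ((X x.1).beadSet x.2⁻¹)) a b a' b' := k
    exact ⟨congrArg (flipVert X x) k'.1, congrArg (flipVert X x) k'.2.1,
      congrArg (flipVert X x) k'.2.2.1, congrArg (flipVert X x) k'.2.2.2.1,
      fun e => k'.2.2.2.2.1 (inj e), fun e => k'.2.2.2.2.2 (inj e)⟩

theorem flipBead_isoOver (x : Σ j, G j) :
    IsoOver ((X x.1).beadMap x.2⁻¹) ((X x.1).beadMap x.2) (flipBead X x) := by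
  have inj : Function.Injective (flipVert X x) := fun z w h =>
    Subtype.ext (MulAction.injective (β := (X x.1).V) x.2 (congrArg Subtype.val h))
  have surj : ∀ w : (X x.1).beadSet x.2, ∃ z : (X x.1).beadSet x.2⁻¹, flipVert X x z = w := by
    intro w
    refine ⟨⟨x.2⁻¹ • w.1, (X x.1).smul_mem_beadSet (by rw [_root_.inv_inv]; exact w.2)⟩, ?_⟩
    exact Subtype.ext (smul_inv_smul _ _)
  refine ⟨⟨inj, surj⟩, ⟨?_, ?_⟩, ?_, ?_, ?_⟩
  · intro a b hab
    have h1 := congrArg (fun d : ((X x.1).graph.induce ((X x.1).beadSet x.2)).Dart => d.toProd) hab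
    exact SimpleGraph.Dart.ext _ _ (Prod.ext (inj (congrArg Prod.fst h1))
      (inj (congrArg Prod.snd h1)))
  · intro a
    obtain ⟨z, hz⟩ := surj (SimpleGraph.Dart.toProd a).1
    obtain ⟨w, hw⟩ := surj (SimpleGraph.Dart.toProd a).2
    have hadj : (X x.1).graph.Adj z.1 w.1 := by
      have h1 := (X x.1).adj_smul x.2⁻¹ _ _ (SimpleGraph.Dart.adj a)
      rw [← hz, ← hw] at h1
      change (X x.1).graph.Adj (x.2⁻¹ • x.2 • z.1) (x.2⁻¹ • x.2 • w.1) at h1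
      rwa [inv_smul_smul, inv_smul_smul] at h1
    refine ⟨(⟨(z, w), hadj⟩ : ((X x.1).graph.induce ((X x.1).beadSet x.2⁻¹)).Dart), ?_⟩
    exact SimpleGraph.Dart.ext _ _ (Prod.ext hz hw)
  · intro a b a' b' k
    exact ⟨inj k.1, inj k.2.1, inj k.2.2.1, inj k.2.2.2.1,
      fun e => k.2.2.2.2.1 (congrArg (flipVert X x) e),
      fun e => k.2.2.2.2.2 (congrArg (flipVert X x) e)⟩
  · intro z
    exact Quotient.sound (s := MulAction.orbitRel (G x.1) (X x.1).V) ⟨x.2, rfl⟩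
  · intro a
    exact (Quotient.sound (s := (X x.1).dartSetoid)
      (a := (X x.1).beadDart x.2⁻¹ a) ⟨x.2, rfl⟩).symm

/-- The necklace of the inverse word is the flipped necklace. -/
def flipHom (h : Fin t → Σ j, G j) : Hom (neck X (flipSeq h) q) (neck X h q) where
  onV
    | .bead k z => .bead k.rev ((flipBead X (h k.rev)).onV z)
    | .string k s h0 h1 => .string (next k).rev (2 * q - s) (by omega) (by omega)
  onE
    | .bead k a => .bead k.rev ((flipBead X (h k.rev)).onE a)
    | .string k s o => .string (next k).rev ⟨2 * q - 1 - s, by omega⟩ (!o)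
  src_comp := by
    -- Position `s` becomes position `2 q - s`. At the ends this respects the gluing because the
    -- translation of a bead exchanges its initial and terminal vertices.
    have key : ∀ (k : Fin t) (s : ℕ) (_ : s ≤ 2 * q) (_ : 0 < q),
      (match (neckPos (fun k => sigmaBead X (flipSeq h k))
        (fun k => (X (flipSeq h k).1).beadIni (flipSeq h k).2)
        (fun k => (X (flipSeq h k).1).beadTer (flipSeq h k).2) q k s) with
      | .bead k z => NeckV.bead k.rev ((flipBead X (h k.rev)).onV z)
      | .string k s h0 h1 => .string (next k).rev (2 * q - s) (by omega) (by omega) :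
        NeckV (fun k => sigmaBead X (h k)) q) =
        neckPos (fun k => sigmaBead X (h k)) (fun k => (X (h k).1).beadIni (h k).2)
          (fun k => (X (h k).1).beadTer (h k).2) q (next k).rev (2 * q - s) := by
      intro k s hs hq
      rcases Nat.eq_zero_or_pos s with rfl | h0
      · simp only [neckPos, lt_irrefl, dite_false, Nat.sub_zero,
          show 0 < 2 * q by omega, dite_true]
        rw [next_rev_next]
        refine congrArg (NeckV.bead k.rev) (Subtype.ext ?_)
        exact smul_inv_smul _ _
      rcases hs.eq_or_lt with rfl | h1
      · simp only [neckPos, lt_irrefl, dite_false, Nat.sub_self, h0, dite_true]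
        rfl
      · have h2 : 0 < 2 * q - s := by omega
        have h3 : 2 * q - s < 2 * q := by omega
        simp only [neckPos, h0, h1, h2, h3, dite_true]
    rintro (⟨k, a⟩ | ⟨k, s, o⟩)
    · rfl
    · have hq : 0 < q := by have := s.2; omega
      cases o
      · refine Eq.trans ?_ (key k (s + 1) (by omega) hq).symm
        exact congrArg (neckPos (fun k => sigmaBead X (h k)) (fun k => (X (h k).1).beadIni (h k).2)
          (fun k => (X (h k).1).beadTer (h k).2) q (next k).rev) (show 2 * q - 1 - s.1 = 2 * q - (s.1 + 1) by omega)
      · refine Eq.trans ?_ (key k s (by omega) hq).symm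
        exact congrArg (neckPos (fun k => sigmaBead X (h k)) (fun k => (X (h k).1).beadIni (h k).2)
          (fun k => (X (h k).1).beadTer (h k).2) q (next k).rev) (show 2 * q - 1 - s.1 + 1 = 2 * q - s.1 by omega)
  inv_comp := by
    rintro (⟨k, a⟩ | ⟨k, s, o⟩) <;> rfl
  sq_comp := by
    rintro _ _ _ _ ⟨k, s⟩
    exact .mk k.rev ((flipBead X (h k.rev)).sq_comp s)

theorem flipHom_isoOver (h : Fin t → Σ j, G j) :
    IsoOver (neckMap X (flipSeq h) q) (neckMap X h q) (flipHom X q h) where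
  bijV := by
    constructor
    · rintro (⟨k, z⟩ | ⟨k, s, h0, h1⟩) (⟨k', z'⟩ | ⟨k', s', h0', h1'⟩) hh
      · injection hh with hk hz
        obtain rfl := Fin.rev_injective hk
        obtain rfl := (flipBead_isoOver X _).bijV.1 (eq_of_heq hz)
        rfl
      · injection hh
      · injection hh
      · injection hh with hk hs
        obtain rfl := next_injective (Fin.rev_injective hk)
        obtain rfl : s = s' := by omega
        rfl
    · rintro (⟨k, z⟩ | ⟨k, s, h0, h1⟩)
      · obtain ⟨k, rfl⟩ := Fin.rev_surjective k
        obtain ⟨z, rfl⟩ := (flipBead_isoOver X _).bijV.2 z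
        exact ⟨.bead k z, rfl⟩
      · obtain ⟨k, rfl⟩ := Fin.rev_surjective k
        obtain ⟨k, rfl⟩ := (Finite.injective_iff_surjective.1 next_injective) k
        refine ⟨.string k (2 * q - s) (by omega) (by omega), ?_⟩
        change NeckV.string _ (2 * q - (2 * q - s)) _ _ = NeckV.string _ _ _ _
        congr 1
        omega
  bijE := by
    constructor
    · rintro (⟨k, z⟩ | ⟨k, s, o⟩) (⟨k', z'⟩ | ⟨k', s', o'⟩) hh
      · injection hh with hk hz
        obtain rfl := Fin.rev_injective hk
        obtain rfl := (flipBead_isoOver X _).bijE.1 (eq_of_heq hz)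
        rfl
      · injection hh
      · injection hh
      · injection hh with hk hs ho
        obtain rfl := next_injective (Fin.rev_injective hk)
        have hs' := congrArg Fin.val hs
        simp only at hs'
        obtain rfl : s = s' := Fin.ext (by omega)
        obtain rfl : o = o' := by simpa using ho
        rfl
    · rintro (⟨k, z⟩ | ⟨k, s, o⟩)
      · obtain ⟨k, rfl⟩ := Fin.rev_surjective k
        obtain ⟨z, rfl⟩ := (flipBead_isoOver X _).bijE.2 z
        exact ⟨.bead k z, rfl⟩
      · obtain ⟨k, rfl⟩ := Fin.rev_surjective k
        obtain ⟨k, rfl⟩ := (Finite.injective_iff_surjective.1 next_injective) k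
        refine ⟨.string k ⟨2 * q - 1 - s, by omega⟩ (!o), ?_⟩
        change NeckE.string _ ⟨2 * q - 1 - (2 * q - 1 - s), _⟩ (!!o) = NeckE.string _ _ _
        rw [Bool.not_not]
        congr 1
        apply Fin.ext
        simp only
        omega
  sq := by
    intro a b a' b' hs
    obtain ⟨k, x, y, z, w, hsq, h1, h2, h3, h4⟩ := NeckSq.exists_eq q hs
    rcases a with ⟨k1, a⟩ | ⟨_, _, _⟩ <;> [skip; injection h1]
    rcases b with ⟨k2, b⟩ | ⟨_, _, _⟩ <;> [skip; injection h2]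
    rcases a' with ⟨k3, a'⟩ | ⟨_, _, _⟩ <;> [skip; injection h3]
    rcases b' with ⟨k4, b'⟩ | ⟨_, _, _⟩ <;> [skip; injection h4]
    injection h1 with e1 h1
    injection h2 with e2 h2
    injection h3 with e3 h3
    injection h4 with e4 h4
    obtain rfl := Fin.rev_injective (e1.trans e2.symm)
    obtain rfl := Fin.rev_injective (e1.trans e3.symm)
    obtain rfl := Fin.rev_injective (e1.trans e4.symm)
    subst e1
    obtain rfl := eq_of_heq h1
    obtain rfl := eq_of_heq h2
    obtain rfl := eq_of_heq h3
    obtain rfl := eq_of_heq h4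
    exact .mk k1 ((flipBead_isoOver X _).sq _ _ _ _ hsq)
  overV := by
    rintro (⟨k, z⟩ | ⟨k, s, h0, h1⟩)
    · exact congrArg (WedgeV.pt _) ((flipBead_isoOver X (h k.rev)).overV z)
    · change stringPos q (fun j => (X j).cx) (fun j => (X j).cxBase) (fun k => (h k).1)
          (next k).rev (2 * q - s) =
        stringPos q (fun j => (X j).cx) (fun j => (X j).cxBase) (fun k => (flipSeq h k).1) k s
      simp only [stringPos, next_rev_next, flipSeq, invSyl]
      rcases lt_trichotomy s q with hs | rfl | hs
      · rw [if_neg (by omega), if_pos (by omega), show 2 * q - s - q = q - s by omega]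
      · simp [wedgePos, show 2 * s - s = s by omega]
      · rw [if_pos (by omega), if_neg (by omega), show q - (2 * q - s) = s - q by omega]
  overE := by
    rintro (⟨k, z⟩ | ⟨k, s, o⟩)
    · exact congrArg (WedgeE.edge _) ((flipBead_isoOver X (h k.rev)).overE z)
    · change stringEdge q (fun j => (X j).cx) (fun k => (h k).1)
          (next k).rev ⟨2 * q - 1 - s, by omega⟩ (!o) =
        stringEdge q (fun j => (X j).cx) (fun k => (flipSeq h k).1) k s o
      simp only [stringEdge, next_rev_next, flipSeq, invSyl]
      by_cases hs : s.1 < q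
      · rw [dif_neg (by omega), dif_pos hs]
        congr 1
        apply Fin.ext
        simp only
        omega
      · rw [dif_pos (by omega), dif_neg hs, Bool.not_not]
        congr 1
        apply Fin.ext
        simp only
        omega

end Symmetry

end CubicalSC

namespace CubicalSC

/-! ### Pieces of a presentation over a free product -/

/-- The periodic sequence that starts at `k`. -/
def unroll {α : Type*} {t : ℕ} (h : Fin t → α) (k : Fin t) (i : ℕ) : α := h (next^[i] k)

theorem iterate_next_val {t : ℕ} (k : Fin t) (i : ℕ) : (next^[i] k).1 = (k.1 + i) % t := by
  induction i with
  | zero => exact (Nat.mod_eq_of_lt k.2).symm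
  | succ i ih =>
    rw [Function.iterate_succ_apply']
    simp only [next, ih]
    rw [Nat.mod_add_mod, add_assoc]

theorem iterate_next_period {t : ℕ} (k : Fin t) (i : ℕ) : next^[i + t] k = next^[i] k := by
  apply Fin.ext
  rw [iterate_next_val, iterate_next_val, ← add_assoc, Nat.add_mod_right]

section Unroll

variable {α : Type*} {t : ℕ} {h : Fin t → α}

theorem unroll_period (k : Fin t) (i : ℕ) : unroll h k (i + t) = unroll h k i :=
  congrArg h (iterate_next_period k i)

theorem unroll_mod (k : Fin t) (i : ℕ) : unroll h k (i % t) = unroll h k i := by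
  refine congrArg h (Fin.ext ?_)
  rw [iterate_next_val, iterate_next_val, Nat.add_mod_mod]

theorem unroll_add (k : Fin t) (i j : ℕ) : unroll h (next^[i] k) j = unroll h k (i + j) := by
  refine congrArg h ?_
  rw [add_comm, Function.iterate_add_apply]

end Unroll

/-! ### Words spelled by cyclic sequences, and pieces obtained from their agreement -/

section Words

open Monoid.CoprodI

variable {r : ℕ} {G : Fin r → Type u} [∀ j, Group (G j)]

/-- The product of a list of syllables. -/
def sylProd (l : List (Σ j, G j)) : Monoid.CoprodI G := (l.map fun x => of x.2).prod

theorem sylProd_cons (x : Σ j, G j) (l : List (Σ j, G j)) :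
    sylProd (x :: l) = of x.2 * sylProd l := by
  simp [sylProd]

theorem sylProd_append (l m : List (Σ j, G j)) : sylProd (l ++ m) = sylProd l * sylProd m := by
  simp [sylProd]

/-- A syllable can be cut inside its factor, `a = c (c⁻¹ a)`, with the remainder `c⁻¹ a` opening the
second word. It does not cancel with `c`, because `c⁻¹ a = c⁻¹` would force `a = 1`. So the last
syllable of a common initial part only has to lie in the right factor. -/
theorem isInitial_of_split {W P : Word G} {p u : List (Σ j, G j)} {m : Fin r} {a c : G m}
    (hW : W.toList = p ++ ⟨m, a⟩ :: u) (hP : P.toList = p ++ [⟨m, c⟩]) : IsInitial P W := by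
  have hone := W.ne_one
  have hch := W.chain_ne
  rw [hW] at hone hch
  have hch2 := (List.isChain_append.1 hch).2.1
  rw [List.isChain_cons] at hch2
  have ha : a ≠ 1 := hone ⟨m, a⟩ (by simp)
  have hprod : W.prod = P.prod * (of (c⁻¹ * a) * sylProd u) := by
    change sylProd W.toList = sylProd P.toList * _
    rw [hW, hP, sylProd_append, sylProd_append, sylProd_cons, sylProd_cons]
    simp [sylProd, mul_assoc]
  by_cases hac : a = c
  · subst hac
    refine ⟨⟨u, fun x hx => hone x (by simp [hx]), hch2.2⟩, ?_, ?_⟩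
    · intro j x hx hx'
      rw [hP] at hx
      simp only [List.getLast?_append, List.getLast?_singleton, Option.some_or,
        Option.some.injEq] at hx
      exact hch2.1 _ hx' (Sigma.mk.inj_iff.1 hx).1
    · rw [hprod]
      simp only [inv_mul_cancel, map_one, one_mul]
      rfl
  · refine ⟨⟨⟨m, c⁻¹ * a⟩ :: u, ?_, ?_⟩, ?_, ?_⟩
    · intro x hx
      rcases List.mem_cons.1 hx with rfl | hx
      · intro h
        exact hac (inv_mul_eq_one.1 h).symm
      · exact hone x (by simp [hx])
    · exact List.isChain_cons.2 hch2
    · intro j x hx hx'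
      rw [hP] at hx
      simp only [List.getLast?_append, List.getLast?_singleton, Option.some_or,
        Option.some.injEq] at hx
      simp only [List.head?_cons, Option.some.injEq] at hx'
      obtain ⟨rfl, hx⟩ := Sigma.mk.inj_iff.1 hx
      obtain rfl := eq_of_heq hx
      have := eq_of_heq (Sigma.mk.inj_iff.1 hx').2
      simp [ha] at this
    · rw [hprod]
      change _ = P.prod * sylProd (_ :: _)
      rw [sylProd_cons]

/-- A sequence of nontrivial syllables in which cyclically adjacent ones lie in different
factors. -/
structure CycSeq {t : ℕ} (h : Fin t → Σ j, G j) : Prop where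
  pos : 0 < t
  ne_one : ∀ k, (h k).2 ≠ 1
  ne_next : ∀ k, (h k).1 ≠ (h (next k)).1

section Unroll

variable {t : ℕ} {h : Fin t → Σ j, G j}

theorem CycSeq.unroll_ne_one (hh : CycSeq h) (k : Fin t) (i : ℕ) : (unroll h k i).2 ≠ 1 :=
  hh.ne_one _

theorem CycSeq.unroll_ne (hh : CycSeq h) (k : Fin t) (i : ℕ) :
    (unroll h k i).1 ≠ (unroll h k (i + 1)).1 := by
  have := hh.ne_next (next^[i] k)
  rwa [← Function.iterate_succ_apply' next i k] at this

theorem CycSeq.two_le (hh : CycSeq h) : 2 ≤ t := by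
  by_contra hcon
  have := hh.pos
  obtain rfl : t = 1 := by omega
  exact hh.ne_next 0 (by rw [Subsingleton.elim (next 0) 0])

end Unroll

/-- Advancing the starting point by one moves the first syllable to the end, which is conjugation by
that syllable. -/
theorem isConj_unroll {t : ℕ} (h : Fin t → Σ j, G j) (k : Fin t) :
    IsConj (sylProd (List.ofFn h)) (sylProd ((List.range t).map (unroll h k))) := by
  have step : ∀ k, IsConj (sylProd ((List.range t).map (unroll h k)))
      (sylProd ((List.range t).map (unroll h (next k)))) := by
    intro k
    obtain ⟨n, rfl⟩ : ∃ n, t = n + 1 := ⟨t - 1, by have := k.2; omega⟩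
    have e1 : (List.range (n + 1)).map (unroll h k) =
        unroll h k 0 :: (List.range n).map (unroll h (next k)) := by
      rw [List.range_succ_eq_map, List.map_cons, List.map_map]
      rfl
    have e2 : (List.range (n + 1)).map (unroll h (next k)) =
        (List.range n).map (unroll h (next k)) ++ [unroll h k 0] := by
      rw [List.range_succ, List.map_append, List.map_singleton]
      have : unroll h (next k) n = unroll h k 0 := by
        have h1 := unroll_period (h := h) k 0
        have h2 := unroll_add (h := h) k 1 n
        rw [show 1 + n = 0 + (n + 1) by omega, h1] at h2
        exact h2
      rw [this]
    rw [e1, e2, sylProd_cons, sylProd_append, isConj_iff]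
    refine ⟨(of (unroll h k 0).2)⁻¹, ?_⟩
    simp [sylProd]
  have all : ∀ i, ∀ k, IsConj (sylProd ((List.range t).map (unroll h k)))
      (sylProd ((List.range t).map (unroll h (next^[i] k)))) := by
    intro i
    induction i with
    | zero => exact fun k => IsConj.refl _
    | succ i ih => exact fun k => (step k).trans (ih (next k))
  have ht : 0 < t := k.pos
  have e0 : List.ofFn h = (List.range t).map (unroll h ⟨0, ht⟩) := by
    refine List.ext_getElem (by simp) fun i h1 h2 => ?_
    simp only [List.getElem_ofFn, List.getElem_map, List.getElem_range]
    refine congrArg h (Fin.ext ?_)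
    rw [iterate_next_val]
    simp only [List.length_ofFn] at h1
    simp [Nat.mod_eq_of_lt h1]
  rw [e0]
  have := all k.1 ⟨0, ht⟩
  have e : next^[k.1] (⟨0, ht⟩ : Fin t) = k := by
    apply Fin.ext
    rw [iterate_next_val]
    simp [Nat.mod_eq_of_lt k.2]
  rwa [e] at this

theorem sylProd_flipSeq {t : ℕ} (h : Fin t → Σ j, G j) :
    sylProd (List.ofFn (flipSeq h)) = (sylProd (List.ofFn h))⁻¹ := by
  have e : List.ofFn (flipSeq h) = (List.ofFn (fun k => invSyl (h k))).reverse := by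
    refine List.ext_getElem (by simp) fun i h1 h2 => ?_
    simp only [List.getElem_ofFn, List.getElem_reverse, List.length_ofFn, flipSeq]
    congr 2
    apply Fin.ext
    simp only [Fin.val_rev]
    omega
  rw [e]
  simp only [sylProd, List.prod_inv_reverse, List.map_reverse, List.map_ofFn]
  congr 3

theorem CycSeq.flip {t : ℕ} {h : Fin t → Σ j, G j} (hh : CycSeq h) : CycSeq (flipSeq h) where
  pos := hh.pos
  ne_one k := inv_ne_one.2 (hh.ne_one _)
  ne_next k e := by
    have := hh.ne_next (next k).rev
    rw [next_rev_next] at this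
    exact this e.symm

/-- The sequence `h` spells a conjugate of `R` or of its inverse. -/
def Spells (R : Word G) {t : ℕ} (h : Fin t → Σ j, G j) : Prop :=
  IsConj R.prod (sylProd (List.ofFn h)) ∨ IsConj R.prod⁻¹ (sylProd (List.ofFn h))

theorem Spells.flip {R : Word G} {t : ℕ} {h : Fin t → Σ j, G j} (hh : Spells R h) :
    Spells R (flipSeq h) := by
  unfold Spells at *
  rw [sylProd_flipSeq]
  have key : ∀ a b : Monoid.CoprodI G, IsConj a b → IsConj a⁻¹ b⁻¹ := by
    intro a b hab
    obtain ⟨c, rfl⟩ := isConj_iff.1 hab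
    exact isConj_iff.2 ⟨c, by group⟩
  rcases hh with hh | hh
  · exact Or.inr (key _ _ hh)
  · exact Or.inl (by simpa using key _ _ hh)

theorem spells_self (R : Word G) : Spells R R.toList.get := by
  left
  rw [List.ofFn_get]
  exact IsConj.refl _

theorem cycSeq_of_cyclicallyReduced {R : Word G} (hR : CyclicallyReduced R) :
    CycSeq R.toList.get := by
  obtain ⟨a, ha, z, hz, hne⟩ := hR
  have hpos : 0 < R.toList.length := by
    rcases List.eq_nil_or_concat R.toList with h | ⟨l, x, h⟩
    · rw [h] at ha
      simp at ha
    · rw [h]; simp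
  refine ⟨hpos, fun k => R.ne_one _ (List.get_mem _ _), fun k => ?_⟩
  have hk := k.2
  have hch := List.isChain_iff_getElem.1 R.chain_ne
  by_cases hlast : k.1 + 1 = R.toList.length
  · rw [List.getLast?_eq_getElem?] at hz
    rw [List.head?_eq_getElem?] at ha
    have e1 : next k = ⟨0, hpos⟩ := Fin.ext (by rw [next_val, if_pos hlast])
    have e2 : k = ⟨R.toList.length - 1, by omega⟩ := Fin.ext (by simp only; omega)
    rw [Option.mem_def, List.getElem?_eq_some_iff] at ha hz
    obtain ⟨_, rfl⟩ := ha
    obtain ⟨_, rfl⟩ := hz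
    rw [e1, e2]
    exact fun h => hne h.symm
  · have e1 : next k = ⟨k.1 + 1, by omega⟩ := Fin.ext (by rw [next_val, if_neg hlast])
    rw [e1]
    exact hch k.1 (by omega)

theorem range_split {l t : ℕ} (h1 : 1 ≤ l) (h2 : l ≤ t) :
    List.range t = List.range (l - 1) ++ (l - 1) :: List.range' l (t - l) := by
  obtain ⟨l, rfl⟩ : ∃ m, l = m + 1 := ⟨l - 1, by omega⟩
  obtain ⟨d, rfl⟩ : ∃ d, t = l + 1 + d := ⟨t - (l + 1), by omega⟩
  rw [Nat.add_sub_cancel, Nat.add_sub_cancel_left, add_assoc, List.range_add]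
  congr 1
  rw [add_comm 1 d, List.range_succ_eq_map, List.map_cons, List.map_map, List.range'_eq_map_range]
  congr 1
  refine List.map_congr_left fun i _ => ?_
  simp only [Function.comp]
  omega

variable {s : ℕ} {R : Fin s → Word G} {α : ℝ}

/-- Unrolled sequences that agree along `l` syllables, except that the first and the last ones
only have to lie in the same factors, give a piece of length `l`. -/
theorem lt_of_agree (hC : FreeProductSmallCancellation R α) {i j : Fin s} {t t' : ℕ}
    (htt : i = j → t = t') {h : Fin t → Σ j, G j} {h' : Fin t' → Σ j, G j} (hh : CycSeq h)
    (hh' : CycSeq h') (hi : Spells (R i) h) (hj : Spells (R j) h') (k : Fin t) (k' : Fin t')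
    {l : ℕ} (l1 : 1 ≤ l) (lt : l ≤ t) (lt' : l ≤ t')
    (hfst : ∀ i < l, (unroll h k i).1 = (unroll h' k' i).1)
    (heq : ∀ i, 0 < i → i + 1 < l → unroll h k i = unroll h' k' i) :
    (l : ℝ) < α * t ∨ (i = j ∧ ∀ i < t, unroll h k i = unroll h' k' i) := by
  classical
  set a := unroll h k with ha
  set b := unroll h' k' with hb
  have ha1 : ∀ i, (a i).2 ≠ 1 := hh.unroll_ne_one k
  have hb1 : ∀ i, (b i).2 ≠ 1 := hh'.unroll_ne_one k'
  have han : ∀ i, (a i).1 ≠ (a (i + 1)).1 := hh.unroll_ne k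
  have hbn : ∀ i, (b i).1 ≠ (b (i + 1)).1 := hh'.unroll_ne k'
  have t2 := hh.two_le
  have t2' := hh'.two_le
  have hat : (a (t - 1)).1 ≠ (a 0).1 := by
    have := han (t - 1)
    rw [show t - 1 + 1 = 0 + t by omega, ha, unroll_period] at this
    exact this
  have hbt : (b (t' - 1)).1 ≠ (b 0).1 := by
    have := hbn (t' - 1)
    rw [show t' - 1 + 1 = 0 + t' by omega, hb, unroll_period] at this
    exact this
  -- the first syllable of the second word
  obtain ⟨ξ, hξ1, hξ⟩ : ∃ ξ : G (b 0).1, ξ ≠ 1 ∧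
      (if l = 1 then b 0 else a 0) = (⟨(b 0).1, ξ⟩ : Σ j, G j) := by
    split_ifs with hl
    · exact ⟨(b 0).2, hb1 0, rfl⟩
    · have h0 := hfst 0 (by omega)
      have h1 := ha1 0
      revert h0 h1
      generalize a 0 = x
      obtain ⟨m, x⟩ := x
      intro h0 h1
      obtain rfl : m = (b 0).1 := h0
      exact ⟨x, h1, rfl⟩
  set β : G (b 0).1 := (b 0).2 with hβ
  -- The second word is `ξ b₁ ⋯ b_{t'-1} (β ξ⁻¹)`, a conjugate of `β b₁ ⋯ b_{t'-1}`. For `l ≥ 2` it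
  -- starts with the first syllable `ξ` of the first word. For `l = 1` the single syllable of the
  -- piece is also its last one, so nothing has to be changed and `ξ = β`.
  let b' : ℕ → Σ j, G j := fun i => if i = 0 then ⟨(b 0).1, ξ⟩ else b i
  have hb'0 : b' 0 = ⟨(b 0).1, ξ⟩ := rfl
  have hb'f : ∀ i, (b' i).1 = (b i).1 := by
    intro i
    simp only [b']
    split_ifs with h0
    · rw [h0]
    · rfl
  have hb'1 : ∀ i, (b' i).2 ≠ 1 := by
    intro i
    by_cases h0 : i = 0
    · subst h0; exact hξ1
    · have : b' i = b i := if_neg h0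
      rw [this]; exact hb1 i
  have hab' : ∀ i < l - 1, a i = b' i := by
    intro i hi
    rcases Nat.eq_zero_or_pos i with rfl | h0
    · rw [hb'0, ← hξ, if_neg (by omega)]
    · simp only [b', if_neg h0.ne']
      exact heq i h0 (by omega)
  -- A trivial remainder must be dropped for the word to be a normal form.
  let tail : List (Σ j, G j) := if ξ = β then [] else [⟨(b 0).1, β * ξ⁻¹⟩]
  have htail : ∀ x ∈ tail, x.1 = (b 0).1 ∧ x.2 ≠ 1 := by
    intro x hx
    simp only [tail] at hx
    split_ifs at hx with he
    · simp at hx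
    · obtain rfl := List.mem_singleton.1 hx
      exact ⟨rfl, fun h => he (mul_inv_eq_one.1 h).symm⟩
  have htailp : sylProd tail = of (β * ξ⁻¹) := by
    simp only [tail]
    split_ifs with he
    · rw [he]; simp [sylProd]
    · simp [sylProd]
  have chain_range : ∀ (f : ℕ → Σ j, G j) (n : ℕ), (∀ i, (f i).1 ≠ (f (i + 1)).1) →
      ((List.range n).map f).IsChain (fun x y => x.1 ≠ y.1) := by
    intro f n hf
    rw [List.isChain_iff_getElem]
    intro i hi
    simpa using hf i
  let W : Word G := ⟨(List.range t).map a, by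
    intro x hx
    obtain ⟨i, -, rfl⟩ := List.mem_map.1 hx
    exact ha1 i, chain_range a t han⟩
  have last' : ((List.range t').map b').getLast? = some (b' (t' - 1)) := by
    rw [List.getLast?_map, List.getLast?_range, if_neg (by omega)]
    rfl
  let W' : Word G := ⟨(List.range t').map b' ++ tail, by
    intro x hx
    rcases List.mem_append.1 hx with hx | hx
    · obtain ⟨i, -, rfl⟩ := List.mem_map.1 hx
      exact hb'1 i
    · exact (htail x hx).2, by
    rw [List.isChain_append]
    refine ⟨chain_range b' t' fun i => ?_, ?_, ?_⟩
    · rw [hb'f, hb'f]; exact hbn i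
    · simp only [tail]
      split_ifs <;> simp
    · intro x hx y hy
      rw [last', Option.mem_def, Option.some.injEq] at hx
      have hy' := (htail y (List.mem_of_mem_head? hy)).1
      rw [hy', ← hx, hb'f]
      exact hbt⟩
  have hWs : W.toList = (List.range (l - 1)).map a ++ a (l - 1) :: (List.range' l (t - l)).map a := by
    change (List.range t).map a = _
    rw [range_split l1 lt]
    simp
  have hWs' : W'.toList = (List.range (l - 1)).map a ++
      b' (l - 1) :: ((List.range' l (t' - l)).map b' ++ tail) := by
    change (List.range t').map b' ++ tail = _
    rw [range_split l1 lt', List.map_append, List.map_cons, List.append_assoc]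
    congr 1
    exact List.map_congr_left fun i hi => (hab' i (List.mem_range.1 hi)).symm
  let P : Word G := ⟨(List.range (l - 1)).map a ++ [a (l - 1)], by
    intro x hx
    rcases List.mem_append.1 hx with hx | hx
    · obtain ⟨i, -, rfl⟩ := List.mem_map.1 hx
      exact ha1 i
    · obtain rfl := List.mem_singleton.1 hx
      exact ha1 _, by
    have : (List.range (l - 1)).map a ++ [a (l - 1)] = (List.range (l - 1 + 1)).map a := by
      rw [List.range_succ, List.map_append, List.map_singleton]
    rw [this]
    exact chain_range a _ han⟩
  have hPW : IsInitial P W := isInitial_of_split (m := (a (l - 1)).1) (a := (a (l - 1)).2)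
    (c := (a (l - 1)).2) hWs rfl
  have hPW' : IsInitial P W' := by
    have e : (a (l - 1)).1 = (b' (l - 1)).1 := by rw [hb'f]; exact hfst _ (by omega)
    have hP : P.toList = (List.range (l - 1)).map a ++ [a (l - 1)] := rfl
    revert e hP hWs'
    generalize a (l - 1) = x
    generalize b' (l - 1) = y
    obtain ⟨m, x⟩ := x
    obtain ⟨m', y⟩ := y
    intro e1 e2 e3
    obtain rfl : m = m' := e2
    exact isInitial_of_split e1 e3
  have hWwc : WeaklyCyclicallyReduced W := by
    right
    intro m x h0 h1
    change ((List.range t).map a).head? = _ at h0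
    change ((List.range t).map a).getLast? = _ at h1
    rw [List.head?_map, List.head?_range, if_neg (by omega), Option.map_some,
      Option.some.injEq] at h0
    rw [List.getLast?_map, List.getLast?_range, if_neg (by omega), Option.map_some,
      Option.some.injEq] at h1
    rw [h0, h1] at hat
    exact hat rfl
  -- If the tail is present, the first and last syllables lie in the same factor, so only the weak
  -- form of cyclic reducedness is available: `β ξ⁻¹ = ξ⁻¹` would force `β = 1`.
  have hWwc' : WeaklyCyclicallyReduced W' := by
    right
    intro m x h0 h1
    change ((List.range t').map b' ++ tail).head? = _ at h0
    change ((List.range t').map b' ++ tail).getLast? = _ at h1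
    rw [List.head?_append, List.head?_map, List.head?_range, if_neg (by omega), Option.map_some,
      Option.some_or, Option.some.injEq, hb'0] at h0
    obtain ⟨rfl, h0⟩ := Sigma.mk.inj_iff.1 h0
    obtain rfl := eq_of_heq h0
    rw [List.getLast?_append, last'] at h1
    simp only [tail] at h1
    split_ifs at h1 with he
    · simp only [List.getLast?_nil, Option.none_or, Option.some.injEq] at h1
      rw [← hb'f (t' - 1), h1] at hbt
      exact hbt rfl
    · simp only [List.getLast?_singleton, Option.some_or, Option.some.injEq] at h1
      have := eq_of_heq (Sigma.mk.inj_iff.1 h1).2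
      exact hb1 0 (by simpa using this)
  have hWi : IsRelatorForm (R i) W := by
    refine ⟨hWwc, ?_⟩
    have := isConj_unroll h k
    exact hi.imp (fun hi => hi.trans this) (fun hi => hi.trans this)
  have hWj : IsRelatorForm (R j) W' := by
    refine ⟨hWwc', ?_⟩
    have h1 := isConj_unroll h' k'
    have h2 : IsConj (sylProd ((List.range t').map b)) W'.prod := by
      change IsConj _ (sylProd ((List.range t').map b' ++ tail))
      obtain ⟨n, rfl⟩ : ∃ n, t' = n + 1 := ⟨t' - 1, by omega⟩
      rw [List.range_succ_eq_map, List.map_cons, List.map_map, List.map_cons, List.map_map,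
        sylProd_append, sylProd_cons, sylProd_cons, htailp, hb'0]
      have e : b' ∘ Nat.succ = b ∘ Nat.succ := by
        funext i
        simp [b']
      rw [e, isConj_iff]
      refine ⟨of (ξ * β⁻¹), ?_⟩
      simp only [map_mul, map_inv, ← hβ]
      group
    exact hj.imp (fun hj => (hj.trans h1).trans h2) (fun hj => (hj.trans h1).trans h2)
  by_cases hne : i ≠ j ∨ W ≠ W'
  · left
    have := hC i j W W' P hWi hWj hne hPW hPW'
    have e1 : syllableLength P = l := by
      change ((List.range (l - 1)).map a ++ [a (l - 1)]).length = l
      simp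
      omega
    have e2 : syllableLength W = t := by
      change ((List.range t).map a).length = t
      simp
    rwa [e1, e2] at this
  · right
    push Not at hne
    obtain ⟨hij, hWW⟩ := hne
    refine ⟨hij, ?_⟩
    -- In the excluded case both words have the same length, so the tail is empty and `ξ = β`. The
    -- second word is then the original one, and its equality with the first is agreement along a
    -- full period.
    have htt' := htt hij
    have e1 : (List.range t).map a = (List.range t').map b' ++ tail := congrArg Word.toList hWW
    have e2 : tail = [] := by
      have := congrArg List.length e1
      simp only [List.length_map, List.length_range, List.length_append] at this
      exact List.length_eq_zero_iff.1 (by omega)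
    have e3 : ξ = β := by
      by_contra hcon
      simp [tail, hcon] at e2
    rw [e2, List.append_nil, ← htt'] at e1
    intro i hi
    have e4 := List.map_inj_left.1 e1 i (List.mem_range.2 hi)
    rw [e4]
    simp only [b']
    split_ifs with h0
    · rw [h0, e3]
    · rfl

end Words

end CubicalSC

namespace CubicalSC

open CubeCx

/-! ### Overlaps of necklaces -/

/-- Two pairs of vertices that are joined by an edge of the fibre product over `Z`. -/
def PairAdj {C D Z : CubeCx.{v}} (M : Hom C Z) (N : Hom D Z) (x y : C.V × D.V) : Prop :=
  ∃ (a : C.E) (b : D.E), M.onE a = N.onE b ∧ C.src a = x.1 ∧ C.tgt a = y.1 ∧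
    D.src b = x.2 ∧ D.tgt b = y.2

section Overlap

variable {r : ℕ} {G : Fin r → Type u} [∀ j, Group (G j)] (X : ∀ j, NPCComplex.{u, v} (G j))

/-- The position of a vertex of a bead relative to the initial vertex. -/
def iniCoord (x : Σ j, G j) (z : (sigmaBead X x).V) : Σ j, (X j).V :=
  ⟨x.1, Subtype.val (p := (· ∈ (X x.1).beadSet x.2)) z⟩

/-- The position of a vertex of a bead relative to the terminal vertex. -/
def terCoord (x : Σ j, G j) (z : (sigmaBead X x).V) : Σ j, (X j).V :=
  ⟨x.1, x.2⁻¹ • Subtype.val (p := (· ∈ (X x.1).beadSet x.2)) z⟩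

/-- The initial vertex of a bead. -/
def iniVert (x : Σ j, G j) : (sigmaBead X x).V := (X x.1).beadIni x.2

/-- The terminal vertex of a bead. -/
def terVert (x : Σ j, G j) : (sigmaBead X x).V := (X x.1).beadTer x.2

variable {X}

theorem iniCoord_ini {x y : Σ j, G j} (h : x.1 = y.1) :
    iniCoord X x (iniVert X x) = iniCoord X y (iniVert X y) := by
  obtain ⟨m, x⟩ := x
  obtain ⟨m', y⟩ := y
  obtain rfl : m = m' := h
  rfl

theorem terCoord_ter {x y : Σ j, G j} (h : x.1 = y.1) :
    terCoord X x (terVert X x) = terCoord X y (terVert X y) := by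
  obtain ⟨m, x⟩ := x
  obtain ⟨m', y⟩ := y
  obtain rfl : m = m' := h
  refine congrArg (Sigma.mk m) ?_
  exact (inv_smul_smul x (X m).base).trans (inv_smul_smul y (X m).base).symm

/-- By freeness the position of one end of a bead relative to the other determines the syllable.
Thus an overlap that matches both pairs of ends of two beads forces equal syllables. -/
theorem eq_of_iniCoord_ter {x y : Σ j, G j}
    (h : iniCoord X x (terVert X x) = iniCoord X y (terVert X y)) : x = y := by
  obtain ⟨m, x⟩ := x
  obtain ⟨m', y⟩ := y
  obtain ⟨rfl, h⟩ := Sigma.mk.inj_iff.1 h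
  exact congrArg (Sigma.mk m) ((X m).smul_inj (eq_of_heq h))

theorem eq_of_terCoord_ini {x y : Σ j, G j}
    (h : terCoord X x (iniVert X x) = terCoord X y (iniVert X y)) : x = y := by
  obtain ⟨m, x⟩ := x
  obtain ⟨m', y⟩ := y
  obtain ⟨rfl, h⟩ := Sigma.mk.inj_iff.1 h
  exact congrArg (Sigma.mk m) (inv_injective ((X m).smul_inj (eq_of_heq h)))

/-- Excludes overlaps that match the terminal vertex of one bead with the initial vertex of the
other, since syllables are nontrivial. -/
theorem eq_one_of_iniCoord {x y : Σ j, G j}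
    (h : iniCoord X x (terVert X x) = iniCoord X y (iniVert X y)) : x.2 = 1 := by
  obtain ⟨m, x⟩ := x
  obtain ⟨m', y⟩ := y
  obtain ⟨rfl, h⟩ := Sigma.mk.inj_iff.1 h
  exact (X m).smul_eq_self (eq_of_heq h)

theorem eq_one_of_terCoord {x y : Σ j, G j}
    (h : terCoord X x (terVert X x) = terCoord X y (iniVert X y)) : y.2 = 1 := by
  obtain ⟨m, x⟩ := x
  obtain ⟨m', y⟩ := y
  obtain ⟨rfl, h⟩ := Sigma.mk.inj_iff.1 h
  have h' : x⁻¹ • x • (X m).base = y⁻¹ • (X m).base := eq_of_heq h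
  rw [inv_smul_smul] at h'
  exact inv_eq_one.1 ((X m).smul_eq_self h'.symm)

theorem fst_eq_of_iniCoord {x y : Σ j, G j} {z : (sigmaBead X x).V} {w : (sigmaBead X y).V}
    (h : iniCoord X x z = iniCoord X y w) : x.1 = y.1 := (Sigma.mk.inj_iff.1 h).1

theorem fst_eq_of_terCoord {x y : Σ j, G j} {z : (sigmaBead X x).V} {w : (sigmaBead X y).V}
    (h : terCoord X x z = terCoord X y w) : x.1 = y.1 := (Sigma.mk.inj_iff.1 h).1

/-- Edges with the same image differ by a translation. If the relative positions of their sources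
agree, freeness determines the translation, and it then matches the targets as well. -/
theorem coord_tgt {q : ℕ} {x y : Σ j, G j} {a : (sigmaBead X x).E} {b : (sigmaBead X y).E}
    (h : (WedgeE.edge x.1 (((X x.1).beadMap x.2).onE a) : WedgeE (fun j => (X j).cx) q) =
      .edge y.1 (((X y.1).beadMap y.2).onE b)) :
    (iniCoord X x ((sigmaBead X x).src a) = iniCoord X y ((sigmaBead X y).src b) →
      iniCoord X x ((sigmaBead X x).tgt a) = iniCoord X y ((sigmaBead X y).tgt b)) ∧
    (terCoord X x ((sigmaBead X x).src a) = terCoord X y ((sigmaBead X y).src b) →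
      terCoord X x ((sigmaBead X x).tgt a) = terCoord X y ((sigmaBead X y).tgt b)) := by
  obtain ⟨m, x⟩ := x
  obtain ⟨m', y⟩ := y
  injection h with h1 h2
  obtain rfl : m = m' := h1
  obtain ⟨g, hg⟩ := Quotient.exact (s := (X m).dartSetoid) (eq_of_heq h2)
  have g1 := congrArg (fun d : (X m).graph.Dart => d.fst) hg
  have g2 := congrArg (fun d : (X m).graph.Dart => d.snd) hg
  set p := ((X m).beadDart x a).fst
  set p' := ((X m).beadDart x a).snd
  set w := ((X m).beadDart y b).fst
  set w' := ((X m).beadDart y b).snd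
  have g1' : g • p = w := g1
  have g2' : g • p' = w' := g2
  constructor
  · intro h
    have h' : p = w := eq_of_heq (Sigma.mk.inj_iff.1 h).2
    have : g = 1 := (X m).smul_eq_self (g1'.trans h'.symm)
    rw [this, one_smul] at g2'
    exact congrArg (Sigma.mk m) g2'
  · intro h
    have h' : x⁻¹ • p = y⁻¹ • w := eq_of_heq (Sigma.mk.inj_iff.1 h).2
    have : x⁻¹ = y⁻¹ * g := (X m).smul_inj (x := p) (by rw [mul_smul, g1', h'])
    refine congrArg (Sigma.mk m) ?_
    change x⁻¹ • p' = y⁻¹ • w'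
    rw [this, mul_smul, g2']

variable (X)

/-- The `s`-th vertex of a string of the necklace. -/
def neckAt {t : ℕ} (h : Fin t → Σ j, G j) (q : ℕ) (k : Fin t) (s : ℕ) : (neck X h q).V :=
  neckPos (fun k => sigmaBead X (h k)) (fun k => iniVert X (h k)) (fun k => terVert X (h k)) q k s

/-- A vertex of a bead, as a vertex of the necklace. -/
def beadAt {t : ℕ} (h : Fin t → Σ j, G j) (q : ℕ) (k : Fin t) (z : (sigmaBead X (h k)).V) :
    (neck X h q).V := NeckV.bead k z

variable {X}

section At

variable {t q : ℕ} {h : Fin t → Σ j, G j} {k : Fin t} {s : ℕ}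

theorem neckAt_zero : neckAt X h q k 0 = beadAt X h q k (terVert X (h k)) := by
  simp [neckAt, neckPos, beadAt]
  rfl

theorem neckAt_last (hq : 0 < q) :
    neckAt X h q k (2 * q) = beadAt X h q (next k) (iniVert X (h (next k))) := by
  simp [neckAt, neckPos, beadAt, hq]
  rfl

theorem neckAt_mid (h0 : 0 < s) (h1 : s < 2 * q) : neckAt X h q k s = NeckV.string k s h0 h1 := by
  simp [neckAt, neckPos, h0, h1]
  rfl

theorem beadAt_inj {k' : Fin t} {f : ∀ k, (sigmaBead X (h k)).V} {z : (sigmaBead X (h k')).V}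
    (e : beadAt X h q k (f k) = beadAt X h q k' z) : k = k' ∧ z = f k' := by
  injection e with e1 e2
  subst e1
  exact ⟨rfl, (eq_of_heq e2).symm⟩

/-- The vertices of a string that lie on a bead. -/
theorem neckAt_eq_beadAt (hq : 0 < q) (hs : s ≤ 2 * q) {k' : Fin t} {z : (sigmaBead X (h k')).V}
    (e : neckAt X h q k s = beadAt X h q k' z) :
    (s = 0 ∧ k = k' ∧ z = terVert X (h k')) ∨
      (s = 2 * q ∧ next k = k' ∧ z = iniVert X (h k')) := by
  rcases Nat.eq_zero_or_pos s with rfl | h0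
  · rw [neckAt_zero] at e
    exact Or.inl ⟨rfl, beadAt_inj (f := fun k => terVert X (h k)) e⟩
  rcases hs.eq_or_lt with rfl | h1
  · rw [neckAt_last hq] at e
    exact Or.inr ⟨rfl, beadAt_inj (f := fun k => iniVert X (h k)) e⟩
  · rw [neckAt_mid h0 h1] at e
    injection e

theorem neckAt_eq_string (hq : 0 < q) (hs : s ≤ 2 * q) {k' : Fin t} {s' : ℕ} {h0 : 0 < s'}
    {h1 : s' < 2 * q}
    (e : neckAt X h q k s = NeckV.string k' s' h0 h1) : k = k' ∧ s = s' := by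
  rcases Nat.eq_zero_or_pos s with rfl | g0
  · rw [neckAt_zero] at e
    injection e
  rcases hs.eq_or_lt with rfl | g1
  · rw [neckAt_last hq] at e
    injection e
  · rw [neckAt_mid g0 g1] at e
    injection e with e1 e2
    exact ⟨e1, e2⟩

end At

/-! ### The overlap between two consecutive disagreements -/

section Run

variable (X) {t t' : ℕ} (h : Fin t → Σ j, G j) (h' : Fin t' → Σ j, G j) (q : ℕ) (k : Fin t)
  (k' : Fin t') (L R : ℕ)

/-- The part of an overlap at the `i`-th bead: the common part of the two beads, and the adjacent
halves of strings. The overlap extends from the `L`-th to the `R`-th bead. -/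
def runPart (i : ℕ) : Set ((neck X h q).V × (neck X h' q).V) :=
  {x | (∃ (z : (sigmaBead X (unroll h k i)).V) (z' : (sigmaBead X (unroll h' k' i)).V),
      (L < i → iniCoord X (unroll h k i) z = iniCoord X (unroll h' k' i) z') ∧
      (i < R → terCoord X (unroll h k i) z = terCoord X (unroll h' k' i) z') ∧
      x = (beadAt X h q (next^[i] k) z, beadAt X h' q (next^[i] k') z'))} ∪
  {x | i < R ∧ ∃ (s : ℕ) (h0 : 0 < s) (h1 : s < 2 * q), s ≤ q ∧
      x = (NeckV.string (next^[i] k) s h0 h1, NeckV.string (next^[i] k') s h0 h1)} ∪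
  {x | ∃ i', i' + 1 = i ∧ L < i ∧ ∃ (s : ℕ) (h0 : 0 < s) (h1 : s < 2 * q), q ≤ s ∧
      x = (NeckV.string (next^[i'] k) s h0 h1, NeckV.string (next^[i'] k') s h0 h1)}

/-- The overlap that extends from the `L`-th to the `R`-th bead. -/
def runSet : Set ((neck X h q).V × (neck X h' q).V) :=
  ⋃ i ∈ {i | L ≤ i ∧ i ≤ R ∧ (unroll h k i).1 = (unroll h' k' i).1}, runPart X h h' q k k' L R i

variable {X h h' q k k' L R}

/-- As `L < R`, at least one of the two coordinate conditions is in force at every bead, and it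
contains the equality of factors. -/
theorem mem_runSet_of_bead (hLR : L < R) {i : ℕ} (hi : L ≤ i) (hi' : i ≤ R)
    {z : (sigmaBead X (unroll h k i)).V} {z' : (sigmaBead X (unroll h' k' i)).V}
    (h1 : L < i → iniCoord X (unroll h k i) z = iniCoord X (unroll h' k' i) z')
    (h2 : i < R → terCoord X (unroll h k i) z = terCoord X (unroll h' k' i) z') :
    ((beadAt X h q (next^[i] k) z, beadAt X h' q (next^[i] k') z') :
      (neck X h q).V × (neck X h' q).V) ∈ runSet X h h' q k k' L R := by
  refine Set.mem_biUnion (x := i) ⟨hi, hi', ?_⟩ (Or.inl (Or.inl ⟨z, z', h1, h2, rfl⟩))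
  rcases hi.eq_or_lt with rfl | hlt
  · exact fst_eq_of_terCoord (h2 hLR)
  · exact fst_eq_of_iniCoord (h1 hlt)

/-- Interior positions belong to the half string adjacent to the bead of the common factor. An end
of the string is an end of a bead: the coordinates agree trivially relative to this end, and
relative to the other end, if required, because the syllables agree strictly between `L` and `R`. -/
theorem mem_runSet_of_string (hq : 0 < q) (hLR : L < R)
    (hrun : ∀ i, L < i → i < R → unroll h k i = unroll h' k' i) {i : ℕ} (hi : L ≤ i) (hi' : i < R)
    {s : ℕ} (hs : s ≤ 2 * q)
    (hm : (s ≤ q ∧ (unroll h k i).1 = (unroll h' k' i).1) ∨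
      (q ≤ s ∧ (unroll h k (i + 1)).1 = (unroll h' k' (i + 1)).1)) :
    ((neckAt X h q (next^[i] k) s, neckAt X h' q (next^[i] k') s) :
      (neck X h q).V × (neck X h' q).V) ∈ runSet X h h' q k k' L R := by
  rcases Nat.eq_zero_or_pos s with rfl | h0
  · rw [neckAt_zero, neckAt_zero]
    have hfst : (unroll h k i).1 = (unroll h' k' i).1 := by
      rcases hm with hm | hm
      · exact hm.2
      · omega
    refine mem_runSet_of_bead hLR hi hi'.le (fun hlt => ?_) (fun _ => terCoord_ter hfst)
    have e := hrun i hlt hi'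
    change iniCoord X (unroll h k i) (terVert X (unroll h k i)) =
      iniCoord X (unroll h' k' i) (terVert X (unroll h' k' i))
    rw [e]
  rcases hs.eq_or_lt with rfl | h1
  · rw [neckAt_last hq, neckAt_last hq]
    have hfst : (unroll h k (i + 1)).1 = (unroll h' k' (i + 1)).1 := by
      rcases hm with hm | hm
      · omega
      · exact hm.2
    have key := mem_runSet_of_bead (X := X) (q := q) (k := k) (k' := k') hLR (i := i + 1) (by omega)
      (by omega) (z := iniVert X (unroll h k (i + 1))) (z' := iniVert X (unroll h' k' (i + 1)))
      (fun _ => iniCoord_ini hfst) (fun hlt => by rw [hrun (i + 1) (by omega) hlt])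
    rw [← Function.iterate_succ_apply' next i k, ← Function.iterate_succ_apply' next i k']
    exact key
  · rw [neckAt_mid h0 h1, neckAt_mid h0 h1]
    rcases hm with hm | hm
    · exact Set.mem_biUnion (x := i) ⟨hi, hi'.le, hm.2⟩
        (Or.inl (Or.inr ⟨hi', s, h0, h1, hm.1, rfl⟩))
    · exact Set.mem_biUnion (x := i + 1) ⟨by omega, by omega, hm.2⟩
        (Or.inr ⟨i, rfl, by omega, s, h0, h1, hm.1, rfl⟩)

/-- The overlap cannot leave through the far ends of the beads `L` and `R`: reaching both initial
vertices at `L`, or both terminal ones at `R`, would make the syllables equal. Matching opposite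
ends of two beads would make a syllable trivial. What remains are equal positions on strings with
the same index. -/
theorem of_neckAt_mem_runSet (hh : CycSeq h) (hh' : CycSeq h') (hq : 0 < q) (hLR : L < R)
    (hL : unroll h k L ≠ unroll h' k' L) (hR : unroll h k R ≠ unroll h' k' R)
    {k₁ : Fin t} {k₁' : Fin t'} {p p' : ℕ} (hp : p ≤ 2 * q) (hp' : p' ≤ 2 * q)
    (hmem : ((neckAt X h q k₁ p, neckAt X h' q k₁' p') :
      (neck X h q).V × (neck X h' q).V) ∈ runSet X h h' q k k' L R) :
    ∃ i, L ≤ i ∧ i < R ∧ k₁ = next^[i] k ∧ k₁' = next^[i] k' ∧ p = p' ∧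
      ((p ≤ q ∧ (unroll h k i).1 = (unroll h' k' i).1) ∨
        (q ≤ p ∧ (unroll h k (i + 1)).1 = (unroll h' k' (i + 1)).1)) := by
  obtain ⟨i, ⟨hi, hi', hfst⟩, hmem⟩ := Set.mem_iUnion₂.1 hmem
  rcases hmem with (⟨z, z', c1, c2, e⟩ | ⟨hiR, s, h0, h1, hs, e⟩) | ⟨i, rfl, hiL, s, h0, h1, hs, e⟩
  · obtain ⟨e1, e2⟩ := Prod.mk.inj e
    rcases neckAt_eq_beadAt hq hp e1 with ⟨rfl, rfl, rfl⟩ | ⟨rfl, f1, rfl⟩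
    · rcases neckAt_eq_beadAt hq hp' e2 with ⟨rfl, rfl, rfl⟩ | ⟨rfl, f2, rfl⟩
      · refine ⟨i, hi, ?_, rfl, rfl, rfl, Or.inl ⟨by omega, hfst⟩⟩
        refine lt_of_le_of_ne hi' ?_
        rintro rfl
        exact hR (eq_of_iniCoord_ter (c1 hLR))
      · exfalso
        rcases hi.eq_or_lt with rfl | hlt
        · exact hh'.unroll_ne_one _ _ (eq_one_of_terCoord (c2 hLR))
        · exact hh.unroll_ne_one _ _ (eq_one_of_iniCoord (c1 hlt))
    · rcases neckAt_eq_beadAt hq hp' e2 with ⟨rfl, rfl, rfl⟩ | ⟨rfl, f2, rfl⟩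
      · exfalso
        rcases hi.eq_or_lt with rfl | hlt
        · exact hh.unroll_ne_one _ _ (eq_one_of_terCoord (c2 hLR).symm)
        · exact hh'.unroll_ne_one _ _ (eq_one_of_iniCoord (c1 hlt).symm)
      · have hlt : L < i := by
          refine lt_of_le_of_ne hi ?_
          rintro rfl
          exact hL (eq_of_terCoord_ini (c2 hLR))
        obtain ⟨i, rfl⟩ : ∃ m, i = m + 1 := ⟨i - 1, by omega⟩
        rw [Function.iterate_succ_apply'] at f1 f2
        exact ⟨i, by omega, by omega, next_injective f1, next_injective f2, rfl,
          Or.inr ⟨by omega, hfst⟩⟩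
  · obtain ⟨e1, e2⟩ := Prod.mk.inj e
    obtain ⟨rfl, rfl⟩ := neckAt_eq_string hq hp e1
    obtain ⟨rfl, rfl⟩ := neckAt_eq_string hq hp' e2
    exact ⟨i, hi, hiR, rfl, rfl, rfl, Or.inl ⟨hs, hfst⟩⟩
  · obtain ⟨e1, e2⟩ := Prod.mk.inj e
    obtain ⟨rfl, rfl⟩ := neckAt_eq_string hq hp e1
    obtain ⟨rfl, rfl⟩ := neckAt_eq_string hq hp' e2
    exact ⟨i, by omega, by omega, rfl, rfl, rfl, Or.inr ⟨hs, hfst⟩⟩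

/-- The endpoints of an edge of a string. -/
theorem src_string (k : Fin t) (s : Fin (2 * q)) (o : Bool) :
    (neck X h q).src (NeckE.string k s o) = neckAt X h q k (if o then s else s + 1) := by
  cases o <;> rfl

theorem tgt_string (k : Fin t) (s : Fin (2 * q)) (o : Bool) :
    (neck X h q).tgt (NeckE.string k s o) = neckAt X h q k (if o then s + 1 else s) := by
  cases o <;> rfl

theorem neckMap_string (k : Fin t) (s : Fin (2 * q)) (o : Bool) :
    (neckMap X h q).onE (NeckE.string k s o) =
      stringEdge q (fun j => (X j).cx) (fun k => (h k).1) k s o := rfl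

/-- The first half of a string runs towards the center and the second half away from it. Edges with
the same image lie in halves of the same kind and are traversed alike, or in halves of different
kinds and are traversed oppositely. -/
theorem stringEdge_eq_cases {k : Fin t} {s : Fin (2 * q)} {o : Bool} {k' : Fin t'}
    {s' : Fin (2 * q)} {o' : Bool}
    (e : stringEdge q (fun j => (X j).cx) (fun k => (h k).1) k s o =
      stringEdge q (fun j => (X j).cx) (fun k => (h' k).1) k' s' o') :
    (s.1 < q ∧ s'.1 < q ∧ (h k).1 = (h' k').1 ∧ s = s' ∧ o = o') ∨
    (q ≤ s.1 ∧ q ≤ s'.1 ∧ (h (next k)).1 = (h' (next k')).1 ∧ s = s' ∧ o = o') ∨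
    (s.1 < q ∧ q ≤ s'.1 ∧ (h k).1 = (h' (next k')).1 ∧ s.1 + s'.1 + 1 = 2 * q ∧ o = !o') ∨
    (q ≤ s.1 ∧ s'.1 < q ∧ (h (next k)).1 = (h' k').1 ∧ s.1 + s'.1 + 1 = 2 * q ∧ o = !o') := by
  unfold stringEdge at e
  split_ifs at e with h1 h2 h2 <;> injection e with e1 e2 e3 <;>
    have e2' := congrArg Fin.val e2 <;> simp only at e2'
  · exact Or.inl ⟨h1, h2, e1, Fin.ext (by omega), by simpa using e3⟩
  · exact Or.inr (Or.inr (Or.inl ⟨h1, by omega, e1, by omega, by rw [← e3, Bool.not_not]⟩))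
  · exact Or.inr (Or.inr (Or.inr ⟨by omega, h2, e1, by omega, e3⟩))
  · exact Or.inr (Or.inl ⟨by omega, by omega, e1, Fin.ext (by omega), e3⟩)

/-- Along beads the relative coordinates propagate by `coord_tgt`. Along strings, a step within
matching halves stays in the range. A step along halves of different kinds is impossible: combined
with the factor already matched, it would give two cyclically adjacent syllables the same factor. -/
theorem runSet_closed (hh : CycSeq h) (hh' : CycSeq h') (hq : 0 < q) (hLR : L < R)
    (hL : unroll h k L ≠ unroll h' k' L) (hR : unroll h k R ≠ unroll h' k' R)
    (hrun : ∀ i, L < i → i < R → unroll h k i = unroll h' k' i)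
    {x y : (neck X h q).V × (neck X h' q).V} (hx : x ∈ runSet X h h' q k k' L R)
    (hxy : PairAdj (neckMap X h q) (neckMap X h' q) x y) : y ∈ runSet X h h' q k k' L R := by
  obtain ⟨x1, x2⟩ := x
  obtain ⟨y1, y2⟩ := y
  obtain ⟨a, b, hab, rfl, rfl, rfl, rfl⟩ := hxy
  rcases a with ⟨k₁, a⟩ | ⟨k₁, s, o⟩
  · rcases b with ⟨k₁', b⟩ | ⟨k₁', s', o'⟩
    · obtain ⟨i, ⟨hi, hi', hfst⟩, hmem⟩ := Set.mem_iUnion₂.1 hx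
      rcases hmem with (⟨z, z', c1, c2, e⟩ | ⟨hiR, s, h0, h1, hs, e⟩) |
        ⟨i, rfl, hiL, s, h0, h1, hs, e⟩
      · obtain ⟨e1, e2⟩ := Prod.mk.inj e
        injection e1 with e1 e1'
        injection e2 with e2 e2'
        subst e1 e2
        obtain rfl := eq_of_heq e1'
        obtain rfl := eq_of_heq e2'
        have key := coord_tgt (X := X) (q := q) hab
        exact mem_runSet_of_bead hLR hi hi' (fun hlt => key.1 (c1 hlt)) (fun hlt => key.2 (c2 hlt))
      · obtain ⟨e1, e2⟩ := Prod.mk.inj e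
        injection e1
      · obtain ⟨e1, e2⟩ := Prod.mk.inj e
        injection e1
    · exfalso
      rw [neckMap_string] at hab
      unfold stringEdge at hab
      split_ifs at hab <;> injection hab
  · rcases b with ⟨k₁', b⟩ | ⟨k₁', s', o'⟩
    · exfalso
      rw [neckMap_string] at hab
      unfold stringEdge at hab
      split_ifs at hab <;> injection hab
    · rw [neckMap_string, neckMap_string] at hab
      rw [src_string, src_string] at hx
      rw [tgt_string, tgt_string]
      have hs := s.2
      have hs' := s'.2
      obtain ⟨i, hi, hi', rfl, rfl, hp, hm⟩ := of_neckAt_mem_runSet hh hh' hq hLR hL hR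
        (by split_ifs <;> omega) (by split_ifs <;> omega) hx
      have n1 := hh.unroll_ne k i
      have n2 := hh'.unroll_ne k' i
      have f1 : h (next (next^[i] k)) = unroll h k (i + 1) := by
        rw [← Function.iterate_succ_apply' next i k]; rfl
      have f2 : h' (next (next^[i] k')) = unroll h' k' (i + 1) := by
        rw [← Function.iterate_succ_apply' next i k']; rfl
      rcases stringEdge_eq_cases hab with ⟨g1, g2, g3, rfl, rfl⟩ | ⟨g1, g2, g3, rfl, rfl⟩ |
        ⟨g1, g2, g3, g4, rfl⟩ | ⟨g1, g2, g3, g4, rfl⟩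
      · exact mem_runSet_of_string hq hLR hrun hi hi' (by split_ifs <;> omega)
          (Or.inl ⟨by split_ifs <;> omega, g3⟩)
      · rw [f1, f2] at g3
        exact mem_runSet_of_string hq hLR hrun hi hi' (by split_ifs <;> omega)
          (Or.inr ⟨by split_ifs <;> omega, g3⟩)
      · exfalso
        rw [f2] at g3
        have g3' : (unroll h k i).1 = (unroll h' k' (i + 1)).1 := g3
        rcases hm with ⟨-, hm⟩ | ⟨-, hm⟩
        · exact n2 (hm.symm.trans g3')
        · exact n1 (g3'.trans hm.symm)
      · exfalso
        rw [f1] at g3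
        have g3' : (unroll h k (i + 1)).1 = (unroll h' k' i).1 := g3
        rcases hm with ⟨-, hm⟩ | ⟨-, hm⟩
        · exact n1 (hm.trans g3'.symm)
        · exact n2 (g3'.symm.trans hm)

end Run

end Overlap

end CubicalSC

namespace CubicalSC

open CubeCx

/-! ### The size of overlaps -/

/-- The part of the fibre product that can be reached from `x` has at most `N` vertices. -/
def Confined {C D Z : CubeCx.{v}} (M : Hom C Z) (N : Hom D Z) (x : C.V × D.V) (n : ℕ) : Prop :=
  ∃ S : Set (C.V × D.V), x ∈ S ∧ (∀ y ∈ S, ∀ z, PairAdj M N y z → z ∈ S) ∧ S.encard ≤ n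

theorem Confined.map {C D D' Z : CubeCx.{v}} {M : Hom C Z} {N : Hom D Z} {N' : Hom D' Z}
    {f : Hom D D'} (hf : IsoOver N N' f) {x : C.V} {y : D.V} {n : ℕ}
    (h : Confined M N (x, y) n) : Confined M N' (x, f.onV y) n := by
  obtain ⟨S, h1, h2, h3⟩ := h
  refine ⟨(fun p => (p.1, f.onV p.2)) '' S, ⟨_, h1, rfl⟩, ?_, (Set.encard_image_le _ _).trans h3⟩
  rintro _ ⟨⟨p, p'⟩, hp, rfl⟩ ⟨z, z'⟩ ⟨a, b, hab, e1, e2, e3, e4⟩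
  obtain ⟨b, rfl⟩ := hf.bijE.2 b
  obtain ⟨z', rfl⟩ := hf.bijV.2 z'
  refine ⟨(z, z'), h2 _ hp _ ⟨a, b, by rw [hab, hf.overE], e1, e2, ?_, ?_⟩, rfl⟩
  · rw [f.src_comp] at e3
    exact hf.bijV.1 e3
  · rw [f.tgt_comp] at e4
    exact hf.bijV.1 e4

section

variable {r : ℕ} {G : Fin r → Type u} [∀ j, Group (G j)] {X : ∀ j, NPCComplex.{u, v} (G j)}
  {t t' : ℕ} {h : Fin t → Σ j, G j} {h' : Fin t' → Σ j, G j} {q : ℕ} {k : Fin t} {k' : Fin t'}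

/-- Paired string vertices have equal positions, so each half string contributes at most `q` pairs;
only the beads are counted by a product. This linear dependence on `q` is essential for the
comparison with the systole. -/
theorem encard_runPart_le {L R C : ℕ} (hC : ∀ k, ENat.card (sigmaBead X (h k)).V ≤ C)
    (hC' : ∀ k, ENat.card (sigmaBead X (h' k)).V ≤ C) (i : ℕ) :
    (runPart X h h' q k k' L R i).encard ≤ (C * C + 2 * q : ℕ) := by
  have key : ∀ (I : Finset ℕ) (k₁ : Fin t) (k₁' : Fin t') (A : Set _),
      (∀ x ∈ A, ∃ (s : ℕ) (h0 : 0 < s) (h1 : s < 2 * q), s ∈ I ∧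
        x = ((NeckV.string k₁ s h0 h1, NeckV.string k₁' s h0 h1) :
          (neck X h q).V × (neck X h' q).V)) → A.encard ≤ I.card := by
    intro I k₁ k₁' A hA
    rw [← Set.encard_coe_eq_coe_finsetCard]
    refine (Set.encard_le_encard (t := (fun s => ((neckAt X h q k₁ s, neckAt X h' q k₁' s) :
      (neck X h q).V × (neck X h' q).V)) '' I) ?_).trans (Set.encard_image_le _ _)
    intro x hx
    obtain ⟨s, h0, h1, hs, rfl⟩ := hA x hx
    exact ⟨s, hs, by simp only [neckAt_mid h0 h1]⟩
  unfold runPart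
  refine (Set.encard_union_le _ _).trans ?_
  have hsplit : ((C * C + 2 * q : ℕ) : ℕ∞) = ((C : ℕ∞) * C + q) + q := by push_cast; ring
  rw [hsplit]
  refine add_le_add ((Set.encard_union_le _ _).trans (add_le_add ?_ ?_)) ?_
  · refine (Set.encard_le_encard
      (t := (fun p : (sigmaBead X (unroll h k i)).V × (sigmaBead X (unroll h' k' i)).V =>
      ((beadAt X h q (next^[i] k) p.1, beadAt X h' q (next^[i] k') p.2) :
      (neck X h q).V × (neck X h' q).V)) '' (Set.univ ×ˢ Set.univ)) ?_).trans ?_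
    · rintro x ⟨z, z', -, -, rfl⟩
      exact ⟨(z, z'), by simp, rfl⟩
    · refine (Set.encard_image_le _ _).trans ?_
      rw [Set.encard_prod, Set.encard_univ, Set.encard_univ]
      exact mul_le_mul' (hC _) (hC' _)
  · refine (key (Finset.Icc 1 q) (next^[i] k) (next^[i] k') _ ?_).trans (by simp)
    rintro x ⟨-, s, h0, h1, hs, rfl⟩
    exact ⟨s, h0, h1, by simp; omega, rfl⟩
  · cases i with
    | zero =>
      refine (key ∅ k k' _ ?_).trans (by simp)
      rintro x ⟨i, hi, -⟩
      omega
    | succ i =>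
      refine (key (Finset.Ico q (2 * q)) (next^[i] k) (next^[i] k') _ ?_).trans
        (by simp [two_mul])
      rintro x ⟨i', hi', -, s, h0, h1, hs, rfl⟩
      obtain rfl : i' = i := by omega
      exact ⟨s, h0, h1, by simp; omega, rfl⟩

variable {s : ℕ} {R : Fin s → Monoid.CoprodI.Word G} {n : ℕ}

/-- Removes the assumption that `l` is at most `t` and `t'`. With `m` the minimum of the three,
small cancellation applied in both orders gives `n m < t` and `n m < t'`; so `m` is smaller than
both periods and equals `l`. -/
theorem mul_lt_of_agree (hn : 0 < n) (hC : FreeProductSmallCancellation R (1 / (n : ℝ)))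
    {i j : Fin s} (htt : i = j → t = t') (hh : CycSeq h) (hh' : CycSeq h') (hi : Spells (R i) h)
    (hj : Spells (R j) h') {l : ℕ} (l1 : 1 ≤ l)
    (hfst : ∀ i < l, (unroll h k i).1 = (unroll h' k' i).1)
    (heq : ∀ i, 0 < i → i + 1 < l → unroll h k i = unroll h' k' i) :
    n * l < t ∨ (i = j ∧ ∀ i, unroll h k i = unroll h' k' i) := by
  have conv : ∀ l t : ℕ, (l : ℝ) < 1 / (n : ℝ) * t → n * l < t := by
    intro l t hlt
    have hn' : (0 : ℝ) < n := Nat.cast_pos.2 hn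
    rw [one_div, inv_mul_eq_div, lt_div_iff₀ hn'] at hlt
    rw [mul_comm]
    exact_mod_cast hlt
  have ext : i = j → (∀ i < t, unroll h k i = unroll h' k' i) →
      ∀ i, unroll h k i = unroll h' k' i := by
    intro hij hall m
    obtain rfl := htt hij
    rw [← unroll_mod k, ← unroll_mod k']
    exact hall _ (Nat.mod_lt _ hh.pos)
  set m := min l (min t t') with hm
  have ht := hh.pos
  have ht' := hh'.pos
  have m1 : 1 ≤ m := by omega
  rcases lt_of_agree hC htt hh hh' hi hj k k' m1 (by omega) (by omega)
      (fun i hi => hfst i (by omega)) (fun i h0 h1 => heq i h0 (by omega)) with h1 | ⟨h1, h2⟩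
  swap
  · exact Or.inr ⟨h1, ext h1 h2⟩
  rcases lt_of_agree hC (fun e => (htt e.symm).symm) hh' hh hj hi k' k m1 (by omega) (by omega)
      (fun i hi => (hfst i (by omega)).symm)
      (fun i h0 h1 => (heq i h0 (by omega)).symm) with h3 | ⟨h3, h4⟩
  swap
  · refine Or.inr ⟨h3.symm, ext h3.symm fun i hi => (h4 i ?_).symm⟩
    rwa [← htt h3.symm]
  left
  have c1 := conv _ _ h1
  have c3 := conv _ _ h3
  have d1 : m ≤ n * m := Nat.le_mul_of_pos_left m hn
  have : m = l := by omega
  rwa [← this]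

/-- An overlap in which the two necklaces are traversed in the same direction is either total or
bounded. -/
theorem forward_overlap (hn : 0 < n) (hC : FreeProductSmallCancellation R (1 / (n : ℝ)))
    {i j : Fin s} (htt : i = j → t = t') (hh : CycSeq h) (hh' : CycSeq h') (hi : Spells (R i) h)
    (hj : Spells (R j) h') (hq : 0 < q) {C : ℕ}
    (hB : ∀ k, ENat.card (sigmaBead X (h k)).V ≤ C)
    (hB' : ∀ k, ENat.card (sigmaBead X (h' k)).V ≤ C)
    {p : ℕ} (h0 : 0 < p) (h1 : p < 2 * q)
    (hp : (p ≤ q ∧ (h k).1 = (h' k').1) ∨ (q ≤ p ∧ (h (next k)).1 = (h' (next k')).1)) :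
    (i = j ∧ ∀ i, unroll h k i = unroll h' k' i) ∨
    ∃ l, n * l < t ∧ Confined (neckMap X h q) (neckMap X h' q)
      ((NeckV.string k p h0 h1, NeckV.string k' p h0 h1) : (neck X h q).V × (neck X h' q).V)
      (l * (C * C + 2 * q)) := by
  classical
  by_cases hall : ∀ i, unroll h k i = unroll h' k' i
  · rcases mul_lt_of_agree hn hC htt hh hh' hi hj (k := k) (k' := k') (l := t) hh.pos
      (fun i _ => by rw [hall]) (fun i _ _ => hall i) with hlt | hres
    · have := Nat.le_mul_of_pos_left t hn
      omega
    · exact Or.inl hres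
  right
  push Not at hall
  obtain ⟨e₀, he₀⟩ := hall
  have ht := hh.pos
  have ht' := hh'.pos
  -- A common period of both sequences. The given string is considered at index `T` instead of `0`,
  -- which leaves room for a disagreement on its left.
  set T := t * t' with hT
  have Tpos : 0 < T := Nat.mul_pos ht ht'
  have perh : ∀ c i, unroll h k (i + T * c) = unroll h k i := fun c i => by
    rw [← unroll_mod k, hT, mul_assoc, Nat.add_mul_mod_self_left, unroll_mod]
  have perh' : ∀ c i, unroll h' k' (i + T * c) = unroll h' k' i := fun c i => by
    rw [← unroll_mod k', hT, mul_comm t t', mul_assoc, Nat.add_mul_mod_self_left, unroll_mod]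
  -- the last disagreement before the given string and the first one after it
  obtain ⟨L, hLT, hL, hLmax⟩ : ∃ L, L ≤ T ∧ unroll h k L ≠ unroll h' k' L ∧
      ∀ i, L < i → i ≤ T → unroll h k i = unroll h' k' i := by
    have hex : ∃ d, d ≤ T ∧ unroll h k (T - d) ≠ unroll h' k' (T - d) := by
      have hlt := Nat.mod_lt e₀ Tpos
      refine ⟨T - e₀ % T, by omega, ?_⟩
      rw [show T - (T - e₀ % T) = e₀ % T by omega]
      intro h
      apply he₀
      rw [← Nat.mod_add_div e₀ T, perh, perh', h]
    refine ⟨T - Nat.find hex, by omega, (Nat.find_spec hex).2, fun i hi hi' => ?_⟩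
    by_contra hne
    have := Nat.find_min hex (m := T - i) (by have := (Nat.find_spec hex).1; omega)
    exact this ⟨by omega, by rwa [show T - (T - i) = i by omega]⟩
  obtain ⟨R', hRT, hR, hRmin⟩ : ∃ R', T < R' ∧ unroll h k R' ≠ unroll h' k' R' ∧
      ∀ i, T < i → i < R' → unroll h k i = unroll h' k' i := by
    have hex : ∃ i, T < i ∧ unroll h k i ≠ unroll h' k' i := by
      refine ⟨e₀ + T * 2, by omega, ?_⟩
      rwa [perh, perh']
    refine ⟨Nat.find hex, (Nat.find_spec hex).1, (Nat.find_spec hex).2, fun i hi hi' => ?_⟩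
    by_contra hne
    exact Nat.find_min hex hi' ⟨hi, hne⟩
  have hrun : ∀ i, L < i → i < R' → unroll h k i = unroll h' k' i := fun i h1 h2 => by
    rcases Nat.lt_or_ge T i with h3 | h3
    · exact hRmin i h3 h2
    · exact hLmax i h1 h3
  have hLR : L < R' := by omega
  -- the range of the overlap
  obtain ⟨a, ha1, ha2, ha3⟩ : ∃ a, L ≤ a ∧ a ≤ L + 1 ∧
      ((unroll h k L).1 = (unroll h' k' L).1 ↔ a = L) := by
    by_cases hf : (unroll h k L).1 = (unroll h' k' L).1
    · exact ⟨L, le_rfl, by omega, by simp [hf]⟩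
    · exact ⟨L + 1, by omega, le_rfl, by simp [hf]⟩
  obtain ⟨b, hb1, hb2, hb3⟩ : ∃ b, R' ≤ b ∧ b ≤ R' + 1 ∧
      ((unroll h k R').1 = (unroll h' k' R').1 ↔ b = R' + 1) := by
    by_cases hf : (unroll h k R').1 = (unroll h' k' R').1
    · exact ⟨R' + 1, by omega, le_rfl, by simp [hf]⟩
    · exact ⟨R', by omega, by omega, by simp [hf]⟩
  -- The disagreeing syllables at `L` and `R'` are counted exactly when their factors agree. They
  -- are then the first and the last syllable of the piece, where agreement of factors is enough.
  have hfst : ∀ i, a ≤ i → i < b → (unroll h k i).1 = (unroll h' k' i).1 := by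
    intro i hi hi'
    rcases (ha1.trans hi).eq_or_lt with rfl | g1
    · exact ha3.2 (by omega)
    rcases (show i ≤ R' by omega).eq_or_lt with rfl | g2
    · exact hb3.2 (by omega)
    · rw [hrun i g1 g2]
  have hl : n * (b - a) < t := by
    rcases Nat.eq_zero_or_pos (b - a) with h0 | hpos
    · rw [h0]; simpa using ht
    rcases mul_lt_of_agree hn hC htt hh hh' hi hj (k := next^[a] k) (k' := next^[a] k')
      (l := b - a) hpos
      (fun i hi => by rw [unroll_add, unroll_add]; exact hfst _ (by omega) (by omega))
      (fun i g0 g1 => by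
        rw [unroll_add, unroll_add]; exact hrun _ (by omega) (by omega)) with hlt | ⟨hij, hres⟩
    · exact hlt
    · exfalso
      apply he₀
      have h2 := hres (e₀ + T * a - a)
      have h3 : a ≤ e₀ + T * a := (Nat.le_mul_of_pos_left a Tpos).trans (Nat.le_add_left _ _)
      rw [unroll_add, unroll_add, Nat.add_sub_cancel' h3, perh, perh'] at h2
      exact h2
  refine ⟨b - a, hl, runSet X h h' q k k' L R', ?_, fun x hx y hxy =>
    runSet_closed hh hh' hq hLR hL hR hrun hx hxy, ?_⟩
  · have e1 : next^[T] k = k := by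
      apply Fin.ext
      rw [iterate_next_val, hT, Nat.add_mul_mod_self_left, Nat.mod_eq_of_lt k.2]
    have e2 : next^[T] k' = k' := by
      apply Fin.ext
      rw [iterate_next_val, hT, Nat.add_mul_mod_self_right, Nat.mod_eq_of_lt k'.2]
    have key := mem_runSet_of_string (X := X) hq hLR hrun hLT hRT h1.le (by
      refine hp.imp (fun hp => ⟨hp.1, ?_⟩) (fun hp => ⟨hp.1, ?_⟩)
      · unfold unroll
        rw [e1, e2]
        exact hp.2
      · unfold unroll
        rw [Function.iterate_succ_apply', Function.iterate_succ_apply', e1, e2]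
        exact hp.2)
    rw [neckAt_mid h0 h1, neckAt_mid h0 h1, e1, e2] at key
    exact key
  · have hsub : runSet X h h' q k k' L R' ⊆
        ⋃ i ∈ Finset.Ico a b, runPart X h h' q k k' L R' i := by
      refine Set.biUnion_subset_biUnion_left ?_
      rintro i ⟨g1, g2, g3⟩
      simp only [Finset.coe_Ico, Set.mem_Ico]
      constructor
      · rcases g1.eq_or_lt with rfl | g1
        · exact (ha3.1 g3).le
        · omega
      · rcases g2.eq_or_lt with rfl | g2
        · rw [hb3.1 g3]; omega
        · omega
    refine (Set.encard_le_encard hsub).trans ((Finset.set_encard_biUnion_le _ _).trans ?_)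
    refine (Finset.sum_le_card_nsmul _ _ _ fun i _ => encard_runPart_le hB hB' i).trans ?_
    rw [Nat.card_Ico, nsmul_eq_mul]
    push_cast
    exact le_rfl

/-- The isomorphism is the rotation by the number `c` of steps from `k` to `k'`. -/
theorem exists_isoOver_of_unroll (htt : t = t') (hall : ∀ i, unroll h k i = unroll h' k' i) :
    ∃ f : Hom (neck X h q) (neck X h' q), IsoOver (neckMap X h q) (neckMap X h' q) f ∧
      ∀ s h0 h1, f.onV (.string k s h0 h1) = .string k' s h0 h1 := by
  subst htt
  have reach : ∀ k l : Fin t, ∃ c, next^[c] k = l := by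
    intro k l
    refine ⟨t - k + l, Fin.ext ?_⟩
    have := k.2
    rw [iterate_next_val, show k.1 + (t - k.1 + l.1) = l.1 + t by omega, Nat.add_mod_right,
      Nat.mod_eq_of_lt l.2]
  obtain ⟨c, hc⟩ := reach k k'
  have hinj : Function.Injective (next (t := t))^[c] := next_injective.iterate c
  let e : Fin t ≃ Fin t := Equiv.ofBijective _ (Finite.injective_iff_bijective.1 hinj)
  have he : ∀ x, e x = next^[c] x := fun _ => rfl
  obtain ⟨f, hf, hf'⟩ := exists_rot_isoOver X q h h' e (fun x => by
      rw [he, he, ← Function.iterate_succ_apply, Function.iterate_succ_apply']) (fun x => by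
    obtain ⟨d, rfl⟩ := reach k x
    rw [he, ← Function.iterate_add_apply, add_comm, Function.iterate_add_apply, hc]
    exact (hall d).symm)
  refine ⟨f, hf, fun s h0 h1 => ?_⟩
  rw [hf', he, hc]

theorem neckMap_onV_string (k : Fin t) (p : ℕ) (h0 : 0 < p) (h1 : p < 2 * q) :
    (neckMap X h q).onV (.string k p h0 h1) =
      stringPos q (fun j => (X j).cx) (fun j => (X j).cxBase) (fun k => (h k).1) k p := rfl

/-- Away from the center the image determines the factor and the distance to the center. The center
lies on all arcs, so there the direction is chosen from any factor that the two strings share; the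
last case is that they share none. -/
theorem stringPos_eq_cases {p p' : ℕ} (h0 : 0 < p) (h1 : p < 2 * q) (h0' : 0 < p')
    (h1' : p' < 2 * q)
    (e : stringPos q (fun j => (X j).cx) (fun j => (X j).cxBase) (fun k => (h k).1) k p =
      stringPos q (fun j => (X j).cx) (fun j => (X j).cxBase) (fun k => (h' k).1) k' p') :
    (p = p' ∧ ((p ≤ q ∧ (h k).1 = (h' k').1) ∨ (q ≤ p ∧ (h (next k)).1 = (h' (next k')).1))) ∨
    (p + p' = 2 * q ∧
      ((p ≤ q ∧ (h k).1 = (h' (next k')).1) ∨ (q ≤ p ∧ (h (next k)).1 = (h' k').1))) ∨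
    (p = q ∧ p' = q ∧ (h k).1 ≠ (h' k').1 ∧ (h (next k)).1 ≠ (h' (next k')).1 ∧
      (h k).1 ≠ (h' (next k')).1 ∧ (h (next k)).1 ≠ (h' k').1) := by
  by_cases hpp : p = q ∧ p' = q
  · obtain ⟨rfl, rfl⟩ := hpp
    by_cases g1 : (h k).1 = (h' k').1
    · exact Or.inl ⟨rfl, Or.inl ⟨le_rfl, g1⟩⟩
    by_cases g2 : (h (next k)).1 = (h' (next k')).1
    · exact Or.inl ⟨rfl, Or.inr ⟨le_rfl, g2⟩⟩
    by_cases g3 : (h k).1 = (h' (next k')).1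
    · exact Or.inr (Or.inl ⟨by omega, Or.inl ⟨le_rfl, g3⟩⟩)
    by_cases g4 : (h (next k)).1 = (h' k').1
    · exact Or.inr (Or.inl ⟨by omega, Or.inr ⟨le_rfl, g4⟩⟩)
    exact Or.inr (Or.inr ⟨rfl, rfl, g1, g2, g3, g4⟩)
  unfold stringPos wedgePos at e
  split_ifs at e <;> first | omega | (injection e with e1 e2; first
    | exact Or.inl ⟨by omega, Or.inl ⟨by omega, e1⟩⟩
    | exact Or.inl ⟨by omega, Or.inr ⟨by omega, e1⟩⟩
    | exact Or.inr (Or.inl ⟨by omega, Or.inl ⟨by omega, e1⟩⟩)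
    | exact Or.inr (Or.inl ⟨by omega, Or.inr ⟨by omega, e1⟩⟩))

/-- A pair of centers of strings without common edges. -/
theorem confined_center (hq : 0 < q) (h1 : q < 2 * q)
    (g1 : (h k).1 ≠ (h' k').1) (g2 : (h (next k)).1 ≠ (h' (next k')).1)
    (g3 : (h k).1 ≠ (h' (next k')).1) (g4 : (h (next k)).1 ≠ (h' k').1) :
    Confined (neckMap X h q) (neckMap X h' q)
      ((NeckV.string k q hq h1, NeckV.string k' q hq h1) : (neck X h q).V × (neck X h' q).V) 1 := by
  refine ⟨_, Set.mem_singleton _, ?_, by simp⟩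
  rintro _ rfl y ⟨a, b, hab, e1, -, e2, -⟩
  exfalso
  rcases a with ⟨k₁, a⟩ | ⟨k₁, s, o⟩
  · injection e1
  rcases b with ⟨k₁', b⟩ | ⟨k₁', s', o'⟩
  · injection e2
  rw [src_string] at e1 e2
  have hs := s.2
  have hs' := s'.2
  obtain ⟨rfl, -⟩ := neckAt_eq_string hq (by split_ifs <;> omega) e1
  obtain ⟨rfl, -⟩ := neckAt_eq_string hq (by split_ifs <;> omega) e2
  rw [neckMap_string, neckMap_string] at hab
  rcases stringEdge_eq_cases hab with ⟨-, -, g, -⟩ | ⟨-, -, g, -⟩ | ⟨-, -, g, -⟩ | ⟨-, -, g, -⟩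
  · exact g1 g
  · exact g2 g
  · exact g3 g
  · exact g4 g

/-- An overlap that contains a vertex of a string is either total or bounded. -/
theorem string_overlap (hn : 0 < n) (hC : FreeProductSmallCancellation R (1 / (n : ℝ)))
    {i j : Fin s} (htt : i = j → t = t') (hh : CycSeq h) (hh' : CycSeq h') (hi : Spells (R i) h)
    (hj : Spells (R j) h') {C : ℕ} (hq : t * (C * C) < 2 * q) (hqn : n < q)
    (hB : ∀ k, ENat.card (sigmaBead X (h k)).V ≤ C)
    (hB' : ∀ k, ENat.card (sigmaBead X (h' k)).V ≤ C)
    {p p' : ℕ} (h0 : 0 < p) (h1 : p < 2 * q) (h0' : 0 < p') (h1' : p' < 2 * q)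
    (heq : (neckMap X h q).onV (.string k p h0 h1) = (neckMap X h' q).onV (.string k' p' h0' h1')) :
    (i = j ∧ ∃ f : Hom (neck X h q) (neck X h' q), IsoOver (neckMap X h q) (neckMap X h' q) f ∧
      f.onV (.string k p h0 h1) = .string k' p' h0' h1') ∨
    ∃ N, n * N < 2 * q * t ∧ Confined (neckMap X h q) (neckMap X h' q)
      ((NeckV.string k p h0 h1, NeckV.string k' p' h0' h1') :
        (neck X h q).V × (neck X h' q).V) N := by
  have hq0 : 0 < q := by omega
  -- Since `n l ≤ t - 1`, the strings of the overlap fall short of the systole bound by at least `2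
  -- q`, which exceeds the contribution `t C²` of the beads.
  have bound : ∀ l, n * l < t → n * (l * (C * C + 2 * q)) < 2 * q * t := by
    intro l hl
    calc n * (l * (C * C + 2 * q)) = (n * l) * (C * C) + (n * l) * (2 * q) := by ring
      _ ≤ t * (C * C) + (n * l) * (2 * q) := by gcongr
      _ < 2 * q + (n * l) * (2 * q) := by gcongr
      _ = 2 * q * (n * l + 1) := by ring
      _ ≤ 2 * q * t := by gcongr; omega
  rw [neckMap_onV_string, neckMap_onV_string] at heq
  rcases stringPos_eq_cases h0 h1 h0' h1' heq with ⟨rfl, hp⟩ | ⟨hpp, hp⟩ | ⟨rfl, rfl, g⟩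
  · rcases forward_overlap hn hC htt hh hh' hi hj hq0 hB hB' h0 h1 hp with ⟨hij, hall⟩ | ⟨l, hl, hl'⟩
    · obtain ⟨f, hf, hf'⟩ := exists_isoOver_of_unroll (X := X) (q := q) (htt hij) hall
      exact Or.inl ⟨hij, f, hf, hf' p h0 h1⟩
    · exact Or.inr ⟨_, bound l hl, hl'⟩
  · obtain ⟨m, rfl⟩ := Fin.rev_surjective k'
    obtain ⟨m, rfl⟩ := (Finite.injective_iff_surjective.1 next_injective) m
    have hBf : ∀ k, ENat.card (sigmaBead X (flipSeq h' k)).V ≤ C := by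
      intro k
      have e := (flipBead_isoOver X (h' k.rev)).bijV
      exact (ENat.card_congr (Equiv.ofBijective _ e)).trans_le (hB' _)
    obtain rfl : p' = 2 * q - p := by omega
    have hfl := flipHom_isoOver X q h'
    have hv : (flipHom X q h').onV (.string m p h0 h1) =
        .string (next m).rev (2 * q - p) h0' h1' := rfl
    have hp' : (p ≤ q ∧ (h k).1 = (flipSeq h' m).1) ∨
        (q ≤ p ∧ (h (next k)).1 = (flipSeq h' (next m)).1) := by
      refine hp.imp (fun hp => ⟨hp.1, ?_⟩) id
      rw [hp.2, next_rev_next]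
      rfl
    rcases forward_overlap hn hC htt hh hh'.flip hi hj.flip hq0 hB hBf h0 h1 hp' with
      ⟨hij, hall⟩ | ⟨l, hl, hl'⟩
    · obtain ⟨f, hf, hf'⟩ := exists_isoOver_of_unroll (X := X) (q := q) (htt hij) hall
      refine Or.inl ⟨hij, f.trans (flipHom X q h'), hf.trans hfl, ?_⟩
      change (flipHom X q h').onV (f.onV _) = _
      rw [hf', hv]
    · have := hl'.map hfl
      rw [hv] at this
      exact Or.inr ⟨_, bound l hl, this⟩
  · refine Or.inr ⟨1, ?_, confined_center h0 h1 g.1 g.2.1 g.2.2.1 g.2.2.2⟩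
    have := hh.pos
    calc n * 1 < 2 * p' := by omega
      _ ≤ 2 * p' * t := Nat.le_mul_of_pos_right _ this

end

end CubicalSC

namespace CubicalSC

open CubeCx

/-! ### Diameters of components -/

section Components

variable {W : Type v} {Γ : SimpleGraph W} {c : Γ.ConnectedComponent}

/-- Two vertices are joined by a path without repeated vertices, whose length is less than the
number of vertices. -/
theorem ediam_le_encard (hc : Γ.Connected) {N : ℕ} (h : (Set.univ : Set W).encard ≤ N) :
    Γ.ediam ≤ N := by
  obtain ⟨hfin, -⟩ := Set.encard_le_coe_iff.1 h
  have hF : Finite W := Set.finite_univ_iff.1 hfin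
  have := Fintype.ofFinite W
  refine SimpleGraph.ediam_le_of_edist_le fun u v => ?_
  obtain ⟨p, hp⟩ := (hc u v).exists_isPath
  refine (SimpleGraph.edist_le p).trans (le_trans ?_ h)
  rw [Set.encard_univ, ENat.card_eq_coe_fintype_card]
  exact_mod_cast hp.length_lt.le

theorem pieceDiam_le {N : ℕ} (h : c.supp.encard ≤ N) :
    CubicalPresentation.pieceDiam c ≤ (N : ℝ≥0∞) := by
  have h1 : c.toSimpleGraph.ediam ≤ N := by
    refine ediam_le_encard c.connected_toSimpleGraph ?_
    rw [Set.encard_univ]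
    exact h
  unfold CubicalPresentation.pieceDiam
  calc (c.toSimpleGraph.ediam : ℝ≥0∞) ≤ ((N : ℕ∞) : ℝ≥0∞) := by exact_mod_cast h1
    _ = (N : ℝ≥0∞) := by simp

theorem supp_subset {T : Set W} {x₀ : W} (h₀ : x₀ ∈ c.supp) (hT : x₀ ∈ T)
    (hstep : ∀ x ∈ T, x ∈ c.supp → ∀ y ∈ c.supp, Γ.Adj x y → y ∈ T) : c.supp ⊆ T := by
  intro y hy
  obtain ⟨p⟩ := SimpleGraph.ConnectedComponent.exact
    (((SimpleGraph.ConnectedComponent.mem_supp_iff _ _).1 h₀).trans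
      ((SimpleGraph.ConnectedComponent.mem_supp_iff _ _).1 hy).symm)
  clear hy
  induction p with
  | nil => exact hT
  | cons hadj p ih =>
    have h1 := (SimpleGraph.ConnectedComponent.mem_supp_congr_adj _ hadj).1 h₀
    exact ih h1 (hstep _ hT h₀ _ h1 hadj)

theorem encard_subtype_le {α : Type*} {p : α → Prop} {A : Set {x // p x}} {S : Set α}
    (h : ∀ x ∈ A, x.1 ∈ S) : A.encard ≤ S.encard := by
  rw [← Subtype.val_injective.encard_image A]
  refine Set.encard_le_encard ?_
  rintro _ ⟨x, hx, rfl⟩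
  exact h x hx

theorem lt_ofReal_mul {n N M : ℕ} (hn : 0 < n) (h : n * N < M) {a b : ℝ≥0∞} (ha : a ≤ N)
    (hb : (M : ℝ≥0∞) ≤ b) : a < ENNReal.ofReal (1 / (n : ℝ)) * b := by
  have hn' : (0 : ℝ) < n := Nat.cast_pos.2 hn
  have h' : (N : ℝ) < 1 / (n : ℝ) * M := by
    rw [one_div, inv_mul_eq_div, lt_div_iff₀ hn', mul_comm]
    exact_mod_cast h
  calc a ≤ (N : ℝ≥0∞) := ha
    _ = ENNReal.ofReal N := (ENNReal.ofReal_natCast N).symm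
    _ < ENNReal.ofReal (1 / (n : ℝ) * M) :=
      (ENNReal.ofReal_lt_ofReal_iff_of_nonneg (Nat.cast_nonneg _)).2 h'
    _ = ENNReal.ofReal (1 / (n : ℝ)) * M := by
      rw [ENNReal.ofReal_mul (by positivity), ENNReal.ofReal_natCast]
    _ ≤ _ := by gcongr

end Components

theorem PairAdj.symm {C D Z : CubeCx.{v}} {M : Hom C Z} {N : Hom D Z} {x y : C.V × D.V}
    (h : PairAdj M N x y) : PairAdj M N y x := by
  obtain ⟨a, b, hab, h1, h2, h3, h4⟩ := h
  refine ⟨C.inv a, D.inv b, ?_, h2, ?_, h4, ?_⟩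
  · rw [← M.inv_comp, ← N.inv_comp, hab]
  · rw [tgt_inv, h1]
  · rw [tgt_inv, h3]

/-! ### From lifts to the universal cover back to maps over `X` -/

namespace CubicalPresentation

variable {P : CubicalPresentation.{v}} {i j : P.I} {f : P.Lift i} {g : P.Lift j}

theorem map_eq_of_coneInter (x : {x : (P.Y i).V × (P.Y j).V // f.onV x.1 = g.onV x.2}) :
    (P.map i).onV x.1.1 = (P.map j).onV x.1.2 := by
  rw [← f.lift_V, ← g.lift_V, x.2]

/-- Projecting to `X` may only create further adjacencies, so a bound for the fibre product over `X`
bounds the components of intersections of lifts. -/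
theorem pairAdj_of_coneInter {x y : {x : (P.Y i).V × (P.Y j).V // f.onV x.1 = g.onV x.2}}
    (h : (P.coneInter f g).Adj x y) : PairAdj (P.map i) (P.map j) x.1 y.1 := by
  have key : ∀ x y : {x : (P.Y i).V × (P.Y j).V // f.onV x.1 = g.onV x.2},
      (∃ (a : (P.Y i).E) (b : (P.Y j).E), f.onE a = g.onE b ∧
        (P.Y i).src a = x.1.1 ∧ (P.Y i).tgt a = y.1.1 ∧
        (P.Y j).src b = x.1.2 ∧ (P.Y j).tgt b = y.1.2) →
      PairAdj (P.map i) (P.map j) x.1 y.1 := by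
    rintro x y ⟨a, b, hab, h⟩
    exact ⟨a, b, by rw [← f.lift_E, ← g.lift_E, hab], h⟩
  rcases ((SimpleGraph.fromRel_adj _ _ _).1 h).2 with h | h
  · exact key _ _ h
  · exact (key _ _ h).symm

theorem sameLift_of_isoOver {f g : P.Lift i} {c : (P.coneInter f g).ConnectedComponent}
    {φ : Hom (P.Y i) (P.Y i)} (hφ : IsoOver (P.map i) (P.map i) φ)
    {x : {x : (P.Y i).V × (P.Y i).V // f.onV x.1 = g.onV x.2}} (hx : x ∈ c.supp)
    (h : φ.onV x.1.1 = x.1.2) : P.SameLift c :=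
  ⟨φ.onV, P.isAut_of_isoOver hφ, x, hx, by rw [h]⟩

/-- In the complement of the dual edges, the carrier of a hyperplane consists of sides of
squares. -/
theorem exists_sq_of_wallInter {e : P.cubicalPart.E} (he : P.WallDisjoint f e)
    {x y : {y : (P.Y i).V // P.cubicalPart.CarrierV e (f.onV y)}}
    (h : (P.wallInter f e).Adj x y) :
    ∃ d : (P.Y i).E, (∃ a b c, P.X.sq ((P.map i).onE d) a b c) ∧
      (P.Y i).src d = x.1 ∧ (P.Y i).tgt d = y.1 := by
  have key : ∀ d : (P.Y i).E, P.cubicalPart.CarrierE e (f.onE d) →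
      ∃ a b c, P.X.sq ((P.map i).onE d) a b c := by
    rintro d (hd | ⟨b, d', b', hsq, -⟩)
    · exact absurd hd (he d)
    · have := (P.X.coverProj P.ConePath P.base).sq_comp hsq
      rw [f.lift_E] at this
      exact ⟨_, _, _, this⟩
  rcases ((SimpleGraph.fromRel_adj _ _ _).1 h).2 with ⟨d, hd, h1, h2⟩ | ⟨d, hd, h1, h2⟩
  · exact ⟨d, key d hd, h1, h2⟩
  · obtain ⟨a, b, c, hs⟩ := key d hd
    refine ⟨(P.Y i).inv d, ?_, h2, ?_⟩
    · rw [← (P.map i).inv_comp]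
      exact ⟨_, _, _, P.X.sq_flip hs⟩
    · rw [tgt_inv, h1]

end CubicalPresentation

/-! ### Bounds for cone-pieces and wall-pieces -/

section Final

variable {r s : ℕ} {G : Fin r → Type u} [∀ j, Group (G j)] {X : ∀ j, NPCComplex.{u, v} (G j)}

/-- A string has `2 q ≥ 2` edges, so none of them joins two vertices of beads. -/
theorem bead_eq_of_edge {t q : ℕ} {h : Fin t → Σ j, G j} (hq : 0 < q) {k k' : Fin t}
    {z : (sigmaBead X (h k)).V} {z' : (sigmaBead X (h k')).V} {a : (neck X h q).E}
    (h1 : (neck X h q).src a = beadAt X h q k z) (h2 : (neck X h q).tgt a = beadAt X h q k' z') :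
    k = k' := by
  rcases a with ⟨k₁, a⟩ | ⟨k₁, p, o⟩
  · injection h1 with h1
    injection h2 with h2
    exact h1.symm.trans h2
  · exfalso
    have hp := p.2
    rw [src_string] at h1
    rw [tgt_string] at h2
    cases o
    · rcases neckAt_eq_beadAt hq (by simp only [Bool.false_eq_true, if_false]; omega) h1
        with ⟨h3, -⟩ | ⟨h3, -⟩ <;>
      rcases neckAt_eq_beadAt hq (by simp only [Bool.false_eq_true, if_false]; omega) h2
        with ⟨h4, -⟩ | ⟨h4, -⟩ <;>
      simp only [Bool.false_eq_true, if_false] at h3 h4 <;> omega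
    · rcases neckAt_eq_beadAt hq (by simp only [if_true]; omega) h1
        with ⟨h3, -⟩ | ⟨h3, -⟩ <;>
      rcases neckAt_eq_beadAt hq (by simp only [if_true]; omega) h2
        with ⟨h4, -⟩ | ⟨h4, -⟩ <;>
      simp only [if_true] at h3 h4 <;> omega

/-- Ensures that an overlap pairs interior string vertices only with interior string vertices, and
bead vertices only with bead vertices. -/
theorem stringPos_ne_pt {t q : ℕ} {h : Fin t → Σ j, G j} {k : Fin t} {p : ℕ} (h0 : 0 < p)
    (h1 : p < 2 * q) (j : Fin r) (x : (X j).cx.V) :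
    stringPos q (fun j => (X j).cx) (fun j => (X j).cxBase) (fun k => (h k).1) k p ≠ .pt j x := by
  intro e
  unfold stringPos wedgePos at e
  split_ifs at e <;> omega

variable {R : Fin s → Monoid.CoprodI.Word G} {n q C : ℕ}

theorem conePiece_lt (hR : ∀ i, CyclicallyReduced (R i)) (hn : 0 < n)
    (hC : FreeProductSmallCancellation R (1 / (n : ℝ)))
    (hB : ∀ i (k : Fin (R i).toList.length),
      ENat.card (sigmaBead X ((R i).toList.get k)).V ≤ C)
    (hq1 : ∀ i, (R i).toList.length * (C * C) < 2 * q) (hq2 : n < q) (hq3 : n * (C * C) < 2 * q)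
    (i j : Fin s) (f : (associatedPresentation X R q).Lift i)
    (g : (associatedPresentation X R q).Lift j)
    (c : ((associatedPresentation X R q).coneInter f g).ConnectedComponent)
    (hc : ¬ (associatedPresentation X R q).SameLift c) :
    CubicalPresentation.pieceDiam c <
      ENNReal.ofReal (1 / (n : ℝ)) * ((associatedPresentation X R q).Y i).systole := by
  have hq : 0 < q := by omega
  have hcyc := fun i => cycSeq_of_cyclicallyReduced (hR i)
  have hsys := le_systole_neck X (R i).toList.get q
  suffices H : ∃ N, n * N < 2 * q * (R i).toList.length ∧ c.supp.encard ≤ (N : ℕ) by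
    obtain ⟨N, h1, h2⟩ := H
    exact lt_ofReal_mul hn h1 (pieceDiam_le h2) hsys
  by_cases hstr : ∃ x ∈ c.supp, ∃ k p h0 h1,
      x.1.1 = (NeckV.string k p h0 h1 : (neck X (R i).toList.get q).V)
  · obtain ⟨⟨⟨x, x'⟩, hxx⟩, hx, k, p, h0, h1, e1⟩ := hstr
    have e1 : x = (NeckV.string k p h0 h1 : (neck X (R i).toList.get q).V) := e1
    subst e1
    have heq := CubicalPresentation.map_eq_of_coneInter ⟨_, hxx⟩
    rcases x' with ⟨k', z⟩ | ⟨k', p', h0', h1'⟩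
    · exact absurd heq (stringPos_ne_pt (h := (R i).toList.get) h0 h1 _ _)
    rcases string_overlap hn hC (fun e : i = j => by rw [e]) (hcyc i) (hcyc j) (spells_self _)
      (spells_self _) (hq1 i) hq2 (hB i) (hB j) h0 h1 h0' h1' heq with
      ⟨rfl, φ, hφ, hφ'⟩ | ⟨N, hN, S, hS, hcl, hcard⟩
    · exact absurd (CubicalPresentation.sameLift_of_isoOver
        (P := associatedPresentation X R q) hφ hx hφ') hc
    · refine ⟨N, hN, (encard_subtype_le ?_).trans hcard⟩
      exact supp_subset (T := Subtype.val ⁻¹' S) hx hS fun x hx _ y _ hadj =>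
        hcl x.1 hx y.1 (CubicalPresentation.pairAdj_of_coneInter hadj)
  · push Not at hstr
    have hbead : ∀ x ∈ c.supp, ∃ k z k' z', x.1.1 = beadAt X (R i).toList.get q k z ∧
        x.1.2 = beadAt X (R j).toList.get q k' z' := by
      rintro ⟨⟨x, x'⟩, hxx⟩ hx
      have heq := CubicalPresentation.map_eq_of_coneInter ⟨_, hxx⟩
      rcases x with ⟨k, z⟩ | ⟨k, p, h0, h1⟩
      · rcases x' with ⟨k', z'⟩ | ⟨k', p', h0', h1'⟩
        · exact ⟨k, z, k', z', rfl, rfl⟩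
        · exact absurd heq.symm (stringPos_ne_pt (h := (R j).toList.get) h0' h1' _ _)
      · exact absurd rfl (hstr _ hx k p h0 h1)
    obtain ⟨x₀, hx₀⟩ := c.nonempty_supp
    obtain ⟨k, z, k', z', e, e'⟩ := hbead x₀ hx₀
    let F : (sigmaBead X ((R i).toList.get k)).V × (sigmaBead X ((R j).toList.get k')).V →
      (neck X (R i).toList.get q).V × (neck X (R j).toList.get q).V := fun p =>
        (beadAt X (R i).toList.get q k p.1, beadAt X (R j).toList.get q k' p.2)
    -- Without string vertices the component cannot leave the product of two beads.
    refine ⟨C * C, ?_, (encard_subtype_le (S := F '' (Set.univ ×ˢ Set.univ)) ?_).trans ?_⟩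
    · exact hq3.trans_le (Nat.le_mul_of_pos_right _ (hcyc i).pos)
    · refine supp_subset (T := {x | x.1 ∈ F '' (Set.univ ×ˢ Set.univ)}) hx₀
        ⟨(z, z'), by simp, Prod.ext e.symm e'.symm⟩ ?_
      rintro x ⟨⟨w, w'⟩, -, hw⟩ _ y hy hadj
      obtain ⟨l, v, l', v', g1, g2⟩ := hbead y hy
      obtain ⟨a, b, -, a1, a2, b1, b2⟩ := CubicalPresentation.pairAdj_of_coneInter hadj
      rw [← hw] at a1 b1
      rw [g1] at a2
      rw [g2] at b2
      obtain rfl := bead_eq_of_edge (X := X) (h := (R i).toList.get) hq a1 a2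
      obtain rfl := bead_eq_of_edge (X := X) (h := (R j).toList.get) hq b1 b2
      exact ⟨(v, v'), by simp, Prod.ext g1.symm g2.symm⟩
    · refine (Set.encard_image_le _ _).trans ?_
      rw [Set.encard_prod, Set.encard_univ, Set.encard_univ]
      push_cast
      exact mul_le_mul' (hB i k) (hB j k')

/-- All squares of the long wedge lie in the complexes of the factors, so string edges are not sides
of squares. Hence a component that meets a bead stays in it, and any other component is a single
string vertex. -/
theorem wallPiece_lt (hR : ∀ i, CyclicallyReduced (R i)) (hn : 0 < n) (hCpos : 0 < C)
    (hB : ∀ i (k : Fin (R i).toList.length),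
      ENat.card (sigmaBead X ((R i).toList.get k)).V ≤ C)
    (hq : n * C < 2 * q) (i : Fin s) (f : (associatedPresentation X R q).Lift i)
    (e : (associatedPresentation X R q).cubicalPart.E)
    (he : (associatedPresentation X R q).WallDisjoint f e)
    (c : ((associatedPresentation X R q).wallInter f e).ConnectedComponent) :
    CubicalPresentation.pieceDiam c <
      ENNReal.ofReal (1 / (n : ℝ)) * ((associatedPresentation X R q).Y i).systole := by
  have hpos := (cycSeq_of_cyclicallyReduced (hR i)).pos
  refine lt_ofReal_mul (N := C) hn (hq.trans_le (Nat.le_mul_of_pos_right _ hpos))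
    (pieceDiam_le ?_) (le_systole_neck X (R i).toList.get q)
  have hedge : ∀ x y, ((associatedPresentation X R q).wallInter f e).Adj x y →
      ∃ k z z', x.1 = beadAt X (R i).toList.get q k z ∧
        y.1 = beadAt X (R i).toList.get q k z' := by
    intro x y hadj
    obtain ⟨d, ⟨a, b, c, hs⟩, h1, h2⟩ := CubicalPresentation.exists_sq_of_wallInter he hadj
    rcases d with ⟨k, d⟩ | ⟨k, p, o⟩
    · exact ⟨k, _, _, h1.symm, h2.symm⟩
    · exfalso
      have hs' : WedgeSq (fun j => (X j).cx) q
        (stringEdge q (fun j => (X j).cx) (fun k => ((R i).toList.get k).1) k p o) a b c := hs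
      generalize hE : stringEdge q (fun j => (X j).cx) (fun k => ((R i).toList.get k).1) k p o = E
        at hs'
      obtain ⟨j, -⟩ := hs'
      unfold stringEdge at hE
      split_ifs at hE
  obtain ⟨x₀, hx₀⟩ := c.nonempty_supp
  by_cases hb : ∃ k z, x₀.1 = beadAt X (R i).toList.get q k z
  · obtain ⟨k, z, hz⟩ := hb
    refine (encard_subtype_le (S := beadAt X (R i).toList.get q k '' Set.univ) ?_).trans
      ((Set.encard_image_le _ _).trans (by rw [Set.encard_univ]; exact hB i k))
    refine supp_subset (T := {x | x.1 ∈ beadAt X (R i).toList.get q k '' Set.univ}) hx₀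
      ⟨z, trivial, hz.symm⟩ ?_
    rintro x ⟨w, -, hw⟩ _ y _ hadj
    obtain ⟨k', v, v', g1, g2⟩ := hedge x y hadj
    have hkk : k = k' := by
      have := hw.trans g1
      injection this
    subst hkk
    exact ⟨v', trivial, g2.symm⟩
  · refine (Set.encard_le_encard (t := {x₀}) ?_).trans ?_
    · refine supp_subset hx₀ rfl ?_
      rintro x rfl _ y _ hadj
      obtain ⟨k', v, v', g1, g2⟩ := hedge _ y hadj
      exact absurd ⟨k', v, g1⟩ hb
    · rw [Set.encard_singleton]
      exact_mod_cast hCpos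

end Final

end CubicalSC

end

/-! ### The choice of `q₀` -/

theorem lemma5p1 {r s : ℕ} {G : Fin r → Type u} [∀ j, Group (G j)]
    (X : ∀ j, CubicalSC.NPCComplex.{u, v} (G j))
    (R : Fin s → Monoid.CoprodI.Word G) (hR : ∀ i, CubicalSC.CyclicallyReduced (R i))
    (n : ℕ) (hn : 0 < n)
    (hC : CubicalSC.FreeProductSmallCancellation R (1 / (n : ℝ))) :
    ∃ q₀ : ℕ, ∀ q : ℕ, q₀ ≤ q →
      (CubicalSC.associatedPresentation X R q).SmallCancellation (1 / (n : ℝ)) := by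
  obtain ⟨C, hCb⟩ := Finite.exists_le fun p : Σ i : Fin s, Fin (R i).toList.length =>
    Nat.card (CubicalSC.sigmaBead X ((R p.1).toList.get p.2)).V
  obtain ⟨T, hT⟩ := Finite.exists_le fun i : Fin s => (R i).toList.length
  have hB : ∀ i (k : Fin (R i).toList.length),
      ENat.card (CubicalSC.sigmaBead X ((R i).toList.get k)).V ≤ (C + 1 : ℕ) := by
    intro i k
    have := CubicalSC.finite_bead X ((R i).toList.get k)
    rw [ENat.card_eq_coe_natCard]
    exact_mod_cast (hCb ⟨i, k⟩).trans (Nat.le_succ C)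
  -- With `C + 1 > 0` as the bound for beads, this number exceeds `n`, `n (C + 1)`, `n (C + 1)²` and
  -- `t (C + 1)²` for every syllable length `t ≤ T`; these are the lower bounds on `q` or `2 q` that
  -- the estimates require.
  refine ⟨(n + T) * ((C + 1) * (C + 1)) + 1, fun q hq i f => ⟨fun j g c hc => ?_, fun e he c => ?_⟩⟩
  · have h1 : ∀ i, (R i).toList.length * ((C + 1) * (C + 1)) ≤ (n + T) * ((C + 1) * (C + 1)) :=
      fun i => Nat.mul_le_mul_right _ ((hT i).trans (Nat.le_add_left _ _))
    have h2 : n * ((C + 1) * (C + 1)) ≤ (n + T) * ((C + 1) * (C + 1)) :=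
      Nat.mul_le_mul_right _ (Nat.le_add_right _ _)
    have h3 : n ≤ n * ((C + 1) * (C + 1)) := Nat.le_mul_of_pos_right _ (by positivity)
    exact CubicalSC.conePiece_lt hR hn hC hB (fun i => by have := h1 i; omega) (by omega)
      (by omega) i j f g c hc
  · have h2 : n * (C + 1) ≤ (n + T) * ((C + 1) * (C + 1)) :=
      Nat.mul_le_mul (Nat.le_add_right _ _) (Nat.le_mul_of_pos_right _ (by positivity))
    exact CubicalSC.wallPiece_lt (C := C + 1) hR hn C.succ_pos hB (by omega) i f e he c
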